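/- Let $n\ge 2$, $a_1,\dots,a_n\in\mathbb C\setminus\{0\}$, fix square roots $\sqrt{a_j^{-1}}$, put $A=\mathrm{diag}[a_1^{-1},\dots,a_n^{-1}]$ and use the bilinear product $x^Ty$, $|x|^2=x^Tx$ on $\mathbb C^p$. All functions are holomorphic; $\delta=\mathrm{diag}[du^1,\dots,du^n]$. The diagonal quadric without center $\sum_j a_j^{-1}(x^j)^2=2x^{n+1}$ in $\mathbb C^{n+1}$ is parametrized by $x_0(V)=(v^1/\sqrt{a_1^{-1}},\dots,v^n/\sqrt{a_n^{-1}},|V|^2/2)$, $V=(v^1,\dots,v^n)$. *Definitions.* An isometric deformation of $x_0$ on an open $U\subset\mathbb C^n$ is a pair $V:U\to\mathbb C^n$, $x:U\to\mathbb C^{2n-1}$ such that $|dx|^2=|d(x_0\circ V)|^2$ is non-degenerate, the coordinates $u^1,\dots,u^n$ are conjugate on both $x$ and $x_0\circ V$ (for $j\ne k$ the second derivative $\partial_{u^j}\partial_{u^k}$ is tangent), and the joined second fundamental forms are non-degenerate: if $N,N_0$ are normal to $x$, $x_0\circ V$ at a point and $N^Td^2x+N_0^Td^2(x_0\circ V)=0$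 there, then $N=0$, $N_0=0$. It is a *Peterson deformation* if its frame is $R=I_n$, i.e. $\partial_{u^j}V$ is a multiple of $e_j$ for every $j$. For $R:U\to\mathbf O_n(\mathbb C)$ put $\omega=\omega(R)=\sum_j(e_je_j^TR^T\partial_{u^j}R\,\delta+\delta R^T\partial_{u^j}R\,e_je_j^T)$ and consider $$dV=R\delta\Lambda,\quad d\Lambda=\omega\Lambda-\delta R^TAV,\quad \Lambda^T\Lambda=-(V^TAV+1),\qquad(1)$$ $$d\omega-\omega\wedge\omega=-\delta R^TAR\wedge\delta,\quad \omega\wedge\delta-\delta\wedge R^TdR=0.\qquad(2)$$ A *datum* on $U$ consists of $R$, $(V,\Lambda)$, $(V_l,\Lambda_l)$ for $l=1,\dots,2n-1$, and $x$, such that (2) and (1) hold, each $(V_l,\Lambda_l)$ satisfies the two differential equations of (1), $V_l^TAV_m+\Lambda_l^T\Lambda_m=\delta_{lm}$, $V_l^TAV+\Lambda_l^T\Lambda=0$, and $dx^l=V_l^TdV$. It is *realized* if moreover $(V,x)$ is an isometric deformation of $x_0$ on every open subset of $U$ on which $|\Lambda|^2$ and all components of $\Lambda$ are nowhere zero. A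 spectral parameter is $z\in\mathbb C\setminus\{0,a_1,\dots,a_n\}$ with chosen square roots $\sqrt z$, $\sqrt{R_z}=\mathrm{diag}[\sqrt{1-za_j^{-1}}]$; $D=\sqrt{R_z}/\sqrt z=\mathrm{diag}[d_1,\dots,d_n]$. Given a datum with index $0$ and an orthogonal solution $R_1$ of the Riccati equation $$dR_1=-R_1\omega_0+R_1\delta R_0^TDR_1-DR_0\delta,\qquad(3)$$ its *leaf* is $R_1$, $V_1=\sqrt{R_z}V_0+\sqrt zR_1\Lambda_0$, $\Lambda_1=\sqrt zR_0^T(DR_1\Lambda_0-AV_0)$, the frame pairs transformed by the same formulas, and $(x^1)^l=(x^0)^l+V_l^T(\sqrt{R_z}V_1-V_0)$. A datum $1$ is a *Bäcklund transform* $B_z$ of a datum $0$ if (3) holds, $\sqrt zR_1\Lambda_0=V_1-\sqrt{R_z}V_0$, $\sqrt zR_0\Lambda_1=\sqrt{R_z}V_1-V_0$ and likewise for the frame pairs, $|\sqrt{R_z}V_1-V_0|^2=-z(V_1^TAV_1+1)$, the formula for $x^1$ holds, and $(x^0)^l=(x^1)^l+V_{l,1}^T(\sqrt{R_z}V_0-V_1)$,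 where $V_{l,1}$ are the frame vectors of datum $1$. **Theorem.** (i) *Peterson deformations.* On a connected open $U$, $(V,\Lambda)$ solves (1) with $R=I_n$, $\omega=0$ iff there are constants with $v^j=c_1^je^{i\sqrt{a_j^{-1}}u^j}+c_2^je^{-i\sqrt{a_j^{-1}}u^j}$, $\lambda_j=i\sqrt{a_j^{-1}}(c_1^je^{i\sqrt{a_j^{-1}}u^j}-c_2^je^{-i\sqrt{a_j^{-1}}u^j})$, $\sum_j2a_j^{-1}(c_1^jc_2^j+c_2^jc_1^j)=-1$. Let $(V,\Lambda)$ be such a solution with all $\lambda_j$ nowhere zero, $(V_l,\Lambda_l)$ solutions of the differential equations of (1) with $R=I_n$, and $x$ with $dx^l=V_l^TdV$, $|dx|^2=|d(x_0\circ V)|^2$. Then $V_l,\Lambda_l$ have the same form with constants $c_{l1}^j,c_{l2}^j$, $$x^l=\sum_j\Big[\tfrac12\big(c_{l1}^jc_1^je^{2i\sqrt{a_j^{-1}}u^j}+c_{l2}^jc_2^je^{-2i\sqrt{a_j^{-1}}u^j}\big)+i\sqrt{a_j^{-1}}(c_{l2}^jc_1^j-c_{l1}^jc_2^j)u^j\Big]+c^l,\qquad(4)$$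 and $$\sum_j2a_j^{-1}(c_{l1}^jc_{m2}^j+c_{l2}^jc_{m1}^j)=\delta_{lm},\quad \sum_j2a_j^{-1}(c_{l1}^jc_2^j+c_{l2}^jc_1^j)=0,\quad \sum_j2a_j^{-1}(c_1^jc_2^j+c_2^jc_1^j)=-1.\qquad(5)$$ Conversely, all constants satisfying (5) give in this way, with $R=I_n$, a realized datum on $\mathbb C^n$, and $(V,x)$ is a Peterson deformation on every open set where $|\Lambda|^2$ and all $\lambda_j$ are nowhere zero. Every Peterson deformation has, near each point and after replacing each $u^j$ by a function $\varphi_j(u^j)$ with $\varphi_j'\ne0$, the form above for some constants satisfying (5). (ii) *Bäcklund transforms.* For $R_0=I_n$ equation (3) is $dR_1=R_1\delta DR_1-D\delta$. On a connected open $U\ni u_0$, a function $R_1$ with $\det(R_1(u_0)-I_n)\ne0$ is a solution iff there is a unique constant matrix $(\zeta_{jk})$ such that on $U$ the matrix $Z$ with $z_{jj}=-\frac12+(\zeta_{jj}+\frac12)e^{-2d_ju^j}$, $z_{jk}=\zeta_{jk}e^{-d_ju^j-d_ku^k}$ $(j\neq k)$ is invertible and $R_1=I_n+Z^{-1}$;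 every value $M$ at $u_0$ with $\det(M-I_n)\ne0$ is attained for exactly one $\zeta$. Where $Z$ is invertible, $I_n+Z^{-1}$ is orthogonal iff $\zeta_{jj}=-\frac12$ and $\zeta_{jk}=-\zeta_{kj}$ for $j\ne k$. Any solution on a connected open set that is orthogonal at one point is orthogonal everywhere. For any datum of (i) with constants satisfying (5), and any orthogonal solution $R_1$ on an open $U$, the leaf is a realized datum on $U$ and a Bäcklund transform $B_z$ of it. In (iii)–(v) fix such a seed datum $0$ and an open $U$; $R_1,R_2,R_4$ (or $R^{(i)}$) are orthogonal solutions on $U$ of the equation in (ii) for spectral parameters $z_1,z_2,z_3$ (or $z_i$) with matrices $D_1,D_2,D_3$ (or $D_i$). (iii) *Bianchi Permutability.* If $D_2R_2R_1^T-D_1$ is invertible on $U$, then $R_3=(D_2-D_1R_2R_1^T)(D_2R_2R_1^T-D_1)^{-1}$ is orthogonal, and the $z_2$-leaf of datum $1$ and the $z_1$-leaf of datum $2$ defined by $R_3$ coincide on $U$ and are a realized datum that is $B_{z_2}$ of datum $1$ and $B_{z_1}$ of datum $2$. (iv) *3-moving Möbius configuration.* Let $R_5$, $R_6$ be obtained from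 $(R_1,R_4)$, $(R_2,R_4)$ as $R_3$ from $(R_1,R_2)$, all inverted matrices and $\Box=(D_2^2-D_3^2)D_1R_1+(D_3^2-D_1^2)D_2R_2+(D_1^2-D_2^2)D_3R_4$ being invertible on $U$; data $3,5,6$ are the corresponding leaves. Then $D_2R_3-D_3R_5$ and $D_3R_6-D_1R_3$ are invertible, there is $R_7$ with $$D_1D_2D_3R_7=D_1[(D_2^2-D_3^2)D_2R_3(D_2R_3-D_3R_5)^{-1}R_1-D_2^2R_1]$$ $$=(D_1^2D_2R_2-D_2^2D_1R_1)\Box^{-1}(D_2^2-D_3^2)(D_3R_4-D_1R_1)-D_2^2D_1R_1$$ $$=(D_1^2D_2R_2-D_2^2D_1R_1)\Box^{-1}(D_3^2-D_1^2)(D_2R_2-D_3R_4)-D_1^2D_2R_2$$ $$=D_2[(D_3^2-D_1^2)D_1R_3(D_3R_6-D_1R_3)^{-1}R_2-D_1^2R_2],$$ $R_7$ is orthogonal, and the leaves of datum $3$ (with $z_3$), $5$ (with $z_2$) and $6$ (with $z_1$) defined by $R_7$ coincide on $U$ and are a realized datum that is $B_{z_3}$, $B_{z_2}$, $B_{z_1}$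 of data $3$, $5$, $6$. (v) *Iteration.* Let $N\ge 0$ and let $R^{(i)}$, $z_i$ $(i=1,\dots,N)$ be given. For lists of distinct indices define $R_{\emptyset}=I_n$, $R_{(i)}=R^{(i)}$ and $R_{(i,j,l)}=(D_i-D_jR_{(i,l)}R_{(j,l)}^T)(D_iR_{(i,l)}R_{(j,l)}^T-D_j)^{-1}R_{(l)}$, and let the datum of $(i,l)$ be the $z_i$-leaf of the datum of $(l)$ defined by $R_{(i,l)}$, starting with the seed. If all inverted matrices are invertible on $U$, then each of these data is realized on $U$, the datum of $(i,l)$ is $B_{z_i}$ of the datum of $(l)$, and the data do not depend on the order of the indices. (vi) *Arbitrarily many constants.* For every $N$, all spectral parameters with pairwise distinct $z_1,\dots,z_N$ and every $u_0$ there is $\varepsilon>0$ such that for all skew-symmetric $K_1,\dots,K_N\in\mathbf M_n(\mathbb C)$ with entries of modulus $<\varepsilon$ the explicit solutions $R^{(i)}=I_n+Z_i^{-1}$ with $\zeta^{(i)}=K_i-\frac12I_n$ exist and satisfy the invertibility hypotheses of (v) on the ball $\max_j|u^j-u_0^j|<\varepsilon$; and for a list containing $i$, with the other $K_j$ fixed,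 the value of its rotation at any point of the ball determines $K_i$. -/

import Mathlib

open Matrix

noncomputable section

namespace Peterson

/-- Points of `ℂⁿ` (the coordinates `u`, and also the vectors `V`, `Λ`).  All products `⬝ᵥ` below are
the complex bilinear ones `xᵀ y`. -/
abbrev Pt (n : ℕ) := Fin n → ℂ

/-- Complex `n × n` matrices. -/
abbrev Mat (n : ℕ) := Matrix (Fin n) (Fin n) ℂ

/-- The partial derivative `∂f/∂uʲ`. -/
def pd {n : ℕ} {F : Type*} [NormedAddCommGroup F] [NormedSpace ℂ F] (j : Fin n) (f : Pt n → F)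
    (u : Pt n) : F :=
  fderiv ℂ f u (Pi.single j 1)

/-- The partial derivative of a matrix valued function, entry by entry. -/
def pdM {n : ℕ} (j : Fin n) (R : Pt n → Mat n) (u : Pt n) : Mat n :=
  Matrix.of fun k l => pd j (fun w => R w k l) u

/-- A matrix valued function is holomorphic on `U`: all its entries are. -/
def HolM {n : ℕ} (U : Set (Pt n)) (R : Pt n → Mat n) : Prop :=
  ∀ k l, AnalyticOnNhd ℂ (fun w => R w k l) U

/-- Complex orthogonality of a matrix. -/
def IsOrth {n : ℕ} (R : Mat n) : Prop := Rᵀ * R = 1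

/-- `e_j e_jᵀ`, the coefficient of `duʲ` in the matrix one-form `δ = diag[du¹ … duⁿ]`. -/
def E {n : ℕ} (j : Fin n) : Mat n := Matrix.single j j 1

/-- The (upper left block of the) matrix `A = diag[a₁⁻¹ … aₙ⁻¹]` of the quadric. -/
def quadA {n : ℕ} (a : Fin n → ℂ) : Mat n := Matrix.diagonal fun j => (a j)⁻¹

/-- The point `x₀ = L Z(v) = (√a₁ v¹, …, √aₙ vⁿ, |v|²/2)` of the diagonal quadric without center
`∑ aⱼ⁻¹ (xʲ)² = 2 xⁿ⁺¹` in `ℂⁿ⁺¹`; here `α j` is the chosen square root of `(a j)⁻¹`. -/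
def quadricPoint {n : ℕ} (α : Fin n → ℂ) (v : Pt n) : Fin (n + 1) → ℂ :=
  Fin.snoc (α := fun _ => ℂ) (fun j => v j / α j) ((v ⬝ᵥ v) / 2)

/-! Geometry -/

/-- `x : U → ℂ²ⁿ⁻¹` is an isometric deformation of the piece `x₀ ∘ V` of the quadric, with common
conjugate system `u` and non-degenerate joined second fundamental forms (the induced metric is assumed
non-degenerate).  The last field says that the second fundamental forms `Nᵀ d²x` of `x` together with
`N₀ᵀ d²x₀` of `x₀` are linearly independent. -/
structure IsIsometricDeformation {n : ℕ} (α : Fin n → ℂ) (U : Set (Pt n)) (V : Pt n → Pt n)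
    (x : Pt n → (Fin (2 * n - 1) → ℂ)) : Prop where
  hol_V : AnalyticOnNhd ℂ V U
  hol_x : AnalyticOnNhd ℂ x U
  isometric : ∀ u ∈ U, ∀ j k : Fin n,
    pd j x u ⬝ᵥ pd k x u
      = pd j (fun w => quadricPoint α (V w)) u ⬝ᵥ pd k (fun w => quadricPoint α (V w)) u
  metric_nondegenerate : ∀ u ∈ U,
    (Matrix.of fun j k : Fin n =>
      pd j (fun w => quadricPoint α (V w)) u ⬝ᵥ pd k (fun w => quadricPoint α (V w)) u).det ≠ 0
  conjugate : ∀ u ∈ U, ∀ j k : Fin n, j ≠ k →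
    pd j (pd k x) u ∈ Submodule.span ℂ (Set.range fun i : Fin n => pd i x u)
  conjugate_quadric : ∀ u ∈ U, ∀ j k : Fin n, j ≠ k →
    pd j (pd k fun w => quadricPoint α (V w)) u
      ∈ Submodule.span ℂ (Set.range fun i : Fin n => pd i (fun w => quadricPoint α (V w)) u)
  joined_nondegenerate : ∀ u ∈ U, ∀ (N : Fin (2 * n - 1) → ℂ) (N₀ : Fin (n + 1) → ℂ),
    (∀ j : Fin n, N ⬝ᵥ pd j x u = 0) →
    (∀ j : Fin n, N₀ ⬝ᵥ pd j (fun w => quadricPoint α (V w)) u = 0) →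
    (∀ j k : Fin n,
      N ⬝ᵥ pd j (pd k x) u + N₀ ⬝ᵥ pd j (pd k fun w => quadricPoint α (V w)) u = 0) →
    N = 0 ∧ N₀ = 0

/-- Peterson's isometric deformations: the orthogonal frame `R` of `dV = R δ Λ` is `Iₙ`, that is
`∂V/∂uʲ` is a multiple of `e_j`. -/
structure IsPeterson {n : ℕ} (α : Fin n → ℂ) (U : Set (Pt n)) (V : Pt n → Pt n)
    (x : Pt n → (Fin (2 * n - 1) → ℂ)) : Prop extends IsIsometricDeformation α U V x where
  frame_one : ∀ u ∈ U, ∀ j k : Fin n, k ≠ j → pd j V u k = 0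

/-! The differential system of isometric deformations of the quadric -/

/-- The coefficient of `duʲ` in `ω = ∑ₖ (eₖ eₖᵀ Rᵀ ∂ₖR δ + δ Rᵀ ∂ₖR eₖ eₖᵀ)`. -/
def omega {n : ℕ} (R : Pt n → Mat n) (j : Fin n) (u : Pt n) : Mat n :=
  ∑ k, (E k * (R u)ᵀ * pdM k R u * E j + E j * (R u)ᵀ * pdM k R u * E k)

/-- `R` is orthogonal and satisfies
`dω - ω ∧ ω = - δ Rᵀ A R ∧ δ`, `ω ∧ δ - δ ∧ Rᵀ dR = 0`. -/
structure IsCompatible {n : ℕ} (a : Fin n → ℂ) (U : Set (Pt n)) (R : Pt n → Mat n) : Prop where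
  hol : HolM U R
  orth : ∀ u ∈ U, IsOrth (R u)
  gauss : ∀ u ∈ U, ∀ j k : Fin n,
    pdM j (omega R k) u - pdM k (omega R j) u - (omega R j u * omega R k u - omega R k u * omega R j u)
      = -(E j * (R u)ᵀ * quadA a * R u * E k - E k * (R u)ᵀ * quadA a * R u * E j)
  codazzi : ∀ u ∈ U, ∀ j k : Fin n,
    (omega R j u * E k - omega R k u * E j)
      - (E j * (R u)ᵀ * pdM k R u - E k * (R u)ᵀ * pdM j R u) = 0

/-- The differential part `dV = R δ Λ`, `dΛ = ω Λ - δ Rᵀ A V`. -/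
structure IsLinearSolution {n : ℕ} (a : Fin n → ℂ) (U : Set (Pt n)) (R : Pt n → Mat n)
    (V L : Pt n → Pt n) : Prop where
  hol_V : AnalyticOnNhd ℂ V U
  hol_L : AnalyticOnNhd ℂ L U
  dV : ∀ u ∈ U, ∀ j : Fin n, pd j V u = (R u * E j) *ᵥ L u
  dL : ∀ u ∈ U, ∀ j : Fin n,
    pd j L u = omega R j u *ᵥ L u - (E j * (R u)ᵀ * quadA a) *ᵥ V u

/-- The full system: `dV = R δ Λ`, `dΛ = ω Λ - δ Rᵀ A V`, `Λᵀ Λ = -(Vᵀ A V + 1)`. -/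
structure IsVLSolution {n : ℕ} (a : Fin n → ℂ) (U : Set (Pt n)) (R : Pt n → Mat n)
    (V L : Pt n → Pt n) : Prop extends IsLinearSolution a U R V L where
  prime_integral : ∀ u ∈ U, L u ⬝ᵥ L u = -(V u ⬝ᵥ quadA a *ᵥ V u + 1)

/-- The data of an isometric deformation of the quadric together with its moving frame: the rotation
`R`, the pair `(V, Λ)`, the pairs `(V_l, Λ_l)`, `l = 1, …, 2n-1`, and the space realization `x`. -/
structure Datum (n : ℕ) where
  R : Pt n → Mat n
  V : Pt n → Pt n
  L : Pt n → Pt n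
  frameV : Fin (2 * n - 1) → Pt n → Pt n
  frameL : Fin (2 * n - 1) → Pt n → Pt n
  x : Pt n → (Fin (2 * n - 1) → ℂ)

/-- Two data coincide on `U`. -/
def Datum.AgreeOn {n : ℕ} (U : Set (Pt n)) (S T : Datum n) : Prop :=
  ∀ u ∈ U, S.R u = T.R u ∧ S.V u = T.V u ∧ S.L u = T.L u ∧
    (∀ l, S.frameV l u = T.frameV l u) ∧ (∀ l, S.frameL l u = T.frameL l u) ∧ S.x u = T.x u

/-- The datum satisfies the whole system: `R` satisfies the compatibility condition, `(V, Λ)` is a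
solution associated to `R`, the `(V_l, Λ_l)` are solutions of the differential part with the
orthonormality relations, and `dx = [V_1 … V_{2n-1}]ᵀ dV`. -/
structure IsDeformationDatum {n : ℕ} (a : Fin n → ℂ) (U : Set (Pt n)) (S : Datum n) : Prop where
  compatible : IsCompatible a U S.R
  solution : IsVLSolution a U S.R S.V S.L
  frame_solution : ∀ l, IsLinearSolution a U S.R (S.frameV l) (S.frameL l)
  frame_orthonormal : ∀ u ∈ U, ∀ l m,
    S.frameV l u ⬝ᵥ quadA a *ᵥ S.frameV m u + S.frameL l u ⬝ᵥ S.frameL m u = if l = m then 1 else 0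
  frame_orthogonal : ∀ u ∈ U, ∀ l,
    S.frameV l u ⬝ᵥ quadA a *ᵥ S.V u + S.frameL l u ⬝ᵥ S.L u = 0
  hol_x : AnalyticOnNhd ℂ S.x U
  dx : ∀ u ∈ U, ∀ (j : Fin n) l, pd j S.x u l = S.frameV l u ⬝ᵥ pd j S.V u

/-- Points where `λ_j ≠ 0` for all `j` and `|Λ|² ≠ 0` (the induced metric is non-degenerate). -/
def Datum.RegularOn {n : ℕ} (U : Set (Pt n)) (S : Datum n) : Prop :=
  ∀ u ∈ U, (∀ j, S.L u j ≠ 0) ∧ S.L u ⬝ᵥ S.L u ≠ 0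

/-- The datum solves the system on `U` and, on the regular part of `U`, its `x` is an isometric
deformation of the piece `x₀ ∘ V` of the quadric. -/
def IsRealized {n : ℕ} (a α : Fin n → ℂ) (U : Set (Pt n)) (S : Datum n) : Prop :=
  IsDeformationDatum a U S ∧
    ∀ U' ⊆ U, IsOpen U' → S.RegularOn U' → IsIsometricDeformation α U' S.V S.x

/-! Explicit Peterson deformations -/

/-- `vʲ = b₁ʲ exp(i √aⱼ⁻¹ uʲ) + b₂ʲ exp(-i √aⱼ⁻¹ uʲ)`. -/
def expV {n : ℕ} (α b₁ b₂ : Fin n → ℂ) (u : Pt n) : Pt n := fun j =>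
  b₁ j * Complex.exp (Complex.I * α j * u j) + b₂ j * Complex.exp (-(Complex.I * α j * u j))

/-- `λ_j = i √aⱼ⁻¹ (b₁ʲ exp(i √aⱼ⁻¹ uʲ) - b₂ʲ exp(-i √aⱼ⁻¹ uʲ))`. -/
def expL {n : ℕ} (α b₁ b₂ : Fin n → ℂ) (u : Pt n) : Pt n := fun j =>
  Complex.I * α j * (b₁ j * Complex.exp (Complex.I * α j * u j)
    - b₂ j * Complex.exp (-(Complex.I * α j * u j)))

/-- The constants `c₁ʲ, c₂ʲ, c_{l1}ʲ, c_{l2}ʲ, cˡ`. -/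
structure Constants (n : ℕ) where
  c₁ : Fin n → ℂ
  c₂ : Fin n → ℂ
  f₁ : Fin (2 * n - 1) → Fin n → ℂ
  f₂ : Fin (2 * n - 1) → Fin n → ℂ
  t : Fin (2 * n - 1) → ℂ

/-- The quadratic system for the constants. -/
structure Constants.Admissible {n : ℕ} (a : Fin n → ℂ) (c : Constants n) : Prop where
  frame_frame : ∀ l m, ∑ j, 2 * (a j)⁻¹ * (c.f₁ l j * c.f₂ m j + c.f₂ l j * c.f₁ m j)
    = if l = m then 1 else 0
  frame_seed : ∀ l, ∑ j, 2 * (a j)⁻¹ * (c.f₁ l j * c.c₂ j + c.f₂ l j * c.c₁ j) = 0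
  seed_seed : ∑ j, 2 * (a j)⁻¹ * (c.c₁ j * c.c₂ j + c.c₂ j * c.c₁ j) = -1

/-- The explicit space realization `x(u)`. -/
def petersonX {n : ℕ} (α : Fin n → ℂ) (c : Constants n) (u : Pt n) : Fin (2 * n - 1) → ℂ := fun l =>
  ∑ j, (1 / 2 * (c.f₁ l j * c.c₁ j * Complex.exp (2 * Complex.I * α j * u j)
        + c.f₂ l j * c.c₂ j * Complex.exp (-(2 * Complex.I * α j * u j)))
      + Complex.I * α j * (c.f₂ l j * c.c₁ j - c.f₁ l j * c.c₂ j) * u j) + c.t l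

/-- The explicit Peterson deformation with given constants. -/
def petersonDatum {n : ℕ} (α : Fin n → ℂ) (c : Constants n) : Datum n where
  R := fun _ => 1
  V := expV α c.c₁ c.c₂
  L := expL α c.c₁ c.c₂
  frameV := fun l => expV α (c.f₁ l) (c.f₂ l)
  frameL := fun l => expL α (c.f₁ l) (c.f₂ l)
  x := petersonX α c

/-! Bäcklund transformation -/

/-- A spectral parameter `z ≠ 0, aⱼ`, with a square root `s` of `z` and `d_j = √(1 - z aⱼ⁻¹) / s`
(any choice of the square roots is allowed). -/
structure SpectralParam {n : ℕ} (a : Fin n → ℂ) where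
  z : ℂ
  s : ℂ
  d : Fin n → ℂ
  z_ne_zero : z ≠ 0
  z_ne : ∀ j, z ≠ a j
  s_sq : s ^ 2 = z
  d_sq : ∀ j, (s * d j) ^ 2 = 1 - z * (a j)⁻¹

/-- `D = √R_z / √z`. -/
def SpectralParam.D {n : ℕ} {a : Fin n → ℂ} (p : SpectralParam a) : Mat n := Matrix.diagonal p.d

/-- `√R_z = √z D`. -/
def SpectralParam.sqrtR {n : ℕ} {a : Fin n → ℂ} (p : SpectralParam a) : Mat n := p.s • p.D

/-- The Riccati equation `dR₁ = -R₁ ω₀ + R₁ δ R₀ᵀ D R₁ - D R₀ δ`. -/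
structure IsRiccati {n : ℕ} {a : Fin n → ℂ} (p : SpectralParam a) (U : Set (Pt n))
    (R₀ R₁ : Pt n → Mat n) : Prop where
  hol : HolM U R₁
  eqn : ∀ u ∈ U, ∀ j : Fin n, pdM j R₁ u
    = -(R₁ u * omega R₀ j u) + R₁ u * E j * (R₀ u)ᵀ * p.D * R₁ u - p.D * R₀ u * E j

/-- The Riccati equation with constant coefficients `dR₁ = R₁ δ D R₁ - D δ`. -/
structure IsPetersonRiccati {n : ℕ} {a : Fin n → ℂ} (p : SpectralParam a) (U : Set (Pt n))
    (R₁ : Pt n → Mat n) : Prop where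
  hol : HolM U R₁
  eqn : ∀ u ∈ U, ∀ j : Fin n, pdM j R₁ u = R₁ u * E j * p.D * R₁ u - p.D * E j

/-- The matrix `Z` with `z_jj = -1/2 + (ζ_jj + 1/2) exp(-2 d_j uʲ)` and
`z_jk = ζ_jk exp(-d_j uʲ - d_k uᵏ)` for `j ≠ k`; `ζ = Z(0)`. -/
def expZ {n : ℕ} {a : Fin n → ℂ} (p : SpectralParam a) (ζ : Mat n) (u : Pt n) : Mat n :=
  Matrix.of fun j k =>
    if j = k then -1 / 2 + (ζ j j + 1 / 2) * Complex.exp (-(2 * p.d j * u j))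
    else ζ j k * Complex.exp (-(p.d j * u j) - p.d k * u k)

/-- `R₁ = Iₙ + Z⁻¹`. -/
def explicitR {n : ℕ} {a : Fin n → ℂ} (p : SpectralParam a) (ζ : Mat n) (u : Pt n) : Mat n :=
  1 + (expZ p ζ u)⁻¹

/-- The leaf obtained from a datum `S` and a solution `R₁` of the Riccati equation:
`V₁ = √R_z V₀ + √z R₁ Λ₀`, `Λ₁ = √z R₀ᵀ (-A V₀ + D R₁ Λ₀)`, the same for the frame, and
`x¹ = x⁰ + [∂x⁰/∂v₀¹ … ∂x⁰/∂v₀ⁿ] (√R_z V₁ - V₀)`, where `∂x⁰/∂v₀ʲ` has the entries `(V_l)ʲ`. -/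
def backlund {n : ℕ} {a : Fin n → ℂ} (p : SpectralParam a) (S : Datum n) (R₁ : Pt n → Mat n) :
    Datum n where
  R := R₁
  V := fun u => p.sqrtR *ᵥ S.V u + p.s • (R₁ u *ᵥ S.L u)
  L := fun u => p.s • ((S.R u)ᵀ *ᵥ (-(quadA a *ᵥ S.V u) + (p.D * R₁ u) *ᵥ S.L u))
  frameV := fun l u => p.sqrtR *ᵥ S.frameV l u + p.s • (R₁ u *ᵥ S.frameL l u)
  frameL := fun l u =>
    p.s • ((S.R u)ᵀ *ᵥ (-(quadA a *ᵥ S.frameV l u) + (p.D * R₁ u) *ᵥ S.frameL l u))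
  x := fun u l => S.x u l
    + S.frameV l u ⬝ᵥ (p.sqrtR *ᵥ (p.sqrtR *ᵥ S.V u + p.s • (R₁ u *ᵥ S.L u)) - S.V u)

/-- `T` is a Bäcklund transform `B_z` of `S`: the rotation of `T` solves the Riccati equation of `S`,
the two are related by `√z R₁ Λ₀ = V₁ - √R_z V₀`, `√z R₀ Λ₁ = √R_z V₁ - V₀` (also for the frames),
the points of the quadric are in the symmetric tangency configuration, and the segment from `x⁰` to
`x¹` is tangent to both submanifolds. -/
structure IsBacklundTransform {n : ℕ} {a : Fin n → ℂ} (p : SpectralParam a) (U : Set (Pt n))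
    (S T : Datum n) : Prop where
  riccati : IsRiccati p U S.R T.R
  left : ∀ u ∈ U, p.s • (T.R u *ᵥ S.L u) = T.V u - p.sqrtR *ᵥ S.V u
  right : ∀ u ∈ U, p.s • (S.R u *ᵥ T.L u) = p.sqrtR *ᵥ T.V u - S.V u
  frame_left : ∀ u ∈ U, ∀ l,
    p.s • (T.R u *ᵥ S.frameL l u) = T.frameV l u - p.sqrtR *ᵥ S.frameV l u
  frame_right : ∀ u ∈ U, ∀ l,
    p.s • (S.R u *ᵥ T.frameL l u) = p.sqrtR *ᵥ T.frameV l u - S.frameV l u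
  tangency : ∀ u ∈ U,
    (p.sqrtR *ᵥ T.V u - S.V u) ⬝ᵥ (p.sqrtR *ᵥ T.V u - S.V u)
      = -(p.z * (T.V u ⬝ᵥ quadA a *ᵥ T.V u + 1))
  segment : ∀ u ∈ U, ∀ l, T.x u l = S.x u l + S.frameV l u ⬝ᵥ (p.sqrtR *ᵥ T.V u - S.V u)
  segment_back : ∀ u ∈ U, ∀ l, S.x u l = T.x u l + T.frameV l u ⬝ᵥ (p.sqrtR *ᵥ S.V u - T.V u)

/-! Iteration -/

/-- `(D₂ - D₁ R₂ R₁ᵀ)(D₂ R₂ R₁ᵀ - D₁)⁻¹`. -/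
def bianchi {n : ℕ} (D₁ D₂ R₁ R₂ : Mat n) : Mat n :=
  (D₂ - D₁ * R₂ * R₁ᵀ) * (D₂ * R₂ * R₁ᵀ - D₁)⁻¹

/-- `□ = (D₂² - D₃²) D₁ R₁ + (D₃² - D₁²) D₂ R₂ + (D₁² - D₂²) D₃ R₄`. -/
def box {n : ℕ} (D₁ D₂ D₃ R₁ R₂ R₄ : Mat n) : Mat n :=
  (D₂ ^ 2 - D₃ ^ 2) * D₁ * R₁ + (D₃ ^ 2 - D₁ ^ 2) * D₂ * R₂ + (D₁ ^ 2 - D₂ ^ 2) * D₃ * R₄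

/-- Iterated algebraic formula for the rotations.  The seed has rotation `Iₙ`, its transforms are the
given `R i`; the rotation attached to `i :: j :: l` comes from those attached to `l`, `j :: l`, `i :: l`
by the Bianchi formula, relative to the rotation attached to `l`. -/
def iterR {n : ℕ} {a : Fin n → ℂ} {ι : Type} (p : ι → SpectralParam a) (R : ι → Pt n → Mat n) :
    List ι → Pt n → Mat n
  | [] => fun _ => 1
  | [i] => R i
  | i :: j :: l => fun u =>
      bianchi (p j).D (p i).D (iterR p R (j :: l) u) (iterR p R (i :: l) u) * iterR p R l u
termination_by l => l.length

/-- The iterated Bäcklund transform of the seed `S` along a list of indices, by algebra only. -/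
def iterDatum {n : ℕ} {a : Fin n → ℂ} {ι : Type} (p : ι → SpectralParam a) (S : Datum n)
    (R : ι → Pt n → Mat n) : List ι → Datum n
  | [] => S
  | i :: l => backlund (p i) (iterDatum p S R l) (iterR p R (i :: l))

/-- All the matrices that are inverted in the iteration are invertible on `U`. -/
def IterNondegenerate {n : ℕ} {a : Fin n → ℂ} {ι : Type} (p : ι → SpectralParam a)
    (R : ι → Pt n → Mat n) (U : Set (Pt n)) : Prop :=
  ∀ (i j : ι) (l : List ι), (i :: j :: l).Nodup → ∀ u ∈ U,
    ((p i).D * iterR p R (i :: l) u * (iterR p R (j :: l) u)ᵀ - (p j).D).det ≠ 0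

end Peterson

end

/-! A pair (V, Λ) is a vector of ℂ²ⁿ with the bilinear form diag[A, 1]. The 2n - 1 frame pairs and
i(V, Λ) form an orthonormal basis. A square matrix with a left inverse has the same right inverse,
so the dual relations `FrameGram` hold as well, in particular ∑ V_l V_lᵀ - V Vᵀ = A⁻¹. The quadric
carries the metric dVᵀ(A⁻¹ + V Vᵀ)dV, hence dx = [V_l]ᵀ dV is isometric to it. Orthogonality of R
makes the ∂_jV mutually orthogonal, which gives conjugacy, and the orthonormal basis gives
non-degeneracy of the joined second fundamental forms. Realizing a datum therefore amounts to
solving the differential system (`IsDeformationDatum.isRealized`).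

For R = I the system splits into n independent oscillators, solved by exponentials. Conversely, on a
Peterson deformation the mixed derivatives of x vanish, so X_j = ∂x/∂vʲ depends on uʲ alone. The
curves (X_j, vʲ) are mutually orthogonal and lie on the quadrics X·X - v² = a_j. Since their
positions and velocities span the whole space, each curve stays in a plane, so it is a conic with an
exponential parametrization (`exists_exponential_coordinates`).

The Bäcklund theory rests on the identity D² + A = z⁻¹I. It makes the leaf an orthogonal map of (V,
Λ) (`leaf_invariant`), so all quadratic relations persist, and it turns the Riccati equation into
the compatibility conditions of the new rotation (`IsRiccati.isCompatible`) and of the new linear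
system (`IsLinearSolution.leaf`). Two matrices D² differ by a scalar, which commutes with every
rotation. This yields orthogonality of the Bianchi rotation (`bianchi_isOrth`), its Riccati equation
(`bianchi_isRiccati`) and the equality of the two leaves (`second_leafV`, `second_leafL`,
`second_leaf_x`). For three parameters the last rotation has a formula in □ that is symmetric enough
to show that all faces of the cube agree (`third_transform_comm`). Reordering a longer list is
generated by exchanges of neighbours: the exchange of the first two entries is `bianchi_comm`, the
next one is the cube, and deeper ones follow by recursion.

Over R = I the matrix Z = (R₁ - I)⁻¹ satisfies an affine linear equation with diagonal coefficients,
which is integrated entry by entry, and orthogonality becomes Z + Zᵀ + I = 0. For K = 0 every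
initial rotation is -I, and the matrices to be inverted are D_i - D_j, invertible for distinct
parameters; continuity covers small K and u near u₀. Injectivity in K_i follows because the Bianchi
formula can be solved for one of its arguments. -/

namespace Peterson

variable {n : ℕ}

/-! ### Partial derivatives of holomorphic functions on ℂⁿ. -/

section Calculus

variable {F : Type*} [NormedAddCommGroup F] [NormedSpace ℂ F]

theorem pd_congr {U : Set (Pt n)} (hU : IsOpen U) {f g : Pt n → F} (h : ∀ u ∈ U, f u = g u)
    {u : Pt n} (hu : u ∈ U) (j : Fin n) : pd j f u = pd j g u := by
  unfold pd
  rw [Filter.EventuallyEq.fderiv_eq (Filter.eventuallyEq_of_mem (hU.mem_nhds hu) h)]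

theorem pd_const (c : F) (u : Pt n) (j : Fin n) : pd j (fun _ => c) u = 0 := by
  simp [pd]

theorem pd_add {f g : Pt n → F} {u : Pt n} (hf : DifferentiableAt ℂ f u)
    (hg : DifferentiableAt ℂ g u) (j : Fin n) :
    pd j (fun w => f w + g w) u = pd j f u + pd j g u := by
  simp [pd, fderiv_fun_add hf hg]

theorem pd_sub {f g : Pt n → F} {u : Pt n} (hf : DifferentiableAt ℂ f u)
    (hg : DifferentiableAt ℂ g u) (j : Fin n) :
    pd j (fun w => f w - g w) u = pd j f u - pd j g u := by
  simp [pd, fderiv_fun_sub hf hg]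

theorem pd_neg (f : Pt n → F) (u : Pt n) (j : Fin n) :
    pd j (fun w => -f w) u = -pd j f u := by
  simp [pd, fderiv_fun_neg]

theorem pd_smul_const {f : Pt n → F} {u : Pt n} (hf : DifferentiableAt ℂ f u) (c : ℂ) (j : Fin n) :
    pd j (fun w => c • f w) u = c • pd j f u := by
  simp [pd, fderiv_fun_const_smul hf]

theorem pd_mul {f g : Pt n → ℂ} {u : Pt n} (hf : DifferentiableAt ℂ f u)
    (hg : DifferentiableAt ℂ g u) (j : Fin n) :
    pd j (fun w => f w * g w) u = pd j f u * g u + f u * pd j g u := by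
  simp only [pd, fderiv_fun_mul hf hg]
  simp
  ring

theorem pd_sum {ι : Type*} (s : Finset ι) {f : ι → Pt n → F} {u : Pt n}
    (hf : ∀ i ∈ s, DifferentiableAt ℂ (f i) u) (j : Fin n) :
    pd j (fun w => ∑ i ∈ s, f i w) u = ∑ i ∈ s, pd j (f i) u := by
  simp only [pd, fderiv_fun_sum hf, _root_.sum_apply]

theorem pd_apply {ι : Type*} [Fintype ι] {f : Pt n → ι → ℂ} {u : Pt n}
    (hf : DifferentiableAt ℂ f u) (j : Fin n) (k : ι) :
    pd j f u k = pd j (fun w => f w k) u := by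
  unfold pd
  rw [fderiv_pi (fun i => (differentiableAt_pi.1 hf i))]
  rfl

theorem pd_coord (u : Pt n) (j k : Fin n) :
    pd j (fun w => w k) u = if k = j then 1 else 0 := by
  unfold pd
  have : (fun w : Pt n => w k) = ContinuousLinearMap.proj (R := ℂ) (φ := fun _ => ℂ) k := rfl
  rw [this, ContinuousLinearMap.fderiv]
  simp [Pi.single_apply]

/-- The chain rule for a function of one variable. -/
theorem pd_comp {g : ℂ → ℂ} {f : Pt n → ℂ} {u : Pt n} {g' : ℂ} (hg : HasDerivAt g g' (f u))
    (hf : DifferentiableAt ℂ f u) (j : Fin n) :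
    pd j (fun w => g (f w)) u = g' * pd j f u := by
  have := hg.comp_hasFDerivAt u hf.hasFDerivAt
  unfold pd
  have h2 : fderiv ℂ (fun w => g (f w)) u = g' • fderiv ℂ f u := this.fderiv
  rw [h2]; simp

theorem pd_cexp {f : Pt n → ℂ} {u : Pt n} (hf : DifferentiableAt ℂ f u) (j : Fin n) :
    pd j (fun w => Complex.exp (f w)) u = Complex.exp (f u) * pd j f u :=
  pd_comp (Complex.hasDerivAt_exp _) hf j

theorem pd_comm [CompleteSpace F] {f : Pt n → F} {u : Pt n} (hf : AnalyticAt ℂ f u) (j k : Fin n) :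
    pd j (pd k f) u = pd k (pd j f) u := by
  have hs : IsSymmSndFDerivAt ℂ f u :=
    ContDiffAt.isSymmSndFDerivAt (n := ⊤) (hf.contDiffAt) (by simp)
  have hd : DifferentiableAt ℂ (fderiv ℂ f) u := by
    have h2 : ContDiffAt ℂ 2 f u := hf.contDiffAt
    exact (h2.fderiv_right (m := 1) (by norm_num)).differentiableAt (by norm_num)
  have key : ∀ j k : Fin n, pd j (pd k f) u
      = fderiv ℂ (fderiv ℂ f) u (Pi.single j 1) (Pi.single k 1) := by
    intro j k
    unfold pd
    rw [fderiv_clm_apply hd (differentiableAt_const _)]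
    simp
  rw [key, key, hs.eq]

theorem fderiv_eq_sum_pd (f : Pt n → F) (u v : Pt n) : fderiv ℂ f u v = ∑ j, v j • pd j f u := by
  have hv : v = ∑ j, v j • (Pi.single j (1 : ℂ) : Pt n) := by
    ext k
    simp [Finset.sum_apply, Pi.single_apply]
  conv_lhs => rw [hv]
  simp [pd, map_sum]

theorem fderiv_eq_zero_of_pd {f : Pt n → F} {u : Pt n} (h : ∀ j, pd j f u = 0) :
    fderiv ℂ f u = 0 := by
  ext v
  simp [fderiv_eq_sum_pd, h]

theorem eq_of_pd_eq_zero {U : Set (Pt n)} (hU : IsOpen U) (hc : IsPreconnected U) {f : Pt n → F}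
    (hf : ∀ u ∈ U, DifferentiableAt ℂ f u) (h : ∀ u ∈ U, ∀ j, pd j f u = 0) {u v : Pt n}
    (hu : u ∈ U) (hv : v ∈ U) : f u = f v :=
  hU.is_const_of_fderiv_eq_zero (𝕜 := ℂ) hc (fun u hu => (hf u hu).differentiableWithinAt)
    (fun u hu => fderiv_eq_zero_of_pd (h u hu)) hu hv

theorem analyticOnNhd_pd {U : Set (Pt n)} [CompleteSpace F] {f : Pt n → F}
    (hf : AnalyticOnNhd ℂ f U) (j : Fin n) : AnalyticOnNhd ℂ (pd j f) U := by
  have h := hf.fderiv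
  intro u hu
  exact ((ContinuousLinearMap.apply ℂ F (Pi.single j 1 : Pt n)).analyticAt _).comp (h u hu)

theorem analyticOnNhd_apply {ι : Type*} [Fintype ι] {U : Set (Pt n)} {f : Pt n → ι → ℂ}
    (hf : AnalyticOnNhd ℂ f U) (k : ι) : AnalyticOnNhd ℂ (fun w => f w k) U := by
  intro u hu
  exact ((ContinuousLinearMap.proj (R := ℂ) (φ := fun _ : ι => ℂ) k).analyticAt _).comp (hf u hu)

theorem analyticOnNhd_vec {ι : Type*} [Fintype ι] {U : Set (Pt n)} {f : Pt n → ι → ℂ}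
    (hf : ∀ k, AnalyticOnNhd ℂ (fun w => f w k) U) : AnalyticOnNhd ℂ f U :=
  fun u hu => AnalyticAt.pi (fun k => hf k u hu)

theorem analyticOnNhd_coord (U : Set (Pt n)) (k : Fin n) : AnalyticOnNhd ℂ (fun w : Pt n => w k) U :=
  fun u _ => (ContinuousLinearMap.proj (R := ℂ) (φ := fun _ : Fin n => ℂ) k).analyticAt u

theorem analyticOnNhd_congr {U : Set (Pt n)} (hU : IsOpen U) {f g : Pt n → F}
    (hf : AnalyticOnNhd ℂ f U) (h : ∀ u ∈ U, f u = g u) : AnalyticOnNhd ℂ g U :=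
  fun u hu => (hf u hu).congr (Filter.eventuallyEq_of_mem (hU.mem_nhds hu) h)

theorem pd_dotProduct {ι : Type*} [Fintype ι] {f g : Pt n → ι → ℂ} {u : Pt n}
    (hf : DifferentiableAt ℂ f u) (hg : DifferentiableAt ℂ g u) (j : Fin n) :
    pd j (fun w => f w ⬝ᵥ g w) u = pd j f u ⬝ᵥ g u + f u ⬝ᵥ pd j g u := by
  have hf' := differentiableAt_pi.1 hf
  have hg' := differentiableAt_pi.1 hg
  simp only [dotProduct]
  rw [pd_sum _ (fun i _ => (hf' i).fun_mul (hg' i)), ← Finset.sum_add_distrib]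
  refine Finset.sum_congr rfl fun i _ => ?_
  rw [pd_mul (hf' i) (hg' i), pd_apply hf, pd_apply hg]

theorem analyticOnNhd_dotProduct {ι : Type*} [Fintype ι] {U : Set (Pt n)} {f g : Pt n → ι → ℂ}
    (hf : AnalyticOnNhd ℂ f U) (hg : AnalyticOnNhd ℂ g U) :
    AnalyticOnNhd ℂ (fun w => f w ⬝ᵥ g w) U := by
  simp only [dotProduct]
  intro u hu
  exact Finset.analyticAt_fun_sum _ fun i _ =>
    (analyticOnNhd_apply hf i u hu).mul (analyticOnNhd_apply hg i u hu)

end Calculus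

/-! ### Calculus of matrix valued holomorphic functions. -/

section MatrixCalculus

variable {U : Set (Pt n)}

theorem HolM.differentiableAt {R : Pt n → Mat n} (h : HolM U R) {u : Pt n} (hu : u ∈ U)
    (k l : Fin n) : DifferentiableAt ℂ (fun w => R w k l) u :=
  (h k l u hu).differentiableAt

theorem HolM.const (M : Mat n) : HolM U (fun _ => M) := fun _ _ => analyticOnNhd_const

theorem HolM.mono {U' : Set (Pt n)} {R : Pt n → Mat n} (h : HolM U R) (hs : U' ⊆ U) : HolM U' R :=
  fun k l => (h k l).mono hs

theorem HolM.mul {R S : Pt n → Mat n} (hR : HolM U R) (hS : HolM U S) :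
    HolM U (fun w => R w * S w) := by
  intro k l
  simp only [Matrix.mul_apply]
  intro u hu
  exact Finset.analyticAt_fun_sum _ fun i _ => (hR k i u hu).mul (hS i l u hu)

theorem HolM.add {R S : Pt n → Mat n} (hR : HolM U R) (hS : HolM U S) :
    HolM U (fun w => R w + S w) := fun k l => (hR k l).add (hS k l)

theorem HolM.sub {R S : Pt n → Mat n} (hR : HolM U R) (hS : HolM U S) :
    HolM U (fun w => R w - S w) := fun k l => (hR k l).sub (hS k l)

theorem HolM.neg {R : Pt n → Mat n} (hR : HolM U R) : HolM U (fun w => -R w) :=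
  fun k l => (hR k l).neg

theorem HolM.transpose {R : Pt n → Mat n} (hR : HolM U R) : HolM U (fun w => (R w)ᵀ) :=
  fun k l => hR l k

theorem HolM.pdM {R : Pt n → Mat n} (hR : HolM U R) (j : Fin n) : HolM U (pdM j R) :=
  fun k l => analyticOnNhd_pd (hR k l) j

theorem HolM.congr (hU : IsOpen U) {R S : Pt n → Mat n} (hR : HolM U R)
    (h : ∀ u ∈ U, R u = S u) : HolM U S :=
  fun k l => analyticOnNhd_congr hU (hR k l) (fun u hu => by rw [h u hu])

theorem HolM.det {R : Pt n → Mat n} (hR : HolM U R) : AnalyticOnNhd ℂ (fun w => (R w).det) U := by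
  intro u hu
  simp only [Matrix.det_apply']
  exact Finset.analyticAt_fun_sum _ fun σ _ =>
    analyticAt_const.mul (Finset.analyticAt_fun_prod _ fun i _ => hR _ _ u hu)

theorem HolM.inv {R : Pt n → Mat n} (hR : HolM U R) (h : ∀ u ∈ U, (R u).det ≠ 0) :
    HolM U (fun w => (R w)⁻¹) := by
  intro k l
  have hadj : HolM U (fun w => (R w).adjugate) := by
    intro k l
    simp only [Matrix.adjugate_apply]
    have : HolM U (fun w => (R w).updateRow l (Pi.single k 1)) := by
      intro k' l'
      by_cases hk : k' = l
      · subst hk; simp only [Matrix.updateRow_self]; exact analyticOnNhd_const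
      · simp only [Matrix.updateRow_ne hk]; exact hR k' l'
    exact this.det
  intro u hu
  simp only [Matrix.inv_def, Ring.inverse_eq_inv', Matrix.smul_apply, smul_eq_mul]
  exact ((hR.det u hu).inv (h u hu)).mul (hadj k l u hu)

theorem HolM.mulVec {R : Pt n → Mat n} {v : Pt n → Pt n} (hR : HolM U R)
    (hv : AnalyticOnNhd ℂ v U) : AnalyticOnNhd ℂ (fun w => R w *ᵥ v w) U := by
  refine analyticOnNhd_vec fun k => ?_
  intro u hu
  simp only [Matrix.mulVec, dotProduct]
  exact Finset.analyticAt_fun_sum _ fun i _ =>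
    (hR k i u hu).mul (analyticOnNhd_apply hv i u hu)

theorem pdM_congr (hU : IsOpen U) {R S : Pt n → Mat n} (h : ∀ u ∈ U, R u = S u) {u : Pt n}
    (hu : u ∈ U) (j : Fin n) : pdM j R u = pdM j S u := by
  ext k l
  exact pd_congr hU (fun w hw => by rw [h w hw]) hu j

theorem pdM_const (M : Mat n) (u : Pt n) (j : Fin n) : pdM j (fun _ => M) u = 0 := by
  ext k l
  exact pd_const _ _ _

theorem pdM_mul {R S : Pt n → Mat n} (hR : HolM U R) (hS : HolM U S) {u : Pt n} (hu : u ∈ U)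
    (j : Fin n) : pdM j (fun w => R w * S w) u = pdM j R u * S u + R u * pdM j S u := by
  ext k l
  simp only [pdM, Matrix.of_apply, Matrix.add_apply, Matrix.mul_apply]
  rw [pd_sum _ (fun i _ => (hR.differentiableAt hu k i).fun_mul (hS.differentiableAt hu i l)),
    ← Finset.sum_add_distrib]
  exact Finset.sum_congr rfl fun i _ =>
    pd_mul (hR.differentiableAt hu k i) (hS.differentiableAt hu i l) j

theorem pdM_add {R S : Pt n → Mat n} (hR : HolM U R) (hS : HolM U S) {u : Pt n} (hu : u ∈ U)
    (j : Fin n) : pdM j (fun w => R w + S w) u = pdM j R u + pdM j S u := by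
  ext k l
  exact pd_add (hR.differentiableAt hu k l) (hS.differentiableAt hu k l) j

theorem pdM_sub {R S : Pt n → Mat n} (hR : HolM U R) (hS : HolM U S) {u : Pt n} (hu : u ∈ U)
    (j : Fin n) : pdM j (fun w => R w - S w) u = pdM j R u - pdM j S u := by
  ext k l
  exact pd_sub (hR.differentiableAt hu k l) (hS.differentiableAt hu k l) j

theorem pdM_neg (R : Pt n → Mat n) (u : Pt n) (j : Fin n) :
    pdM j (fun w => -R w) u = -pdM j R u := by
  ext k l
  exact pd_neg _ _ _

theorem pdM_transpose (R : Pt n → Mat n) (u : Pt n) (j : Fin n) :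
    pdM j (fun w => (R w)ᵀ) u = (pdM j R u)ᵀ := rfl

theorem pdM_comm {R : Pt n → Mat n} (hR : HolM U R) {u : Pt n} (hu : u ∈ U) (j k : Fin n) :
    pdM j (pdM k R) u = pdM k (pdM j R) u := by
  ext p q
  exact pd_comm (hR p q u hu) j k

theorem pdM_inv {R : Pt n → Mat n} (hU : IsOpen U) (hR : HolM U R) (h : ∀ u ∈ U, (R u).det ≠ 0)
    {u : Pt n} (hu : u ∈ U) (j : Fin n) :
    pdM j (fun w => (R w)⁻¹) u = -((R u)⁻¹ * pdM j R u * (R u)⁻¹) := by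
  have hun : ∀ w ∈ U, IsUnit (R w).det := fun w hw => isUnit_iff_ne_zero.2 (h w hw)
  have h1 : pdM j (fun w => R w * (R w)⁻¹) u = 0 := by
    rw [pdM_congr (S := fun _ => 1) hU (fun w hw => Matrix.mul_nonsing_inv _ (hun w hw)) hu,
      pdM_const]
  rw [pdM_mul hR (hR.inv h) hu] at h1
  have h2 := congrArg ((R u)⁻¹ * ·) h1
  simp only [Matrix.mul_add, Matrix.mul_zero, ← Matrix.mul_assoc] at h2
  rw [Matrix.nonsing_inv_mul _ (hun u hu), Matrix.one_mul] at h2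
  rw [eq_neg_iff_add_eq_zero, add_comm]
  exact h2

theorem pd_mulVec {R : Pt n → Mat n} {v : Pt n → Pt n} (hR : HolM U R)
    (hv : AnalyticOnNhd ℂ v U) {u : Pt n} (hu : u ∈ U) (j : Fin n) :
    pd j (fun w => R w *ᵥ v w) u = pdM j R u *ᵥ v u + R u *ᵥ pd j v u := by
  have hd := (hR.mulVec hv u hu).differentiableAt
  have hv' := differentiableAt_pi.1 (hv u hu).differentiableAt
  ext k
  rw [pd_apply hd]
  simp only [Matrix.mulVec, dotProduct, Pi.add_apply, pdM, Matrix.of_apply]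
  rw [pd_sum _ (fun i _ => (hR.differentiableAt hu k i).fun_mul (hv' i)), ← Finset.sum_add_distrib]
  refine Finset.sum_congr rfl fun i _ => ?_
  rw [pd_mul (hR.differentiableAt hu k i) (hv' i), pd_apply (hv u hu).differentiableAt]

end MatrixCalculus

/-! ### Uniqueness for linear total differential systems. -/

section Uniqueness

/-- A holomorphic solution of a homogeneous linear total differential equation that vanishes at a
point of a connected open set vanishes. -/
theorem eq_zero_of_pdM_eq {U : Set (Pt n)} (hU : IsOpen U) (hc : IsPreconnected U)
    {Y : Pt n → Mat n} {P Q : Fin n → Pt n → Mat n} (hY : HolM U Y) (hP : ∀ j, HolM U (P j))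
    (hQ : ∀ j, HolM U (Q j))
    (h : ∀ u ∈ U, ∀ j, pdM j Y u = P j u * Y u + Y u * Q j u) {u₀ : Pt n} (hu₀ : u₀ ∈ U)
    (h₀ : Y u₀ = 0) : ∀ u ∈ U, Y u = 0 := by
  let f : Pt n → Fin n → Fin n → ℂ := fun u k l => Y u k l
  have hf : AnalyticOnNhd ℂ f U := fun u hu =>
    AnalyticAt.pi fun k => AnalyticAt.pi fun l => hY k l u hu
  -- By the identity theorem it is enough to prove vanishing near u₀; there Grönwall's inequality is
  -- applied along the segment from u₀.
  suffices hz : f =ᶠ[nhds u₀] 0 by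
    have := hf.eqOn_zero_of_preconnected_of_eventuallyEq_zero hc hu₀ hz
    intro u hu
    ext k l
    exact congrFun (congrFun (this hu) k) l
  have hbound : ∃ C : ℝ, 0 ≤ C ∧ ∀ᶠ u in nhds u₀, ∀ j k l, ‖P j u k l‖ ≤ C ∧ ‖Q j u k l‖ ≤ C := by
    -- One more than the sum of all norms at u₀ dominates every coefficient near u₀, by continuity.
    refine ⟨∑ j, ∑ k, ∑ l, (‖P j u₀ k l‖ + ‖Q j u₀ k l‖) + 1, by positivity, ?_⟩
    refine Filter.eventually_all.2 fun j => Filter.eventually_all.2 fun k =>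
      Filter.eventually_all.2 fun l => ?_
    have hle : ‖P j u₀ k l‖ + ‖Q j u₀ k l‖ ≤ ∑ j, ∑ k, ∑ l, (‖P j u₀ k l‖ + ‖Q j u₀ k l‖) := by
      refine le_trans ?_ (Finset.single_le_sum (f := fun j => ∑ k, ∑ l, (‖P j u₀ k l‖ + ‖Q j u₀ k l‖))
        (fun _ _ => by positivity) (Finset.mem_univ j))
      refine le_trans ?_ (Finset.single_le_sum (f := fun k => ∑ l, (‖P j u₀ k l‖ + ‖Q j u₀ k l‖))
        (fun _ _ => by positivity) (Finset.mem_univ k))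
      exact (Finset.single_le_sum (f := fun l => (‖P j u₀ k l‖ + ‖Q j u₀ k l‖))
        (fun _ _ => by positivity) (Finset.mem_univ l))
    have h1 := (hP j k l u₀ hu₀).continuousAt.norm.eventually_lt
      (continuousAt_const (y := ‖P j u₀ k l‖ + 1)) (by simp)
    have h2 := (hQ j k l u₀ hu₀).continuousAt.norm.eventually_lt
      (continuousAt_const (y := ‖Q j u₀ k l‖ + 1)) (by simp)
    filter_upwards [h1, h2] with u h1 h2
    have := norm_nonneg (P j u₀ k l)
    have := norm_nonneg (Q j u₀ k l)
    constructor <;> linarith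
  obtain ⟨C, hC, hb⟩ := hbound
  obtain ⟨r, hr, hball⟩ := Metric.eventually_nhds_iff_ball.1 (hb.and (hU.mem_nhds hu₀))
  refine Metric.eventually_nhds_iff_ball.2 ⟨r, hr, fun u hu => ?_⟩
  have hseg : ∀ t ∈ Set.Icc (0 : ℝ) 1, u₀ + (t : ℂ) • (u - u₀) ∈ Metric.ball u₀ r := by
    intro t ht
    rw [mem_ball_iff_norm, add_sub_cancel_left, norm_smul, Complex.norm_real, Real.norm_eq_abs,
      abs_of_nonneg ht.1]
    rw [mem_ball_iff_norm] at hu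
    nlinarith [norm_nonneg (u - u₀), ht.1, ht.2]
  have hder : ∀ t ∈ Set.Icc (0 : ℝ) 1, HasDerivAt (fun t : ℝ => f (u₀ + (t : ℂ) • (u - u₀)))
      (fderiv ℂ f (u₀ + (t : ℂ) • (u - u₀)) (u - u₀)) t := by
    intro t ht
    have hin := (hball _ (hseg t ht)).2
    have h1 : HasFDerivAt f (fderiv ℂ f (u₀ + (t : ℂ) • (u - u₀))) (u₀ + (t : ℂ) • (u - u₀)) :=
      (hf _ hin).differentiableAt.hasFDerivAt
    have h2 : HasDerivAt (fun t : ℝ => u₀ + (t : ℂ) • (u - u₀)) (u - u₀) t := by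
      have h3 : HasDerivAt (fun t : ℝ => (t : ℂ)) 1 t := Complex.ofRealCLM.hasDerivAt
      simpa using (h3.smul_const (u - u₀)).const_add u₀
    exact (h1.restrictScalars ℝ).comp_hasDerivAt t h2
  have hpd : ∀ w ∈ U, ∀ j k l, pd j f w k l = pdM j Y w k l := by
    intro w hw j k l
    have hd := (hf w hw).differentiableAt
    have hd1 := differentiableAt_pi.1 hd
    unfold pd
    rw [fderiv_pi hd1]
    show (fderiv ℂ (fun w => f w k) w) (Pi.single j 1) l = _
    rw [fderiv_pi (differentiableAt_pi.1 (hd1 k))]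
    rfl
  have hest : ∀ w ∈ Metric.ball u₀ r, ∀ j, ‖pd j f w‖ ≤ (2 * n * C) * ‖f w‖ := by
    intro w hw j
    obtain ⟨hB, hin⟩ := hball w hw
    have hfl : ∀ k l, ‖Y w k l‖ ≤ ‖f w‖ := fun k l =>
      (norm_le_pi_norm (f w k) l).trans (norm_le_pi_norm (f w) k)
    refine (pi_norm_le_iff_of_nonneg (by positivity)).2 fun k =>
      (pi_norm_le_iff_of_nonneg (by positivity)).2 fun l => ?_
    rw [hpd w hin, h w hin, Matrix.add_apply, Matrix.mul_apply, Matrix.mul_apply]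
    have e1 : ‖∑ i, P j w k i * Y w i l‖ ≤ n * (C * ‖f w‖) := by
      refine (norm_sum_le_of_le _ (fun i _ => ?_)).trans_eq
        (by rw [Finset.sum_const, Finset.card_univ, Fintype.card_fin, nsmul_eq_mul])
      rw [norm_mul]
      exact mul_le_mul (hB j k i).1 (hfl i l) (norm_nonneg _) hC
    have e2 : ‖∑ i, Y w k i * Q j w i l‖ ≤ n * (C * ‖f w‖) := by
      refine (norm_sum_le_of_le _ (fun i _ => ?_)).trans_eq
        (by rw [Finset.sum_const, Finset.card_univ, Fintype.card_fin, nsmul_eq_mul])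
      rw [norm_mul, mul_comm C]
      exact mul_le_mul (hfl k i) (hB j i l).2 (norm_nonneg _) (norm_nonneg _)
    refine (norm_add_le _ _).trans ((add_le_add e1 e2).trans_eq ?_)
    ring
  have hcont : ContinuousOn (fun t : ℝ => f (u₀ + (t : ℂ) • (u - u₀))) (Set.Icc 0 1) :=
    fun t ht => (hder t ht).continuousAt.continuousWithinAt
  -- Grönwall constant: n partial derivatives, each at most 2nC‖f‖ (n terms in each of the two
  -- matrix products) and weighted by a coordinate of u - u₀ of size below r.
  have hz := eq_zero_of_abs_deriv_le_mul_abs_self_of_eq_zero_right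
    (K := n * (r * (2 * n * C))) hcont
    (fun t ht => (hder t ⟨ht.1, ht.2.le⟩).hasDerivWithinAt)
    (by
      show f (u₀ + ((0 : ℝ) : ℂ) • (u - u₀)) = 0
      simp only [Complex.ofReal_zero, zero_smul, add_zero]
      ext k l
      simp [f, h₀])
    (by
      intro t ht
      rw [fderiv_eq_sum_pd]
      refine (norm_sum_le_of_le (f := fun j => (u - u₀) j • pd j f (u₀ + (t : ℂ) • (u - u₀))) _
        (n := fun _ => r * (2 * n * C * ‖f (u₀ + (t : ℂ) • (u - u₀))‖)) (fun j _ => ?_)).trans_eq ?_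
      · rw [norm_smul]
        refine mul_le_mul ?_ (hest _ (hseg t ⟨ht.1, ht.2.le⟩) j) (norm_nonneg _) hr.le
        rw [mem_ball_iff_norm] at hu
        exact (norm_le_pi_norm (u - u₀) j).trans hu.le
      · rw [Finset.sum_const, Finset.card_univ, Fintype.card_fin, nsmul_eq_mul]
        ring)
    1 (by simp)
  simpa using hz

end Uniqueness

end Peterson
namespace Peterson

variable {n : ℕ}

/-! ### Orthonormal frames for diag[A, 1] and their dual relations. -/

section Frames

theorem dot_quadA (a v w : Fin n → ℂ) : v ⬝ᵥ quadA a *ᵥ w = ∑ j, (a j)⁻¹ * (v j * w j) := by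
  simp only [quadA, mulVec_diagonal, dotProduct]
  exact Finset.sum_congr rfl fun j _ => by ring

/-- The matrix with the columns `(v_l, m_l)` and `i (v, m)`. -/
noncomputable def frameMatrix {ι : Type*} (v m : ι → Fin n → ℂ) (v₀ m₀ : Fin n → ℂ) :
    Matrix (Fin n ⊕ Fin n) (ι ⊕ Unit) ℂ :=
  Matrix.of fun p q => Sum.elim
    (fun l => Sum.elim (v l) (m l) p) (fun _ => Complex.I * Sum.elim v₀ m₀ p) q

/-- The vectors `(v_l, m_l)` together with `i (v, m)` are orthonormal for `diag[A, 1]`. -/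
structure FrameOrthonormal {ι : Type*} [DecidableEq ι] (a : Fin n → ℂ) (v m : ι → Fin n → ℂ)
    (v₀ m₀ : Fin n → ℂ) : Prop where
  frame : ∀ l k, v l ⬝ᵥ quadA a *ᵥ v k + m l ⬝ᵥ m k = if l = k then 1 else 0
  seed : ∀ l, v l ⬝ᵥ quadA a *ᵥ v₀ + m l ⬝ᵥ m₀ = 0
  prime : v₀ ⬝ᵥ quadA a *ᵥ v₀ + m₀ ⬝ᵥ m₀ = -1

/-- The dual relations between the rows of the frame matrix. -/
structure FrameGram {ι : Type*} [Fintype ι] (a : Fin n → ℂ) (v m : ι → Fin n → ℂ)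
    (v₀ m₀ : Fin n → ℂ) : Prop where
  vv : ∀ j k, ∑ l, v l j * v l k - v₀ j * v₀ k = if j = k then a j else 0
  vm : ∀ j k, ∑ l, v l j * m l k - v₀ j * m₀ k = 0
  mm : ∀ j k, ∑ l, m l j * m l k - m₀ j * m₀ k = if j = k then 1 else 0

variable {ι : Type*} {a : Fin n → ℂ} {v m : ι → Fin n → ℂ}
  {v₀ m₀ : Fin n → ℂ}

theorem I_mul_I_mul (x y : ℂ) : Complex.I * x * (Complex.I * y) = -(x * y) := by
  linear_combination (x * y) * Complex.I_mul_I

/-- The transpose of the frame matrix, multiplied by `diag[A, 1]`. -/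
noncomputable def frameDual {ι : Type*} (a : Fin n → ℂ) (v m : ι → Fin n → ℂ) (v₀ m₀ : Fin n → ℂ) :
    Matrix (ι ⊕ Unit) (Fin n ⊕ Fin n) ℂ :=
  Matrix.of fun q p => frameMatrix v m v₀ m₀ p q * Sum.elim (fun j => (a j)⁻¹) (fun _ => 1) p

/-- The factor i on the last column produces the minus sign of the seed terms, so the row relations
are the blocks of a single matrix identity. -/
theorem frameGram_iff_matrix [Fintype ι] (ha : ∀ j, a j ≠ 0) : FrameGram a v m v₀ m₀ ↔
    (frameMatrix v m v₀ m₀ * frameDual a v m v₀ m₀ : Matrix (Fin n ⊕ Fin n) (Fin n ⊕ Fin n) ℂ)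
      = 1 := by
  have hent : ∀ p q, (frameMatrix v m v₀ m₀ * frameDual a v m v₀ m₀ :
      Matrix (Fin n ⊕ Fin n) (Fin n ⊕ Fin n) ℂ) p q
      = (∑ l, Sum.elim (v l) (m l) p * Sum.elim (v l) (m l) q
        - Sum.elim v₀ m₀ p * Sum.elim v₀ m₀ q) * Sum.elim (fun j => (a j)⁻¹) (fun _ => 1) q := by
    intro p q
    simp [Matrix.mul_apply, frameMatrix, frameDual, Fintype.sum_sum_type, ← mul_assoc,
      ← Finset.sum_mul, sub_eq_add_neg, add_mul]
    rw [mul_right_comm Complex.I, Complex.I_mul_I]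
    ring
  have hvv : ∀ j k x, x * (a k)⁻¹ = (if j = k then 1 else 0) ↔ x = if j = k then a j else 0 := by
    intro j k x
    by_cases h : j = k
    · subst h
      simp [mul_inv_eq_one₀ (ha j)]
    · simp [h, ha]
  constructor
  · intro h
    ext p q
    rw [hent]
    rcases p with j | j <;> rcases q with k | k
    · simpa [Matrix.one_apply] using (hvv j k _).2 (h.vv j k)
    · simpa using h.vm j k
    · have := h.vm k j
      have h' : ∑ l, m l j * v l k - m₀ j * v₀ k = 0 := by
        rw [← this]
        simp only [mul_comm]
      rw [Matrix.one_apply_ne (by simp)]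
      simp [h']
    · simpa [Matrix.one_apply] using h.mm j k
  · intro h
    refine ⟨fun j k => (hvv j k _).1 ?_, fun j k => ?_, fun j k => ?_⟩
    · have := congrFun (congrFun h (.inl j)) (.inl k)
      rw [hent] at this
      simpa [Matrix.one_apply] using this
    · have := congrFun (congrFun h (.inl j)) (.inr k)
      rw [hent] at this
      simpa using this
    · have := congrFun (congrFun h (.inr j)) (.inr k)
      rw [hent] at this
      simpa [Matrix.one_apply] using this

/-- The same two matrices in the opposite order; the factor i turns the value -1 of the seed into 1.
-/
theorem frameOrthonormal_iff_matrix [DecidableEq ι] : FrameOrthonormal a v m v₀ m₀ ↔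
    (frameDual a v m v₀ m₀ * frameMatrix v m v₀ m₀ : Matrix (ι ⊕ Unit) (ι ⊕ Unit) ℂ) = 1 := by
  have hent : ∀ p q, (frameDual a v m v₀ m₀ * frameMatrix v m v₀ m₀ :
      Matrix (ι ⊕ Unit) (ι ⊕ Unit) ℂ) p q
      = ∑ j, frameMatrix v m v₀ m₀ (.inl j) p * (a j)⁻¹ * frameMatrix v m v₀ m₀ (.inl j) q
        + ∑ j, frameMatrix v m v₀ m₀ (.inr j) p * frameMatrix v m v₀ m₀ (.inr j) q := by
    intro p q
    rw [Matrix.mul_apply, Fintype.sum_sum_type]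
    simp [frameDual]
  have h11 : ∀ l k, (frameDual a v m v₀ m₀ * frameMatrix v m v₀ m₀ :
      Matrix (ι ⊕ Unit) (ι ⊕ Unit) ℂ) (.inl l) (.inl k)
      = v l ⬝ᵥ quadA a *ᵥ v k + m l ⬝ᵥ m k := by
    intro l k
    rw [hent, dot_quadA]
    simp only [frameMatrix, Matrix.of_apply, Sum.elim_inl, Sum.elim_inr, dotProduct]
    congr 1
    exact Finset.sum_congr rfl fun _ _ => by ring
  have h12 : ∀ l s, (frameDual a v m v₀ m₀ * frameMatrix v m v₀ m₀ :
      Matrix (ι ⊕ Unit) (ι ⊕ Unit) ℂ) (.inl l) (.inr s)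
      = Complex.I * (v l ⬝ᵥ quadA a *ᵥ v₀ + m l ⬝ᵥ m₀) := by
    intro l k
    rw [hent, dot_quadA]
    simp only [frameMatrix, Matrix.of_apply, Sum.elim_inl, Sum.elim_inr, dotProduct, mul_add,
      Finset.mul_sum]
    congr 1 <;> exact Finset.sum_congr rfl fun _ _ => by ring
  have h21 : ∀ s l, (frameDual a v m v₀ m₀ * frameMatrix v m v₀ m₀ :
      Matrix (ι ⊕ Unit) (ι ⊕ Unit) ℂ) (.inr s) (.inl l)
      = Complex.I * (v l ⬝ᵥ quadA a *ᵥ v₀ + m l ⬝ᵥ m₀) := by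
    intro l k
    rw [hent, dot_quadA]
    simp only [frameMatrix, Matrix.of_apply, Sum.elim_inl, Sum.elim_inr, dotProduct, mul_add,
      Finset.mul_sum]
    congr 1 <;> exact Finset.sum_congr rfl fun _ _ => by ring
  have h22 : ∀ s t, (frameDual a v m v₀ m₀ * frameMatrix v m v₀ m₀ :
      Matrix (ι ⊕ Unit) (ι ⊕ Unit) ℂ) (.inr s) (.inr t)
      = -(v₀ ⬝ᵥ quadA a *ᵥ v₀ + m₀ ⬝ᵥ m₀) := by
    intro l k
    rw [hent, dot_quadA]
    simp only [frameMatrix, Matrix.of_apply, Sum.elim_inl, Sum.elim_inr, dotProduct, neg_add,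
      ← Finset.sum_neg_distrib]
    congr 1 <;> refine Finset.sum_congr rfl fun j _ => ?_
    · linear_combination ((a j)⁻¹ * v₀ j * v₀ j) * Complex.I_mul_I
    · exact I_mul_I_mul _ _
  constructor
  · intro h
    ext p q
    rcases p with l | l <;> rcases q with k | k
    · rw [h11, h.frame]; simp [Matrix.one_apply]
    · rw [h12, h.seed]; simp
    · rw [h21, h.seed]; simp
    · rw [h22, h.prime]; simp
  · intro h
    refine ⟨fun l k => ?_, fun l => ?_, ?_⟩
    · rw [← h11, h]; simp [Matrix.one_apply]
    · have := h12 l ()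
      rw [h] at this
      simpa using this.symm
    · have := h22 () ()
      rw [h] at this
      simp only [Matrix.one_apply_eq] at this
      linear_combination this

/-- The cardinality condition makes the frame matrix square, so a one-sided inverse is two-sided.
This is where the dimension 2n - 1 of the ambient space enters. -/
theorem frameGram_iff_frameOrthonormal [Fintype ι] [DecidableEq ι] (hn : Fintype.card ι + 1 = 2 * n) (ha : ∀ j, a j ≠ 0) :
    FrameGram a v m v₀ m₀ ↔ FrameOrthonormal a v m v₀ m₀ := by
  rw [frameGram_iff_matrix ha, frameOrthonormal_iff_matrix]
  have hc : Fintype.card (Fin n ⊕ Fin n) = Fintype.card (ι ⊕ Unit) := by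
    rw [Fintype.card_sum, Fintype.card_sum, Fintype.card_fin, Fintype.card_unit]
    omega
  exact Matrix.mul_eq_one_comm_of_equiv (Fintype.card_eq.1 hc).some

end Frames

/-! ### Orthogonal matrices and the Bianchi formula. -/

section Algebra

variable {D₁ D₂ D₃ R R₁ R₂ R₃ R₄ : Mat n} {c : ℂ}

theorem IsOrth.mul_transpose (h : IsOrth R) : R * Rᵀ = 1 := mul_eq_one_comm.1 h

theorem IsOrth.mul (h : IsOrth R) (h₁ : IsOrth R₁) : IsOrth (R * R₁) := by
  unfold IsOrth at *
  rw [Matrix.transpose_mul, Matrix.mul_assoc, ← Matrix.mul_assoc Rᵀ, h, Matrix.one_mul, h₁]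

theorem IsOrth.transpose (h : IsOrth R) : IsOrth Rᵀ := by
  unfold IsOrth
  rw [Matrix.transpose_transpose]
  exact h.mul_transpose

theorem IsOrth.one : IsOrth (1 : Mat n) := by simp [IsOrth]

theorem IsOrth.isUnit_det (h : IsOrth R) : IsUnit R.det := by
  have := congrArg Matrix.det h
  rw [Matrix.det_mul, Matrix.det_one] at this
  exact IsUnit.of_mul_eq_one_right _ this

theorem IsOrth.det_ne_zero (h : IsOrth R) : R.det ≠ 0 := h.isUnit_det.ne_zero

theorem IsOrth.mul_transpose_mul (h : IsOrth R) (M : Mat n) : R * (Rᵀ * M) = M := by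
  rw [← Matrix.mul_assoc, h.mul_transpose, Matrix.one_mul]

theorem IsOrth.transpose_mul_mul (h : IsOrth R) (M : Mat n) : Rᵀ * (R * M) = M := by
  rw [← Matrix.mul_assoc, h, Matrix.one_mul]

theorem bianchi_denominator (h₁ : IsOrth R₁) :
    D₂ * R₂ * R₁ᵀ - D₁ = (D₂ * R₂ - D₁ * R₁) * R₁ᵀ := by
  rw [Matrix.sub_mul, Matrix.mul_assoc D₁, h₁.mul_transpose, Matrix.mul_one]

theorem bianchi_numerator (h₁ : IsOrth R₁) :
    D₂ - D₁ * R₂ * R₁ᵀ = (D₂ * R₁ - D₁ * R₂) * R₁ᵀ := by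
  rw [Matrix.sub_mul, Matrix.mul_assoc D₂, h₁.mul_transpose, Matrix.mul_one]

theorem det_denominator_ne_zero_iff (h₁ : IsOrth R₁) :
    (D₂ * R₂ * R₁ᵀ - D₁).det ≠ 0 ↔ (D₂ * R₂ - D₁ * R₁).det ≠ 0 := by
  rw [bianchi_denominator h₁, Matrix.det_mul]
  simp [h₁.det_ne_zero]

theorem det_sub_swap_ne_zero {M N : Mat n} : (M - N).det ≠ 0 ↔ (N - M).det ≠ 0 := by
  rw [← neg_sub N M, Matrix.det_neg]
  simp

theorem inv_mul_transpose {M : Mat n} (h₁ : IsOrth R₁) :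
    (M * R₁ᵀ)⁻¹ = R₁ * M⁻¹ := by
  rw [Matrix.mul_inv_rev, Matrix.inv_eq_left_inv h₁.mul_transpose]

/-- The factors R₁ᵀ cancel. In this form numerator and denominator both change sign when the indices
are exchanged. -/
theorem bianchi_eq (h₁ : IsOrth R₁) :
    bianchi D₁ D₂ R₁ R₂ = (D₂ * R₁ - D₁ * R₂) * (D₂ * R₂ - D₁ * R₁)⁻¹ := by
  rw [bianchi, bianchi_numerator h₁, bianchi_denominator h₁, inv_mul_transpose h₁,
    Matrix.mul_assoc, h₁.transpose_mul_mul]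

/-- A singular matrix has inverse `0`, so no invertibility is needed; hence `bianchi_comm` is free
of non-degeneracy hypotheses. -/
theorem neg_inv_eq (M : Mat n) : (-M)⁻¹ = -M⁻¹ := by
  rcases isEmpty_or_nonempty (Fin n) with h | h
  · exact Subsingleton.elim _ _
  by_cases hM : IsUnit M.det
  · refine Matrix.inv_eq_left_inv ?_
    rw [neg_mul_neg, Matrix.nonsing_inv_mul _ hM]
  · rw [Matrix.nonsing_inv_apply_not_isUnit _ hM, Matrix.nonsing_inv_apply_not_isUnit, neg_zero]
    rw [Matrix.det_neg]
    simpa using hM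

theorem bianchi_comm (h₁ : IsOrth R₁) (h₂ : IsOrth R₂) :
    bianchi D₁ D₂ R₁ R₂ = bianchi D₂ D₁ R₂ R₁ := by
  rw [bianchi_eq h₁, bianchi_eq h₂, ← neg_sub (D₁ * R₂), ← neg_sub (D₁ * R₁), neg_inv_eq,
    neg_mul_neg]

theorem bianchi_mul (h₁ : IsOrth R₁) (hG : (D₂ * R₂ - D₁ * R₁).det ≠ 0) :
    bianchi D₁ D₂ R₁ R₂ * (D₂ * R₂ - D₁ * R₁) = D₂ * R₁ - D₁ * R₂ := by
  rw [bianchi_eq h₁, Matrix.mul_assoc, Matrix.nonsing_inv_mul _ (isUnit_iff_ne_zero.2 hG),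
    Matrix.mul_one]

end Algebra

/-! ### The diagonal matrices attached to a spectral parameter. -/

section SpectralParam

variable {a : Fin n → ℂ} (p p₁ p₂ p₃ : SpectralParam a)

theorem SpectralParam.d_sq_eq (j : Fin n) : p.d j ^ 2 = p.z⁻¹ - (a j)⁻¹ := by
  have h := p.d_sq j
  rw [mul_pow, p.s_sq] at h
  have hz := p.z_ne_zero
  field_simp
  linear_combination h

theorem SpectralParam.d_ne_zero (ha : ∀ j, a j ≠ 0) (j : Fin n) : p.d j ≠ 0 := by
  intro h
  have h1 := p.d_sq j
  rw [h, mul_zero, zero_pow two_ne_zero] at h1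
  have h2 : p.z * (a j)⁻¹ = 1 := by linear_combination h1
  exact p.z_ne j ((mul_inv_eq_one₀ (ha j)).1 h2)

theorem SpectralParam.D_transpose : p.Dᵀ = p.D := Matrix.diagonal_transpose _

theorem SpectralParam.D_comm : p₁.D * p₂.D = p₂.D * p₁.D := by
  simp only [SpectralParam.D, Matrix.diagonal_mul_diagonal, mul_comm]

theorem E_transpose (j : Fin n) : (E j)ᵀ = E j := by simp [E]

theorem E_eq_diagonal (j : Fin n) : (E j : Mat n) = Matrix.diagonal (Pi.single j 1) := by
  simp [E, Matrix.diagonal_single]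

theorem SpectralParam.D_mul_E (j : Fin n) : p.D * E j = E j * p.D := by
  simp only [E_eq_diagonal, SpectralParam.D, Matrix.diagonal_mul_diagonal, mul_comm]

theorem quadA_mul_E (j : Fin n) : quadA a * E j = E j * quadA a := by
  simp only [E_eq_diagonal, quadA, Matrix.diagonal_mul_diagonal, mul_comm]

theorem E_comm (j k : Fin n) : (E j : Mat n) * E k = E k * E j := by
  simp only [E_eq_diagonal, Matrix.diagonal_mul_diagonal, mul_comm]

theorem quadA_transpose : (quadA a)ᵀ = quadA a := Matrix.diagonal_transpose _

theorem SpectralParam.D_mul_quadA : p.D * quadA a = quadA a * p.D := by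
  simp only [quadA, SpectralParam.D, Matrix.diagonal_mul_diagonal, mul_comm]

/-- The identity behind the whole transformation theory: the chosen square roots drop out and D² + A
is scalar. -/
theorem SpectralParam.D_mul_D : p.D * p.D = p.z⁻¹ • 1 - quadA a := by
  rw [SpectralParam.D, quadA, Matrix.diagonal_mul_diagonal, ← Matrix.diagonal_one,
    ← Matrix.diagonal_smul, Matrix.diagonal_sub]
  congr 1
  ext j
  have := p.d_sq_eq j
  simp only [Pi.smul_apply, smul_eq_mul, mul_one]
  rw [← this]
  ring

/-- A cancels in the difference. The resulting scalar can be moved past rotations, although the D's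
themselves cannot. -/
theorem SpectralParam.sq_sub_sq : p₂.D ^ 2 - p₁.D ^ 2 = (p₂.z⁻¹ - p₁.z⁻¹) • 1 := by
  rw [pow_two, pow_two, p₂.D_mul_D, p₁.D_mul_D, sub_smul]
  abel

theorem SpectralParam.sq_sub_sq_mul (M : Mat n) :
    (p₂.D ^ 2 - p₁.D ^ 2) * M = M * (p₂.D ^ 2 - p₁.D ^ 2) := by
  rw [SpectralParam.sq_sub_sq]
  simp

theorem SpectralParam.det_D_ne_zero (ha : ∀ j, a j ≠ 0) : p.D.det ≠ 0 := by
  rw [SpectralParam.D, Matrix.det_diagonal]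
  exact Finset.prod_ne_zero_iff.2 fun j _ => p.d_ne_zero ha j

end SpectralParam

/-! ### Bianchi rotations for two and three parameters. -/

section Bianchi

variable {a : Fin n → ℂ} {p₁ p₂ p₃ : SpectralParam a} {R₀ R₁ R₂ R₃ R₄ R₅ : Mat n}

/-- `(D₁ + D₂ T) (D₂ R₂ - D₁ R₁) = (D₂² - D₁²) R₁` for `T` given by the Bianchi formula. -/
theorem add_bianchi_mul (h₁ : IsOrth R₁) (hG : (p₂.D * R₂ - p₁.D * R₁).det ≠ 0) :
    (p₁.D + p₂.D * bianchi p₁.D p₂.D R₁ R₂) * (p₂.D * R₂ - p₁.D * R₁)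
      = (p₂.D ^ 2 - p₁.D ^ 2) * R₁ := by
  rw [Matrix.add_mul, Matrix.mul_assoc p₂.D, bianchi_mul h₁ hG]
  linear_combination (norm := noncomm_ring) p₁.D_comm p₂ * R₂

/-- Numerator H and denominator G satisfy HᵀH = GᵀG: the cross terms agree because diagonal matrices
commute, and the scalar D₂² - D₁² is unchanged by conjugation with R₁ or R₂. -/
theorem bianchi_isOrth (h₁ : IsOrth R₁) (h₂ : IsOrth R₂)
    (hG : (p₂.D * R₂ - p₁.D * R₁).det ≠ 0) : IsOrth (bianchi p₁.D p₂.D R₁ R₂) := by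
  set G := p₂.D * R₂ - p₁.D * R₁ with hGdef
  have hGu : IsUnit G.det := isUnit_iff_ne_zero.2 hG
  have key : (p₂.D * R₁ - p₁.D * R₂)ᵀ * (p₂.D * R₁ - p₁.D * R₂) = Gᵀ * G := by
    rw [hGdef]
    simp only [Matrix.transpose_sub, Matrix.transpose_mul, SpectralParam.D_transpose]
    have e0 : ∀ R : Mat n, IsOrth R →
        Rᵀ * (p₂.D ^ 2 - p₁.D ^ 2) * R = p₂.D ^ 2 - p₁.D ^ 2 := by
      intro R hR
      rw [Matrix.mul_assoc, p₁.sq_sub_sq_mul, ← Matrix.mul_assoc, hR, Matrix.one_mul]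
    linear_combination (norm := noncomm_ring) e0 R₁ h₁ - e0 R₂ h₂
      + R₁ᵀ * p₁.D_comm p₂ * R₂ - R₂ᵀ * p₁.D_comm p₂ * R₁
  unfold IsOrth
  rw [bianchi_eq h₁, Matrix.transpose_mul, Matrix.mul_assoc, ← Matrix.mul_assoc _ _ G⁻¹, key,
    Matrix.mul_assoc Gᵀ, Matrix.mul_nonsing_inv _ hGu, Matrix.mul_one, ← Matrix.transpose_mul,
    Matrix.mul_nonsing_inv _ hGu, Matrix.transpose_one]

theorem box_swap : box p₂.D p₁.D p₃.D R₂ R₁ R₄ = -box p₁.D p₂.D p₃.D R₁ R₂ R₄ := by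
  unfold box
  noncomm_ring

/-- Expresses □ by the two denominators that share the index 1, with scalar coefficients. -/
theorem box_eq : box p₁.D p₂.D p₃.D R₁ R₂ R₄
    = (p₃.D ^ 2 - p₁.D ^ 2) * (p₂.D * R₂ - p₁.D * R₁)
      - (p₂.D ^ 2 - p₁.D ^ 2) * (p₃.D * R₄ - p₁.D * R₁) := by
  unfold box
  noncomm_ring

/-- The denominator of the third transform is, up to invertible factors, the matrix `□`. -/
theorem bianchi_sub_mul (h₁ : IsOrth R₁)
    (hG : (p₂.D * R₂ - p₁.D * R₁).det ≠ 0) (hG' : (p₃.D * R₄ - p₁.D * R₁).det ≠ 0) :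
    (p₂.D * bianchi p₁.D p₂.D R₁ R₂ - p₃.D * bianchi p₁.D p₃.D R₁ R₄)
        * (p₂.D * R₂ - p₁.D * R₁)
      = -(R₁ * (p₃.D * R₄ - p₁.D * R₁)⁻¹ * box p₁.D p₂.D p₃.D R₁ R₂ R₄) := by
  have e1 := add_bianchi_mul h₁ hG
  have e2 := add_bianchi_mul h₁ hG'
  rw [box_eq]
  set G := p₂.D * R₂ - p₁.D * R₁
  set G' := p₃.D * R₄ - p₁.D * R₁
  set T := bianchi p₁.D p₂.D R₁ R₂
  set T' := bianchi p₁.D p₃.D R₁ R₄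
  have hG'u : G'⁻¹ * G' = 1 := Matrix.nonsing_inv_mul _ (isUnit_iff_ne_zero.2 hG')
  have hG'v : G' * G'⁻¹ = 1 := Matrix.mul_nonsing_inv _ (isUnit_iff_ne_zero.2 hG')
  -- The common summand D₁ of `e1` and of this identity cancels in D₂T - D₃T'.
  have e3 : p₁.D + p₃.D * T' = R₁ * G'⁻¹ * (p₃.D ^ 2 - p₁.D ^ 2) := by
    have := congrArg (· * G'⁻¹) e2
    simp only [Matrix.mul_assoc, hG'v, Matrix.mul_one] at this
    rw [this, SpectralParam.sq_sub_sq_mul]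
  have e4 : R₁ * G'⁻¹ * ((p₂.D ^ 2 - p₁.D ^ 2) * G') = (p₂.D ^ 2 - p₁.D ^ 2) * R₁ := by
    rw [p₁.sq_sub_sq_mul p₂ G', p₁.sq_sub_sq_mul p₂ R₁, ← Matrix.mul_assoc, Matrix.mul_assoc R₁,
      hG'u, Matrix.mul_one]
  linear_combination (norm := noncomm_ring) e1 - e3 * G - e4

theorem det_bianchi_sub_ne_zero_iff (h₁ : IsOrth R₁)
    (hG : (p₂.D * R₂ - p₁.D * R₁).det ≠ 0) (hG' : (p₃.D * R₄ - p₁.D * R₁).det ≠ 0) :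
    (p₂.D * bianchi p₁.D p₂.D R₁ R₂ - p₃.D * bianchi p₁.D p₃.D R₁ R₄).det ≠ 0 ↔
      (box p₁.D p₂.D p₃.D R₁ R₂ R₄).det ≠ 0 := by
  have h := congrArg Matrix.det (bianchi_sub_mul h₁ hG hG')
  rw [Matrix.det_mul, Matrix.det_neg, Matrix.det_mul, Matrix.det_mul] at h
  have hi : ((p₃.D * R₄ - p₁.D * R₁)⁻¹).det ≠ 0 := by
    rw [Matrix.det_nonsing_inv, Ring.inverse_eq_inv']
    exact inv_ne_zero hG'
  have hne : (-1 : ℂ) ^ Fintype.card (Fin n) ≠ 0 := pow_ne_zero _ (by norm_num)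
  constructor
  · intro h1 h2
    rw [h2, mul_zero, mul_zero] at h
    exact (mul_ne_zero h1 hG) h
  · intro h1 h2
    rw [h2, zero_mul] at h
    exact (mul_ne_zero hne (mul_ne_zero (mul_ne_zero h₁.det_ne_zero hi) h1)) h.symm

theorem bianchi_sub_inv (h₁ : IsOrth R₁)
    (hG : (p₂.D * R₂ - p₁.D * R₁).det ≠ 0) (hG' : (p₃.D * R₄ - p₁.D * R₁).det ≠ 0)
    (hb : (box p₁.D p₂.D p₃.D R₁ R₂ R₄).det ≠ 0) :
    (p₂.D * bianchi p₁.D p₂.D R₁ R₂ - p₃.D * bianchi p₁.D p₃.D R₁ R₄)⁻¹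
      = -((p₂.D * R₂ - p₁.D * R₁) * (box p₁.D p₂.D p₃.D R₁ R₂ R₄)⁻¹
          * (p₃.D * R₄ - p₁.D * R₁) * R₁ᵀ) := by
  refine Matrix.inv_eq_right_inv ?_
  have h := bianchi_sub_mul h₁ hG hG'
  have hb' := Matrix.mul_nonsing_inv _ (isUnit_iff_ne_zero.2 hb)
  have hG'u := Matrix.nonsing_inv_mul _ (isUnit_iff_ne_zero.2 hG')
  rw [Matrix.mul_neg, ← Matrix.mul_assoc, ← Matrix.mul_assoc, ← Matrix.mul_assoc, h]
  simp only [Matrix.neg_mul, neg_neg, Matrix.mul_assoc]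
  rw [← Matrix.mul_assoc (box _ _ _ _ _ _), hb', Matrix.one_mul, ← Matrix.mul_assoc _⁻¹, hG'u,
    Matrix.one_mul, h₁.mul_transpose]

/-- With the inverse from `bianchi_sub_inv` inserted, T meets its own denominator and collapses to
D₂R₁ - D₁R₂; the trailing R₁ᵀR₁ disappears. -/
theorem D_bianchi_sub_inv (h₁ : IsOrth R₁)
    (hG : (p₂.D * R₂ - p₁.D * R₁).det ≠ 0) (hG' : (p₃.D * R₄ - p₁.D * R₁).det ≠ 0)
    (hb : (box p₁.D p₂.D p₃.D R₁ R₂ R₄).det ≠ 0) :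
    p₁.D * ((p₂.D ^ 2 - p₃.D ^ 2) * p₂.D * bianchi p₁.D p₂.D R₁ R₂
        * (p₂.D * bianchi p₁.D p₂.D R₁ R₂ - p₃.D * bianchi p₁.D p₃.D R₁ R₄)⁻¹ * R₁
        - p₂.D ^ 2 * R₁)
      = (p₁.D ^ 2 * p₂.D * R₂ - p₂.D ^ 2 * p₁.D * R₁) * (box p₁.D p₂.D p₃.D R₁ R₂ R₄)⁻¹
        * (p₂.D ^ 2 - p₃.D ^ 2) * (p₃.D * R₄ - p₁.D * R₁) - p₂.D ^ 2 * p₁.D * R₁ := by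
  rw [bianchi_sub_inv h₁ hG hG' hb]
  have h1 := bianchi_mul h₁ hG
  set G := p₂.D * R₂ - p₁.D * R₁
  set G' := p₃.D * R₄ - p₁.D * R₁
  set B := (box p₁.D p₂.D p₃.D R₁ R₂ R₄)⁻¹
  set T := bianchi p₁.D p₂.D R₁ R₂
  have e1 := p₃.sq_sub_sq_mul p₂ (p₁.D * p₂.D * (p₂.D * R₁ - p₁.D * R₂) * B)
  have e2 := p₃.sq_sub_sq_mul p₂ p₁.D
  have e3 : R₁ᵀ * R₁ = 1 := h₁
  have e4 := p₁.D_comm p₂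
  have f1 : p₁.D * p₂.D ^ 2 = p₂.D ^ 2 * p₁.D := by
    linear_combination (norm := noncomm_ring) e4 * p₂.D + p₂.D * e4
  have f2 : p₁.D * p₂.D * p₁.D = p₁.D ^ 2 * p₂.D := by
    linear_combination (norm := noncomm_ring) - p₁.D * e4
  have step1 : (p₂.D ^ 2 - p₃.D ^ 2) * p₂.D * T * -(G * B * G' * R₁ᵀ) * R₁
      = -((p₂.D ^ 2 - p₃.D ^ 2) * (p₂.D * (p₂.D * R₁ - p₁.D * R₂) * B) * G') := by
    rw [← h1]
    simp only [Matrix.mul_neg, Matrix.neg_mul, Matrix.mul_assoc, e3, Matrix.mul_one]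
  have step2 : p₁.D * (p₂.D * (p₂.D * R₁ - p₁.D * R₂) * B)
      = -((p₁.D ^ 2 * p₂.D * R₂ - p₂.D ^ 2 * p₁.D * R₁) * B) := by
    linear_combination (norm := noncomm_ring) f1 * R₁ * B - f2 * R₂ * B
  rw [step1, p₃.sq_sub_sq_mul p₂]
  linear_combination (norm := noncomm_ring) -(step2 * (p₂.D ^ 2 - p₃.D ^ 2) * G') - f1 * R₁

/-- The rotation R₀ of the base cancels between numerator and denominator, so the third transform
depends only on R₁, R₂, R₄. A general R₀ is kept because the iteration uses the result over
intermediate data. -/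
theorem third_transform_eq (h₀ : IsOrth R₀) (h₁ : IsOrth R₁) (h₂ : IsOrth R₂)
    (hG : (p₂.D * R₂ - p₁.D * R₁).det ≠ 0) (hG' : (p₃.D * R₄ - p₁.D * R₁).det ≠ 0)
    (hb : (box p₁.D p₂.D p₃.D R₁ R₂ R₄).det ≠ 0)
    (h₃ : R₃ = bianchi p₁.D p₂.D R₁ R₂ * R₀) (h₅ : R₅ = bianchi p₁.D p₃.D R₁ R₄ * R₀) :
    p₁.D * p₂.D * p₃.D * (bianchi p₂.D p₃.D R₃ R₅ * R₁)
      = (p₁.D ^ 2 * p₂.D * R₂ - p₂.D ^ 2 * p₁.D * R₁) * (box p₁.D p₂.D p₃.D R₁ R₂ R₄)⁻¹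
        * (p₂.D ^ 2 - p₃.D ^ 2) * (p₃.D * R₄ - p₁.D * R₁) - p₂.D ^ 2 * p₁.D * R₁ := by
  rw [← D_bianchi_sub_inv h₁ hG hG' hb]
  have hT := bianchi_isOrth h₁ h₂ hG
  have hdet := (det_bianchi_sub_ne_zero_iff h₁ hG hG').2 hb
  have hinv := Matrix.mul_nonsing_inv _ (isUnit_iff_ne_zero.2 hdet)
  rw [bianchi_eq (h₃ ▸ hT.mul h₀), h₃, h₅]
  set T := bianchi p₁.D p₂.D R₁ R₂
  set T' := bianchi p₁.D p₃.D R₁ R₄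
  have e1 : p₃.D * (T' * R₀) - p₂.D * (T * R₀) = -(p₂.D * T - p₃.D * T') * R₀ᵀᵀ := by
    rw [Matrix.transpose_transpose]; noncomm_ring
  rw [e1, inv_mul_transpose h₀.transpose, neg_inv_eq]
  set Ni := (p₂.D * T - p₃.D * T')⁻¹
  have e2 : p₃.D * (T * R₀) - p₂.D * (T' * R₀) = (p₃.D * T - p₂.D * T') * R₀ := by
    noncomm_ring
  rw [e2]
  have e3 : (p₃.D * T - p₂.D * T') * R₀ * (R₀ᵀ * -Ni) = -((p₃.D * T - p₂.D * T') * Ni) := by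
    rw [Matrix.mul_assoc, h₀.mul_transpose_mul, Matrix.mul_neg]
  rw [e3]
  have e4 := p₂.D_comm p₃
  linear_combination (norm := noncomm_ring) -((p₁.D * p₂.D ^ 2) * hinv * R₁)
    - p₁.D * e4 * p₃.D * T * Ni * R₁ - p₁.D * p₃.D * e4 * T * Ni * R₁
    - p₁.D * p₂.D * e4 * T' * Ni * R₁

/-- The factors to the right of □⁻¹ differ by exactly -□, which cancels the inverse and leaves the
difference of the two last terms. -/
theorem box_formula_swap (hb : (box p₁.D p₂.D p₃.D R₁ R₂ R₄).det ≠ 0) :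
    (p₁.D ^ 2 * p₂.D * R₂ - p₂.D ^ 2 * p₁.D * R₁) * (box p₁.D p₂.D p₃.D R₁ R₂ R₄)⁻¹
        * (p₂.D ^ 2 - p₃.D ^ 2) * (p₃.D * R₄ - p₁.D * R₁) - p₂.D ^ 2 * p₁.D * R₁
      = (p₁.D ^ 2 * p₂.D * R₂ - p₂.D ^ 2 * p₁.D * R₁) * (box p₁.D p₂.D p₃.D R₁ R₂ R₄)⁻¹
        * (p₃.D ^ 2 - p₁.D ^ 2) * (p₂.D * R₂ - p₃.D * R₄) - p₁.D ^ 2 * p₂.D * R₂ := by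
  have hinv := Matrix.nonsing_inv_mul _ (isUnit_iff_ne_zero.2 hb)
  set B := (box p₁.D p₂.D p₃.D R₁ R₂ R₄)⁻¹
  unfold box at hinv
  linear_combination (norm := noncomm_ring)
    -((p₁.D ^ 2 * p₂.D * R₂ - p₂.D ^ 2 * p₁.D * R₁) * hinv)

/-- Exchanging the indices 1 and 2 changes four signs (prefactor, □, scalar and last difference),
which cancel in pairs. -/
theorem box_formula_comm :
    (p₂.D ^ 2 * p₁.D * R₁ - p₁.D ^ 2 * p₂.D * R₂) * (box p₂.D p₁.D p₃.D R₂ R₁ R₄)⁻¹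
        * (p₁.D ^ 2 - p₃.D ^ 2) * (p₃.D * R₄ - p₂.D * R₂) - p₁.D ^ 2 * p₂.D * R₂
      = (p₁.D ^ 2 * p₂.D * R₂ - p₂.D ^ 2 * p₁.D * R₁) * (box p₁.D p₂.D p₃.D R₁ R₂ R₄)⁻¹
        * (p₃.D ^ 2 - p₁.D ^ 2) * (p₂.D * R₂ - p₃.D * R₄) - p₁.D ^ 2 * p₂.D * R₂ := by
  rw [box_swap, neg_inv_eq]
  noncomm_ring

theorem mul_left_cancel_of_det {M N P : Mat n} (hM : M.det ≠ 0) (h : M * N = M * P) : N = P := by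
  have hu := Matrix.nonsing_inv_mul _ (isUnit_iff_ne_zero.2 hM)
  have := congrArg (M⁻¹ * ·) h
  simpa only [← Matrix.mul_assoc, hu, Matrix.one_mul] using this

theorem mul_right_cancel_of_det {M N P : Mat n} (hM : M.det ≠ 0) (h : N * M = P * M) : N = P := by
  have hu := Matrix.mul_nonsing_inv _ (isUnit_iff_ne_zero.2 hM)
  have := congrArg (· * M⁻¹) h
  simpa only [Matrix.mul_assoc, hu, Matrix.mul_one] using this

/-- Consistency on the cube: the third transform does not depend on the face it is computed from. -/
theorem third_transform_comm (ha : ∀ j, a j ≠ 0) (h₀ : IsOrth R₀) (h₁ : IsOrth R₁) (h₂ : IsOrth R₂)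
    (hG : (p₂.D * R₂ - p₁.D * R₁).det ≠ 0) (hG₁ : (p₃.D * R₄ - p₁.D * R₁).det ≠ 0)
    (hG₂ : (p₃.D * R₄ - p₂.D * R₂).det ≠ 0)
    (hb : (box p₁.D p₂.D p₃.D R₁ R₂ R₄).det ≠ 0)
    (h₃ : R₃ = bianchi p₁.D p₂.D R₁ R₂ * R₀) (h₅ : R₅ = bianchi p₁.D p₃.D R₁ R₄ * R₀)
    {R₆ : Mat n} (h₆ : R₆ = bianchi p₂.D p₃.D R₂ R₄ * R₀) :
    bianchi p₂.D p₃.D R₃ R₅ * R₁ = bianchi p₁.D p₃.D R₃ R₆ * R₂ := by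
  have hb' : (box p₂.D p₁.D p₃.D R₂ R₁ R₄).det ≠ 0 := by
    rw [box_swap, Matrix.det_neg]
    exact mul_ne_zero (pow_ne_zero _ (by norm_num)) hb
  have e1 := third_transform_eq h₀ h₁ h₂ hG hG₁ hb h₃ h₅
  have e2 := third_transform_eq h₀ h₂ h₁ (det_sub_swap_ne_zero.1 hG) hG₂ hb'
    (h₃.trans (by rw [bianchi_comm h₁ h₂])) h₆
  rw [box_formula_comm, ← box_formula_swap hb, ← e1, p₂.D_comm p₁] at e2
  refine (mul_left_cancel_of_det ?_ e2).symm
  rw [Matrix.det_mul, Matrix.det_mul]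
  exact mul_ne_zero (mul_ne_zero (p₁.det_D_ne_zero ha) (p₂.det_D_ne_zero ha)) (p₃.det_D_ne_zero ha)

/-- In the iteration nothing is assumed about □; its invertibility is forced by that of the
denominator one level higher. -/
theorem det_box_ne_zero (h₁ : IsOrth R₁)
    (hG : (p₂.D * R₂ - p₁.D * R₁).det ≠ 0) (hG' : (p₃.D * R₄ - p₁.D * R₁).det ≠ 0)
    (h₃ : R₃ = bianchi p₁.D p₂.D R₁ R₂ * R₀) (h₅ : R₅ = bianchi p₁.D p₃.D R₁ R₄ * R₀)
    (h : (p₃.D * R₅ - p₂.D * R₃).det ≠ 0) : (box p₁.D p₂.D p₃.D R₁ R₂ R₄).det ≠ 0 := by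
  refine (det_bianchi_sub_ne_zero_iff h₁ hG hG').1 ?_
  rw [h₃, h₅, ← Matrix.mul_assoc, ← Matrix.mul_assoc, ← Matrix.sub_mul, Matrix.det_mul] at h
  exact det_sub_swap_ne_zero.1 (left_ne_zero_of_mul h)

/-- The Bianchi formula determines one of its arguments. -/
theorem bianchi_injective (ha : ∀ j, a j ≠ 0) (hz : p₁.z ≠ p₂.z) (h₁ : IsOrth R₁)
    (hG : (p₂.D * R₂ - p₁.D * R₁).det ≠ 0) (hG' : (p₂.D * R₃ - p₁.D * R₁).det ≠ 0)
    (h : bianchi p₁.D p₂.D R₁ R₂ = bianchi p₁.D p₂.D R₁ R₃) : R₂ = R₃ := by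
  have e1 := add_bianchi_mul h₁ hG
  have e2 := add_bianchi_mul h₁ hG'
  rw [h, ← e2] at e1
  have hc : (p₂.z⁻¹ - p₁.z⁻¹) ≠ 0 := by
    rw [sub_ne_zero]
    exact fun h => hz (inv_injective h).symm
  -- Multiplied by the denominator this matrix becomes a nonzero scalar times an orthogonal matrix,
  -- so it can be cancelled.
  have hdet : (p₁.D + p₂.D * bianchi p₁.D p₂.D R₁ R₃).det ≠ 0 := by
    intro h0
    have := congrArg Matrix.det e2
    rw [Matrix.det_mul, h0, zero_mul, p₁.sq_sub_sq p₂, smul_mul_assoc, Matrix.one_mul,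
      Matrix.det_smul] at this
    exact mul_ne_zero (pow_ne_zero _ hc) h₁.det_ne_zero this.symm
  have e3 := mul_left_cancel_of_det hdet e1
  exact mul_left_cancel_of_det (p₂.det_D_ne_zero ha) (sub_left_injective e3)

end Bianchi

/-! ### Iterated rotations and their independence of the order. -/

section Iteration

variable {a : Fin n → ℂ} {ι : Type} {p : ι → SpectralParam a} {R : ι → Pt n → Mat n}
  {U : Set (Pt n)}

theorem iterR_nil (u : Pt n) : iterR p R [] u = 1 := by simp [iterR]

theorem iterR_singleton (i : ι) : iterR p R [i] = R i := by simp [iterR]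

theorem iterR_cons_cons (i j : ι) (l : List ι) (u : Pt n) : iterR p R (i :: j :: l) u
    = bianchi (p j).D (p i).D (iterR p R (j :: l) u) (iterR p R (i :: l) u) * iterR p R l u := by
  rw [iterR]

theorem nodup_cons_of_cons_cons {i j : ι} {l : List ι} (h : (i :: j :: l).Nodup) :
    (i :: l).Nodup := by
  simp only [List.nodup_cons, List.mem_cons, not_or] at h ⊢
  tauto

theorem nodup_swap {i j : ι} {l : List ι} (h : (i :: j :: l).Nodup) : (j :: i :: l).Nodup :=
  (List.Perm.swap j i l).nodup_iff.1 h

/-- The recursion of `iterR` at `i :: j :: l` refers to `l`, `j :: l` and `i :: l`; the induction on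
`l` therefore carries the claim for `l` and for all one-entry extensions together. The same device
recurs below. -/
theorem isOrth_of_nodup_cons_aux (hO : ∀ i, ∀ u ∈ U, IsOrth (R i u))
    (hU : IterNondegenerate p R U) (u : Pt n) (hu : u ∈ U) (l : List ι) :
    (l.Nodup → IsOrth (iterR p R l u)) ∧ ∀ i, (i :: l).Nodup → IsOrth (iterR p R (i :: l) u) := by
  induction l with
  | nil => exact ⟨fun _ => by rw [iterR_nil]; exact IsOrth.one,
      fun i _ => by rw [iterR_singleton]; exact hO i u hu⟩
  | cons j l ih =>
    refine ⟨ih.2 j, fun i hi => ?_⟩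
    have hj : (j :: l).Nodup := hi.of_cons
    rw [iterR_cons_cons]
    refine (bianchi_isOrth (ih.2 j hj) (ih.2 i (nodup_cons_of_cons_cons hi)) ?_).mul
      (ih.1 hj.of_cons)
    exact (det_denominator_ne_zero_iff (ih.2 j hj)).1 (hU i j l hi u hu)

theorem iterR_isOrth (hO : ∀ i, ∀ u ∈ U, IsOrth (R i u))
    (hU : IterNondegenerate p R U) {u : Pt n} (hu : u ∈ U) {l : List ι} (hl : l.Nodup) :
    IsOrth (iterR p R l u) :=
  (isOrth_of_nodup_cons_aux hO hU u hu l).1 hl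

theorem IterNondegenerate.det_ne_zero (hO : ∀ i, ∀ u ∈ U, IsOrth (R i u))
    (hU : IterNondegenerate p R U) {u : Pt n} (hu : u ∈ U) {i j : ι} {l : List ι}
    (hl : (i :: j :: l).Nodup) :
    ((p i).D * iterR p R (i :: l) u - (p j).D * iterR p R (j :: l) u).det ≠ 0 :=
  (det_denominator_ne_zero_iff (iterR_isOrth hO hU hu hl.of_cons)).1 (hU i j l hl u hu)

theorem iterR_swap (hO : ∀ i, ∀ u ∈ U, IsOrth (R i u))
    (hU : IterNondegenerate p R U) {u : Pt n} (hu : u ∈ U) {i j : ι} {l : List ι}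
    (hl : (i :: j :: l).Nodup) : iterR p R (i :: j :: l) u = iterR p R (j :: i :: l) u := by
  rw [iterR_cons_cons, iterR_cons_cons, bianchi_comm (iterR_isOrth hO hU hu hl.of_cons)
    (iterR_isOrth hO hU hu (nodup_cons_of_cons_cons hl))]

/-- Consistency on the cube with base `l` and directions `k`, `j`, `i`. -/
theorem iterR_cons_swap (ha : ∀ j, a j ≠ 0) (hO : ∀ i, ∀ u ∈ U, IsOrth (R i u))
    (hU : IterNondegenerate p R U) {u : Pt n} (hu : u ∈ U) {i j k : ι} {l : List ι}
    (hl : (i :: j :: k :: l).Nodup) :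
    iterR p R (i :: j :: k :: l) u = iterR p R (i :: k :: j :: l) u := by
  have hjk : (j :: k :: l).Nodup := hl.of_cons
  have hkj := nodup_swap hjk
  have hik : (i :: k :: l).Nodup := nodup_cons_of_cons_cons hl
  have hl' : (i :: k :: j :: l).Nodup := (((List.Perm.swap k j l).cons i).nodup_iff).1 hl
  have hij : (i :: j :: l).Nodup := nodup_cons_of_cons_cons hl'
  have h₀ := iterR_isOrth hO hU hu hjk.of_cons.of_cons
  have hk := iterR_isOrth hO hU hu hik.of_cons
  have hj := iterR_isOrth hO hU hu hij.of_cons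
  have hjk' := hU.det_ne_zero hO hu hjk
  have hik' := hU.det_ne_zero hO hu hik
  have hij' := hU.det_ne_zero hO hu hij
  rw [iterR_cons_cons i j (k :: l), iterR_cons_cons i k (j :: l), iterR_swap hO hU hu hkj]
  refine third_transform_comm ha h₀ hk hj hjk' hik' hij' ?_ (iterR_cons_cons j k l u)
    (iterR_cons_cons i k l u) (iterR_cons_cons i j l u)
  exact det_box_ne_zero hk hjk' hik' (iterR_cons_cons j k l u) (iterR_cons_cons i k l u)
    (hU.det_ne_zero hO hu hl)

theorem iterR_perm_aux (ha : ∀ j, a j ≠ 0) (hO : ∀ i, ∀ u ∈ U, IsOrth (R i u))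
    (hU : IterNondegenerate p R U) {u : Pt n} (hu : u ∈ U) {l l' : List ι} (h : l.Perm l') :
    (l.Nodup → iterR p R l u = iterR p R l' u) ∧
      ∀ i, (i :: l).Nodup → iterR p R (i :: l) u = iterR p R (i :: l') u := by
  induction h with
  | nil => exact ⟨fun _ => rfl, fun _ _ => rfl⟩
  | cons j hp ih =>
    refine ⟨ih.2 j, fun i hi => ?_⟩
    rw [iterR_cons_cons, iterR_cons_cons, ih.1 hi.of_cons.of_cons, ih.2 j hi.of_cons,
      ih.2 i (nodup_cons_of_cons_cons hi)]
  | swap j k l => exact ⟨fun h => iterR_swap hO hU hu h, fun i h => iterR_cons_swap ha hO hU hu h⟩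
  | trans hp hq ih₁ ih₂ =>
    exact ⟨fun h => (ih₁.1 h).trans (ih₂.1 (hp.nodup_iff.1 h)),
      fun i h => (ih₁.2 i h).trans (ih₂.2 i ((hp.cons i).nodup_iff.1 h))⟩

theorem iterR_perm (ha : ∀ j, a j ≠ 0) (hO : ∀ i, ∀ u ∈ U, IsOrth (R i u))
    (hU : IterNondegenerate p R U) {u : Pt n} (hu : u ∈ U) {l l' : List ι} (h : l.Perm l')
    (hl : l.Nodup) : iterR p R l u = iterR p R l' u :=
  (iterR_perm_aux ha hO hU hu h).1 hl

theorem iterR_congr {R' : ι → Pt n → Mat n} {u : Pt n} (l : List ι)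
    (h : ∀ j ∈ l, R j u = R' j u) : iterR p R l u = iterR p R' l u := by
  suffices ∀ l : List ι, ((∀ j ∈ l, R j u = R' j u) → iterR p R l u = iterR p R' l u) ∧
      ∀ i, (∀ j ∈ i :: l, R j u = R' j u) → iterR p R (i :: l) u = iterR p R' (i :: l) u from
    (this l).1 h
  intro l
  induction l with
  | nil =>
    exact ⟨fun _ => by rw [iterR_nil, iterR_nil], fun i h => by
      rw [iterR_singleton, iterR_singleton]; exact h i (by simp)⟩
  | cons j l ih =>
    refine ⟨ih.2 j, fun i hi => ?_⟩
    rw [iterR_cons_cons, iterR_cons_cons, ih.1 fun k hk => hi k (by simp [hk]),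
      ih.2 j fun k hk => hi k (by simp at hk ⊢; tauto),
      ih.2 i fun k hk => hi k (by simp at hk ⊢; tauto)]

/-- The rotation attached to a list containing `i` determines `R i`, the other `R j` being fixed. -/
theorem iterR_injective (ha : ∀ j, a j ≠ 0) (hz : ∀ i j, i ≠ j → (p i).z ≠ (p j).z)
    {R' : ι → Pt n → Mat n}
    (hO : ∀ i, ∀ u ∈ U, IsOrth (R i u)) (hU : IterNondegenerate p R U)
    (hO' : ∀ i, ∀ u ∈ U, IsOrth (R' i u)) (hU' : IterNondegenerate p R' U)
    {u : Pt n} (hu : u ∈ U) {i : ι} {l : List ι} (hl : l.Nodup) (hi : i ∈ l)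
    (hR : ∀ j, j ≠ i → R j u = R' j u) (h : iterR p R l u = iterR p R' l u) : R i u = R' i u := by
  -- Independence of the order allows `i` to be placed first.
  obtain ⟨m, hm⟩ : ∃ m, l.Perm (i :: m) := by
    obtain ⟨s, t, rfl⟩ := List.append_of_mem hi
    exact ⟨s ++ t, List.perm_middle⟩
  rw [iterR_perm ha hO hU hu hm hl, iterR_perm ha hO' hU' hu hm hl] at h
  have hnd : (i :: m).Nodup := hm.nodup_iff.1 hl
  clear hm hl hi
  -- The rotations of `j :: m` and `m` do not involve `R i`, so solving the Bianchi formula for its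
  -- remaining argument removes `j` and passes from `i :: j :: m` to `i :: m`.
  induction m with
  | nil => simpa only [iterR_singleton] using h
  | cons j m ih =>
    have him := nodup_cons_of_cons_cons hnd
    have hjm : (j :: m).Nodup := hnd.of_cons
    have hne : ∀ k ∈ j :: m, k ≠ i := by
      rintro k hk rfl
      exact (List.nodup_cons.1 hnd).1 hk
    refine ih ?_ him
    have e1 : iterR p R (j :: m) u = iterR p R' (j :: m) u :=
      iterR_congr _ fun k hk => hR k (hne k hk)
    have e2 : iterR p R m u = iterR p R' m u :=
      iterR_congr _ fun k hk => hR k (hne k (List.mem_cons_of_mem _ hk))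
    rw [iterR_cons_cons, iterR_cons_cons, e1, e2] at h
    have h' := mul_right_cancel_of_det (iterR_isOrth hO' hU' hu hjm.of_cons).det_ne_zero h
    have d1 := hU.det_ne_zero hO hu hnd
    rw [e1] at d1
    exact bianchi_injective ha (hz j i (hne j (by simp))) (iterR_isOrth hO' hU' hu hjm) d1
      (hU'.det_ne_zero hO' hu hnd) h'

end Iteration

end Peterson
namespace Peterson

variable {n : ℕ}

/-! ### From the differential system to isometric deformations of the quadric. -/

section Quadric

variable {a α : Fin n → ℂ} {U : Set (Pt n)}

/-- The differential of the parametrization of the quadric at `v`, applied to `w`. -/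
noncomputable def quadricTangent (α : Fin n → ℂ) (v w : Pt n) : Fin (n + 1) → ℂ :=
  Fin.snoc (α := fun _ => ℂ) (fun j => w j / α j) (v ⬝ᵥ w)

theorem snoc_dotProduct_snoc (v w : Fin n → ℂ) (s t : ℂ) :
    (Fin.snoc (α := fun _ => ℂ) v s : Fin (n + 1) → ℂ) ⬝ᵥ Fin.snoc (α := fun _ => ℂ) w t
      = v ⬝ᵥ w + s * t := by
  simp [dotProduct, Fin.sum_univ_castSucc]

theorem alpha_ne_zero (ha : ∀ j, a j ≠ 0) (hα : ∀ j, α j ^ 2 = (a j)⁻¹) (j : Fin n) : α j ≠ 0 := by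
  intro h
  have := hα j
  rw [h, zero_pow two_ne_zero] at this
  exact inv_ne_zero (ha j) this.symm

theorem div_alpha_mul_div_alpha (hα : ∀ j, α j ^ 2 = (a j)⁻¹) (j : Fin n) (x y : ℂ) :
    x / α j * (y / α j) = a j * (x * y) := by
  rw [div_mul_div_comm, ← pow_two, hα, div_inv_eq_mul, mul_comm]

theorem quadricTangent_dot (hα : ∀ j, α j ^ 2 = (a j)⁻¹) (v w w' : Pt n) :
    quadricTangent α v w ⬝ᵥ quadricTangent α v w'
      = ∑ k, a k * (w k * w' k) + (v ⬝ᵥ w) * (v ⬝ᵥ w') := by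
  rw [quadricTangent, quadricTangent, snoc_dotProduct_snoc]
  congr 1
  exact Finset.sum_congr rfl fun k _ => div_alpha_mul_div_alpha hα k _ _

theorem quadricTangent_sum {ι : Type*} (s : Finset ι) (v : Pt n) (c : ι → ℂ) (w : ι → Pt n) :
    quadricTangent α v (∑ i ∈ s, c i • w i) = ∑ i ∈ s, c i • quadricTangent α v (w i) := by
  ext k
  refine Fin.lastCases ?_ (fun k => ?_) k
  · simp [quadricTangent, dotProduct_sum, Finset.sum_apply]
  · simp [quadricTangent, Finset.sum_apply, Finset.sum_div, mul_div_assoc]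

theorem analyticOnNhd_quadricPoint {V : Pt n → Pt n} (hV : AnalyticOnNhd ℂ V U) :
    AnalyticOnNhd ℂ (fun w => quadricPoint α (V w)) U := by
  refine analyticOnNhd_vec fun k => ?_
  refine Fin.lastCases ?_ (fun k => ?_) k
  · simp only [quadricPoint, Fin.snoc_last]
    exact (analyticOnNhd_dotProduct hV hV).div analyticOnNhd_const (fun _ _ => two_ne_zero)
  · simp only [quadricPoint, Fin.snoc_castSucc, div_eq_mul_inv]
    exact (analyticOnNhd_apply hV k).mul analyticOnNhd_const

theorem pd_quadricPoint {V : Pt n → Pt n} (hV : AnalyticOnNhd ℂ V U) {u : Pt n} (hu : u ∈ U)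
    (j : Fin n) :
    pd j (fun w => quadricPoint α (V w)) u = quadricTangent α (V u) (pd j V u) := by
  have hd := (hV u hu).differentiableAt
  have hd' := differentiableAt_pi.1 hd
  have hq := (analyticOnNhd_quadricPoint (α := α) hV u hu).differentiableAt
  ext k
  rw [pd_apply hq]
  refine Fin.lastCases ?_ (fun k => ?_) k
  · simp only [quadricPoint, quadricTangent, Fin.snoc_last]
    have : (fun w => V w ⬝ᵥ V w / 2) = fun w => (2 : ℂ)⁻¹ • (V w ⬝ᵥ V w) := by
      ext w; simp [div_eq_inv_mul]
    rw [this, pd_smul_const ((analyticOnNhd_dotProduct hV hV u hu).differentiableAt),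
      pd_dotProduct hd hd, dotProduct_comm (pd j V u)]
    simp only [smul_eq_mul]
    ring
  · simp only [quadricPoint, quadricTangent, Fin.snoc_castSucc]
    have : (fun w => V w k / α k) = fun w => (α k)⁻¹ • V w k := by
      ext w; simp [div_eq_inv_mul]
    rw [this, pd_smul_const (hd' k), pd_apply hd, smul_eq_mul, div_eq_inv_mul]

/-- Only the last coordinate of the quadric is nonlinear, so the second summand points along the
last axis and is proportional to ∂_jV·∂_kV: orthogonality of the ∂_jV gives conjugacy. -/
theorem pd_pd_quadricPoint (hU : IsOpen U) {V : Pt n → Pt n} (hV : AnalyticOnNhd ℂ V U) {u : Pt n}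
    (hu : u ∈ U) (j k : Fin n) :
    pd j (pd k fun w => quadricPoint α (V w)) u = quadricTangent α (V u) (pd j (pd k V) u)
      + Fin.snoc (α := fun _ => ℂ) (0 : Fin n → ℂ) (pd j V u ⬝ᵥ pd k V u) := by
  have hk := analyticOnNhd_pd hV k
  have hd := (hV u hu).differentiableAt
  have hdk := (hk u hu).differentiableAt
  have hq := analyticOnNhd_pd (analyticOnNhd_quadricPoint (α := α) hV) k
  ext i
  rw [pd_apply (hq u hu).differentiableAt,
    pd_congr hU (fun w hw => by rw [pd_quadricPoint hV hw]) hu]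
  refine Fin.lastCases ?_ (fun i => ?_) i
  · simp only [quadricTangent, Fin.snoc_last, Pi.add_apply]
    rw [pd_dotProduct hd hdk, add_comm]
  · simp only [quadricTangent, Fin.snoc_castSucc, Pi.add_apply, Pi.zero_apply, add_zero]
    have : (fun w => pd k V w i / α i) = fun w => (α i)⁻¹ • pd k V w i := by
      ext w; simp [div_eq_inv_mul]
    rw [this, pd_smul_const (differentiableAt_pi.1 hdk i), pd_apply hdk, smul_eq_mul,
      div_eq_inv_mul]

/-- The metric of the quadric is non-degenerate where `1 + Vᵀ A V ≠ 0`. -/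
theorem eq_zero_of_quadric_metric (ha : ∀ j, a j ≠ 0) {v w : Pt n}
    (hσ : 1 + v ⬝ᵥ quadA a *ᵥ v ≠ 0)
    (h : ∀ k, a k * w k + v k * (v ⬝ᵥ w) = 0) : w = 0 := by
  have h1 : ∀ k, w k = -((a k)⁻¹ * v k * (v ⬝ᵥ w)) := by
    intro k
    have := h k
    have hk := ha k
    field_simp
    linear_combination this
  have h2 : v ⬝ᵥ w = 0 := by
    have : (1 + v ⬝ᵥ quadA a *ᵥ v) * (v ⬝ᵥ w) = 0 := by
      rw [dot_quadA, add_mul, one_mul, Finset.sum_mul]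
      nth_rewrite 1 [dotProduct]
      rw [← Finset.sum_add_distrib]
      refine Finset.sum_eq_zero fun k _ => ?_
      linear_combination v k * h1 k
    exact (mul_eq_zero.1 this).resolve_left hσ
  ext k
  rw [h1, h2]
  simp

theorem mul_E_mulVec (R : Mat n) (j k : Fin n) (v : Pt n) : ((R * E j) *ᵥ v) k = R k j * v j := by
  rw [← Matrix.mulVec_mulVec, E, Matrix.mulVec, dotProduct]
  simp [Matrix.single_mulVec, Function.update_apply]

theorem mul_E_mulVec_dot {R : Mat n} (hR : IsOrth R) (j k : Fin n) (v w : Pt n) :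
    ((R * E j) *ᵥ v) ⬝ᵥ ((R * E k) *ᵥ w) = if j = k then v j * w k else 0 := by
  have h : (Rᵀ * R) j k = if j = k then 1 else 0 := by
    rw [show Rᵀ * R = 1 from hR, Matrix.one_apply]
  rw [Matrix.mul_apply] at h
  simp only [dotProduct, mul_E_mulVec]
  calc ∑ i, R i j * v j * (R i k * w k) = (∑ i, Rᵀ j i * R i k) * (v j * w k) := by
        rw [Finset.sum_mul]
        exact Finset.sum_congr rfl fun i _ => by rw [Matrix.transpose_apply]; ring
    _ = _ := by rw [h]; simp

theorem exists_eq_sum_mul_E_mulVec {R : Mat n} (hR : IsOrth R) {v : Pt n} (hv : ∀ j, v j ≠ 0)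
    (y : Pt n) : ∃ c : Fin n → ℂ, y = ∑ j, c j • ((R * E j) *ᵥ v) := by
  refine ⟨fun j => (Rᵀ *ᵥ y) j / v j, ?_⟩
  have h : R *ᵥ (Rᵀ *ᵥ y) = y := by
    rw [Matrix.mulVec_mulVec, hR.mul_transpose, Matrix.one_mulVec]
  ext k
  conv_lhs => rw [← h]
  rw [Finset.sum_apply]
  nth_rewrite 1 [Matrix.mulVec]
  refine Finset.sum_congr rfl fun j _ => ?_
  rw [Pi.smul_apply, mul_E_mulVec, smul_eq_mul]
  have := hv j
  field_simp

/-- A solution of the system with non-degenerate metric is an isometric deformation of the quadric. -/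
theorem IsDeformationDatum.isIsometricDeformation (ha : ∀ j, a j ≠ 0)
    (hα : ∀ j, α j ^ 2 = (a j)⁻¹) (hn : n ≠ 0) {S : Datum n} (hU : IsOpen U)
    (hS : IsDeformationDatum a U S) (hreg : S.RegularOn U) :
    IsIsometricDeformation α U S.V S.x := by
  have hV := hS.solution.hol_V
  have hx := hS.hol_x
  have hpdx : ∀ u ∈ U, ∀ j, pd j S.x u = fun l => S.frameV l u ⬝ᵥ pd j S.V u :=
    fun u hu j => funext fun l => hS.dx u hu j l
  have hgram : ∀ u ∈ U, FrameGram a (fun l => S.frameV l u) (fun l => S.frameL l u)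
      (S.V u) (S.L u) := by
    intro u hu
    refine (frameGram_iff_frameOrthonormal (by simp; omega) ha).2
      ⟨hS.frame_orthonormal u hu, hS.frame_orthogonal u hu, ?_⟩
    rw [hS.solution.prime_integral u hu]
    ring
  have hdot : ∀ u ∈ U, ∀ w w' : Pt n, ∑ l, (S.frameV l u ⬝ᵥ w) * (S.frameV l u ⬝ᵥ w')
      = quadricTangent α (S.V u) w ⬝ᵥ quadricTangent α (S.V u) w' := by
    -- The dual relation ∑ V_l V_lᵀ = A⁻¹ + V Vᵀ, evaluated on w and w', is the metric of the
    -- quadric.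
    intro u hu w w'
    rw [quadricTangent_dot hα]
    have e1 : ∀ (f : Pt n), (f ⬝ᵥ w) * (f ⬝ᵥ w') = ∑ j, ∑ k, w j * w' k * (f j * f k) := by
      intro f
      rw [dotProduct, dotProduct, Finset.sum_mul_sum]
      exact Finset.sum_congr rfl fun j _ => Finset.sum_congr rfl fun k _ => by ring
    simp only [e1]
    rw [Finset.sum_comm]
    have e2 : ∀ j, ∑ l, ∑ k, w j * w' k * (S.frameV l u j * S.frameV l u k)
        = ∑ k, w j * w' k * (S.V u j * S.V u k) + a j * (w j * w' j) := by
      intro j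
      rw [Finset.sum_comm]
      have : ∀ k, ∑ l, w j * w' k * (S.frameV l u j * S.frameV l u k)
          = w j * w' k * (S.V u j * S.V u k) + if j = k then a j * (w j * w' j) else 0 := by
        intro k
        rw [← Finset.mul_sum, sub_eq_iff_eq_add.1 ((hgram u hu).vv j k)]
        by_cases hjk : j = k
        · subst hjk; simp; ring
        · simp [hjk]
      simp only [this, Finset.sum_add_distrib]
      simp
    simp only [e2, Finset.sum_add_distrib]
    ring
  -- Both ∂_jV_l and ∂_kV are multiples of columns of R, hence orthogonal for j ≠ k.
  have hsecond : ∀ u ∈ U, ∀ j k l, pd j (pd k S.x) u l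
      = (if j = k then S.frameL l u j * S.L u k else 0) + S.frameV l u ⬝ᵥ pd j (pd k S.V) u := by
    intro u hu j k l
    have hVk := analyticOnNhd_pd hV k
    rw [pd_apply (analyticOnNhd_pd hx k u hu).differentiableAt,
      pd_congr hU (fun w hw => hS.dx w hw k l) hu,
      pd_dotProduct ((hS.frame_solution l).hol_V u hu).differentiableAt
        (hVk u hu).differentiableAt,
      (hS.frame_solution l).dV u hu, hS.solution.dV u hu,
      mul_E_mulVec_dot (hS.compatible.orth u hu)]
  have hspan : ∀ u ∈ U, ∀ y : Pt n, ∃ c : Fin n → ℂ, y = ∑ j, c j • pd j S.V u := by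
    intro u hu y
    obtain ⟨c, hc⟩ := exists_eq_sum_mul_E_mulVec (hS.compatible.orth u hu) (hreg u hu).1 y
    exact ⟨c, by simpa only [hS.solution.dV u hu] using hc⟩
  have hzero : ∀ u ∈ U, ∀ y : Pt n, (∀ j, y ⬝ᵥ pd j S.V u = 0) → y = 0 := by
    intro u hu y hy
    have : ∀ z : Pt n, y ⬝ᵥ z = 0 := by
      intro z
      obtain ⟨c, rfl⟩ := hspan u hu z
      simp [dotProduct_sum, hy]
    ext k
    simpa using this (Pi.single k 1)
  have hσ : ∀ u ∈ U, 1 + S.V u ⬝ᵥ quadA a *ᵥ S.V u ≠ 0 := by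
    intro u hu h
    refine (hreg u hu).2 ?_
    rw [hS.solution.prime_integral u hu, add_comm, h, neg_zero]
  refine ⟨hV, hx, ?_, ?_, ?_, ?_, ?_⟩
  · intro u hu j k
    rw [pd_quadricPoint hV hu, pd_quadricPoint hV hu, ← hdot u hu, hpdx u hu, hpdx u hu]
    rfl
  · intro u hu hdet
    obtain ⟨y, hy, hy'⟩ := Matrix.exists_mulVec_eq_zero_iff.2 hdet
    refine hy ?_
    -- A kernel vector y of the Gram matrix gives a vector w orthogonal to all tangent vectors, so w
    -- = 0; pairing with ∂_kV leaves y_k λ_k² = 0.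
    set w := ∑ k, y k • pd k S.V u with hw
    have h1 : ∀ j, quadricTangent α (S.V u) (pd j S.V u) ⬝ᵥ quadricTangent α (S.V u) w = 0 := by
      intro j
      have := congrFun hy' j
      simp only [Matrix.mulVec, dotProduct, Matrix.of_apply, Pi.zero_apply] at this
      rw [hw, quadricTangent_sum, dotProduct_sum, ← this]
      refine Finset.sum_congr rfl fun k _ => ?_
      rw [pd_quadricPoint hV hu, pd_quadricPoint hV hu, dotProduct_smul, smul_eq_mul, mul_comm]
      rfl
    have h2 : w = 0 := by
      refine eq_zero_of_quadric_metric ha (hσ u hu) fun k => ?_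
      have := congrFun (hzero u hu (fun k => a k * w k + S.V u k * (S.V u ⬝ᵥ w)) (fun j => ?_)) k
      · exact this
      · have h3 := h1 j
        rw [quadricTangent_dot hα] at h3
        rw [← h3]
        simp only [dotProduct, Finset.sum_mul, ← Finset.sum_add_distrib]
        exact Finset.sum_congr rfl fun i _ => by ring
    ext k
    have h4 : w ⬝ᵥ pd k S.V u = y k * (S.L u k * S.L u k) := by
      rw [hw, sum_dotProduct]
      simp only [smul_dotProduct, hS.solution.dV u hu, mul_E_mulVec_dot (hS.compatible.orth u hu)]
      simp
    rw [h2, zero_dotProduct] at h4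
    simpa [(hreg u hu).1 k] using h4.symm
  · intro u hu j k hjk
    obtain ⟨c, hc⟩ := hspan u hu (pd j (pd k S.V) u)
    have : pd j (pd k S.x) u = ∑ i, c i • pd i S.x u := by
      ext l
      rw [hsecond u hu, if_neg hjk, hc, zero_add, dotProduct_sum, Finset.sum_apply]
      refine Finset.sum_congr rfl fun i _ => ?_
      rw [dotProduct_smul, Pi.smul_apply, hpdx u hu]
    rw [this]
    exact Submodule.sum_mem _ fun i _ => Submodule.smul_mem _ _ (Submodule.subset_span ⟨i, rfl⟩)
  · intro u hu j k hjk
    obtain ⟨c, hc⟩ := hspan u hu (pd j (pd k S.V) u)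
    rw [pd_pd_quadricPoint hU hV hu, hc, quadricTangent_sum, hS.solution.dV u hu,
      hS.solution.dV u hu, mul_E_mulVec_dot (hS.compatible.orth u hu), if_neg hjk]
    have : (Fin.snoc (α := fun _ => ℂ) (0 : Fin n → ℂ) (0 : ℂ) : Fin (n + 1) → ℂ) = 0 := by
      ext i
      refine Fin.lastCases ?_ (fun i => ?_) i <;> simp
    rw [this, add_zero]
    refine Submodule.sum_mem _ fun i _ => Submodule.smul_mem _ _ (Submodule.subset_span ⟨i, ?_⟩)
    exact pd_quadricPoint hV hu i
  · intro u hu N N₀ hN hN₀ h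
    -- Normality gives ∑ N_l V_l = 0, and the diagonal second derivatives give ∑ N_l Λ_l = -νΛ.
    -- Pairing with (V, Λ) yields ν|Λ|² = 0, and then pairing with the frame pairs yields N = 0.
    have e1 : ∑ l, N l • S.frameV l u = 0 := by
      refine hzero u hu _ fun j => ?_
      rw [sum_dotProduct, ← hN j, hpdx u hu]
      exact Finset.sum_congr rfl fun l _ => smul_dotProduct _ _ _
    set ν := N₀ (Fin.last n) with hν
    have hN₀' : N₀ = Fin.snoc (α := fun _ => ℂ) (fun k => N₀ k.castSucc) ν := by
      ext k
      refine Fin.lastCases ?_ (fun k => ?_) k <;> simp [hν]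
    have e2 : (fun k => N₀ k.castSucc / α k) + ν • S.V u = 0 := by
      refine hzero u hu _ fun j => ?_
      have := hN₀ j
      rw [pd_quadricPoint hV hu, hN₀', quadricTangent, snoc_dotProduct_snoc] at this
      rw [add_dotProduct, smul_dotProduct, smul_eq_mul, ← this]
      congr 1
      exact Finset.sum_congr rfl fun i _ => by ring
    have e3 : ∑ l, N l • S.frameL l u + ν • S.L u = 0 := by
      ext j
      have hj := h j j
      rw [pd_pd_quadricPoint hU hV hu, dotProduct_add] at hj
      have t1 : N ⬝ᵥ pd j (pd j S.x) u = (∑ l, N l • S.frameL l u) j * S.L u j := by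
        have : N ⬝ᵥ pd j (pd j S.x) u = (∑ l, N l • S.frameL l u) j * S.L u j
            + (∑ l, N l • S.frameV l u) ⬝ᵥ pd j (pd j S.V) u := by
          rw [sum_dotProduct, Finset.sum_apply, Finset.sum_mul, ← Finset.sum_add_distrib,
            dotProduct]
          refine Finset.sum_congr rfl fun l _ => ?_
          rw [hsecond u hu, if_pos rfl, smul_dotProduct, Pi.smul_apply, smul_eq_mul, smul_eq_mul]
          ring
        rw [this, e1, zero_dotProduct, add_zero]
      have t2 : N₀ ⬝ᵥ quadricTangent α (S.V u) (pd j (pd j S.V) u) = 0 := by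
        have : N₀ ⬝ᵥ quadricTangent α (S.V u) (pd j (pd j S.V) u)
            = ((fun k => N₀ k.castSucc / α k) + ν • S.V u) ⬝ᵥ pd j (pd j S.V) u := by
          rw [hN₀', quadricTangent, snoc_dotProduct_snoc, add_dotProduct, smul_dotProduct,
            smul_eq_mul]
          congr 1
          exact Finset.sum_congr rfl fun i _ => by simp; ring
        rw [this, e2, zero_dotProduct]
      have t3 : N₀ ⬝ᵥ Fin.snoc (α := fun _ => ℂ) (0 : Fin n → ℂ) (pd j S.V u ⬝ᵥ pd j S.V u)
          = ν * (S.L u j * S.L u j) := by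
        rw [hN₀', snoc_dotProduct_snoc, hS.solution.dV u hu,
          mul_E_mulVec_dot (hS.compatible.orth u hu)]
        simp
      rw [t1, t2, t3] at hj
      have : ((∑ l, N l • S.frameL l u) j + ν * S.L u j) * S.L u j = 0 := by
        linear_combination hj
      simpa using (mul_eq_zero.1 this).resolve_right ((hreg u hu).1 j)
    have hpair : ∀ y m : Pt n, ∑ l, N l * (S.frameV l u ⬝ᵥ quadA a *ᵥ y + S.frameL l u ⬝ᵥ m)
        = -(ν * (S.L u ⬝ᵥ m)) := by
      intro y m
      have t1 := congrArg (· ⬝ᵥ quadA a *ᵥ y) e1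
      have t2 := congrArg (· ⬝ᵥ m) e3
      simp only [sum_dotProduct, smul_dotProduct, zero_dotProduct, add_dotProduct,
        smul_eq_mul] at t1 t2
      simp only [mul_add, Finset.sum_add_distrib]
      linear_combination t1 + t2
    have hν0 : ν = 0 := by
      have := hpair (S.V u) (S.L u)
      simp only [hS.frame_orthogonal u hu, mul_zero, Finset.sum_const_zero] at this
      have := neg_eq_zero.1 this.symm
      exact (mul_eq_zero.1 this).resolve_right (hreg u hu).2
    constructor
    · ext m
      have := hpair (S.frameV m u) (S.frameL m u)
      simp only [hS.frame_orthonormal u hu, hν0, zero_mul, neg_zero] at this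
      simpa using this
    · ext k
      refine Fin.lastCases ?_ (fun k => ?_) k
      · exact hν0
      · have := congrFun e2 k
        simpa [hν0, alpha_ne_zero ha hα k] using this

theorem IsDeformationDatum.mono {U' : Set (Pt n)} {S : Datum n} (hS : IsDeformationDatum a U S)
    (h : U' ⊆ U) : IsDeformationDatum a U' S where
  compatible := ⟨hS.compatible.hol.mono h, fun u hu => hS.compatible.orth u (h hu),
    fun u hu => hS.compatible.gauss u (h hu), fun u hu => hS.compatible.codazzi u (h hu)⟩
  solution := ⟨⟨hS.solution.hol_V.mono h, hS.solution.hol_L.mono h,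
    fun u hu => hS.solution.dV u (h hu), fun u hu => hS.solution.dL u (h hu)⟩,
    fun u hu => hS.solution.prime_integral u (h hu)⟩
  frame_solution l := ⟨(hS.frame_solution l).hol_V.mono h, (hS.frame_solution l).hol_L.mono h,
    fun u hu => (hS.frame_solution l).dV u (h hu), fun u hu => (hS.frame_solution l).dL u (h hu)⟩
  frame_orthonormal u hu := hS.frame_orthonormal u (h hu)
  frame_orthogonal u hu := hS.frame_orthogonal u (h hu)
  hol_x := hS.hol_x.mono h
  dx u hu := hS.dx u (h hu)

theorem IsDeformationDatum.isRealized (ha : ∀ j, a j ≠ 0) (hα : ∀ j, α j ^ 2 = (a j)⁻¹)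
    (hn : n ≠ 0) {S : Datum n} (hS : IsDeformationDatum a U S) : IsRealized a α U S :=
  ⟨hS, fun _ hU' ho hreg => (hS.mono hU').isIsometricDeformation ha hα hn ho hreg⟩

end Quadric

end Peterson
namespace Peterson

variable {n : ℕ}

/-! ### Vector identities in the matrix ring. -/

section Columns

/-- The square matrix all of whose columns are `v`; it turns identities between vectors into
identities in the ring of square matrices. -/
def colM (v : Pt n) : Mat n := Matrix.of fun i _ => v i

theorem colM_mulVec (M : Mat n) (v : Pt n) : colM (M *ᵥ v) = M * colM v := rfl

theorem colM_add (v w : Pt n) : colM (v + w) = colM v + colM w := rfl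

theorem colM_sub (v w : Pt n) : colM (v - w) = colM v - colM w := rfl

theorem colM_neg (v : Pt n) : colM (-v) = -colM v := rfl

theorem colM_injective {v w : Pt n} (h : colM v = colM w) : v = w := by
  ext i
  exact congrFun (congrFun h i) i

theorem dotProduct_eq_of_colM [Nonempty (Fin n)] {x y : ℂ}
    (h : (Matrix.of fun _ _ => x : Mat n) = Matrix.of fun _ _ => y) : x = y := by
  obtain ⟨i⟩ := ‹Nonempty (Fin n)›
  exact congrFun (congrFun h i) i

end Columns

/-! ### Compatibility conditions and the Riccati equation. -/

section Rotation

variable {a : Fin n → ℂ} {U : Set (Pt n)} {R R₀ R₁ : Pt n → Mat n} {p : SpectralParam a}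

theorem sum_E : ∑ j, (E j : Mat n) = 1 := by
  simp only [E_eq_diagonal]
  ext k l
  simp [Matrix.sum_apply, Matrix.diagonal_apply, Matrix.one_apply, Pi.single_apply]

theorem E_mul_mul_E (j : Fin n) (B : Mat n) : E j * B * E j = B j j • E j := by
  rw [E, Matrix.single_mul_mul_single]
  simp

theorem transpose_mul_pdM_skew (hU : IsOpen U) (hR : HolM U R) (hO : ∀ u ∈ U, IsOrth (R u))
    {u : Pt n} (hu : u ∈ U) (j : Fin n) : (pdM j R u)ᵀ * R u = -((R u)ᵀ * pdM j R u) := by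
  have h : pdM j (fun w => (R w)ᵀ * R w) u = 0 := by
    rw [pdM_congr (S := fun _ => 1) hU hO hu, pdM_const]
  rw [pdM_mul hR.transpose hR hu, pdM_transpose] at h
  exact eq_neg_of_add_eq_zero_left h

theorem pdM_transpose_eq (hU : IsOpen U) (hR : HolM U R) (hO : ∀ u ∈ U, IsOrth (R u))
    {u : Pt n} (hu : u ∈ U) (j : Fin n) :
    (pdM j R u)ᵀ = -((R u)ᵀ * pdM j R u * (R u)ᵀ) := by
  have h := congrArg (· * (R u)ᵀ) (transpose_mul_pdM_skew hU hR hO hu j)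
  simpa only [Matrix.mul_assoc, (hO u hu).mul_transpose, Matrix.mul_one, Matrix.neg_mul] using h

/-- The off-diagonal entries of B play the role of rotation coefficients. Summing over k with ∑ E_k
= 1 gives the formula; the leftover terms cancel because E_k B E_k and E_k Bᵀ E_k are the same
multiple of E_k. -/
theorem omega_eq_of_rotation {u : Pt n} {B : Mat n}
    (h : ∀ j, (R u)ᵀ * pdM j R u = E j * B - Bᵀ * E j) (j : Fin n) :
    omega R j u = B * E j - E j * Bᵀ := by
  have h2 : ∀ k, (E k * E k : Mat n) = E k := by
    intro k
    rw [E, Matrix.single_mul_single_same, mul_one]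
  have h1 : ∀ k : Fin n, E k * (R u)ᵀ * pdM k R u * E j + E j * (R u)ᵀ * pdM k R u * E k
      = E k * (B * E j) - (E j * Bᵀ) * E k
        + ((E j * E k) * B * E k - E k * Bᵀ * (E k * E j)) := by
    intro k
    have e1 := h k
    set X := pdM k R u
    set Y := (R u)ᵀ
    linear_combination (norm := noncomm_ring) E k * e1 * E j + E j * e1 * E k
      + h2 k * B * E j - E j * Bᵀ * h2 k
  have h3 : ∑ k, ((E j * E k) * B * E k - E k * Bᵀ * (E k * E j)) = 0 := by
    refine Finset.sum_eq_zero fun k _ => ?_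
    have e1 := E_mul_mul_E k B
    have e2 := E_mul_mul_E k Bᵀ
    rw [Matrix.transpose_apply, ← e1] at e2
    have e3 := E_mul_mul_E k B
    have e4 : E j * (E k * B * E k) = (E k * B * E k) * E j := by
      rw [e3, mul_smul_comm, smul_mul_assoc, E_comm]
    linear_combination (norm := noncomm_ring) e4 - e2 * E j
  unfold omega
  simp only [h1]
  rw [Finset.sum_add_distrib, h3, Finset.sum_sub_distrib, ← Finset.sum_mul, ← Finset.mul_sum, sum_E, Matrix.one_mul, Matrix.mul_one, add_zero]

theorem omega_apply (u : Pt n) (j l m : Fin n) : omega R j u l m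
    = (if m = j then ((R u)ᵀ * pdM l R u) l j else 0)
      + (if l = j then ((R u)ᵀ * pdM m R u) j m else 0) := by
  have h : ∀ (i k : Fin n) (B : Mat n), (E i * B * E k) l m
      = if l = i then (if m = k then B i k else 0) else 0 := by
    intro i k B
    rw [E, E, Matrix.single_mul_mul_single]
    simp only [one_mul, mul_one, Matrix.single_apply]
    by_cases h1 : l = i <;> by_cases h2 : m = k <;> simp [h1, h2, eq_comm]
  unfold omega
  simp only [Matrix.sum_apply, Matrix.add_apply, Matrix.mul_assoc (E _) (R u)ᵀ, h,
    Finset.sum_add_distrib]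
  congr 1
  · simp
  · by_cases h1 : l = j <;> simp [h1]

/-- The Codazzi equation says that Rᵀ∂_kR vanishes off its k-th row and column. The k-th row becomes
the k-th row of B, and skew symmetry supplies the column. -/
theorem exists_rotation (hU : IsOpen U) (hR : IsCompatible a U R) {u : Pt n} (hu : u ∈ U) :
    ∃ B : Mat n, ∀ j, (R u)ᵀ * pdM j R u = E j * B - Bᵀ * E j := by
  have hskew : ∀ j l m, ((R u)ᵀ * pdM j R u) l m = -((R u)ᵀ * pdM j R u) m l := by
    intro j l m
    have h := transpose_mul_pdM_skew hU hR.hol hR.orth hu j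
    have h2 : ((R u)ᵀ * pdM j R u)ᵀ = -((R u)ᵀ * pdM j R u) := by
      rw [Matrix.transpose_mul, Matrix.transpose_transpose, h]
    exact congrFun (congrFun h2 m) l
  have hdiag : ∀ j l, ((R u)ᵀ * pdM j R u) l l = 0 := fun j l => self_eq_neg.1 (hskew j l l)
  -- In the (j, m) entry of the Codazzi equation, besides this entry, only ω_k at (j, j) can occur
  -- (when m = j), and it is zero for j ≠ k.
  have hz : ∀ k j m, j ≠ k → m ≠ k → ((R u)ᵀ * pdM k R u) j m = 0 := by
    intro k j m hjk hmk
    have h := congrFun (congrFun (hR.codazzi u hu j k) j) m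
    have hEl : ∀ (i : Fin n) (B : Mat n), (E i * B) j m = if i = j then B j m else 0 := by
      intro i B
      rw [E_eq_diagonal, Matrix.diagonal_mul, Pi.single_apply]
      rcases eq_or_ne i j with rfl | hi
      · simp
      · simp [hi, hi.symm]
    have hEr : ∀ (i : Fin n) (B : Mat n), (B * E i) j m = if i = m then B j m else 0 := by
      intro i B
      rw [E_eq_diagonal, Matrix.mul_diagonal, Pi.single_apply]
      rcases eq_or_ne i m with rfl | hi
      · simp
      · simp [hi, hi.symm]
    simp only [Matrix.sub_apply, Matrix.mul_assoc (E _) (R u)ᵀ, hEl, hEr, if_true,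
      Matrix.zero_apply, if_neg (Ne.symm hjk), if_neg (Ne.symm hmk), zero_sub, sub_zero] at h
    have h0 : (if j = m then omega R k u j m else 0) = 0 := by
      by_cases hjm : j = m
      · rw [if_pos hjm, omega_apply, if_neg hmk, if_neg hjk, add_zero]
      · rw [if_neg hjm]
    rw [h0, neg_zero, zero_sub] at h
    exact neg_eq_zero.1 h
  refine ⟨Matrix.of fun k m => ((R u)ᵀ * pdM k R u) k m, fun j => ?_⟩
  ext l m
  rw [Matrix.sub_apply, E_eq_diagonal, Matrix.diagonal_mul, Matrix.mul_diagonal]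
  simp only [Pi.single_apply, Matrix.of_apply, Matrix.transpose_apply]
  by_cases hl : l = j
  · subst hl
    by_cases hm : m = l
    · subst hm
      simp [hdiag]
    · simp [hm]
  · by_cases hm : m = j
    · subst hm
      simp [hl]
      exact hskew _ _ _
    · simp [hl, hm, hz j l m hl hm]

theorem codazzi_of_rotation {u : Pt n} {B : Mat n}
    (h : ∀ j, (R u)ᵀ * pdM j R u = E j * B - Bᵀ * E j) (j k : Fin n) :
    (omega R j u * E k - omega R k u * E j)
      - (E j * (R u)ᵀ * pdM k R u - E k * (R u)ᵀ * pdM j R u) = 0 := by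
  rw [omega_eq_of_rotation h, omega_eq_of_rotation h, Matrix.mul_assoc (E j) (R u)ᵀ,
    Matrix.mul_assoc (E k) (R u)ᵀ, h, h]
  linear_combination (norm := noncomm_ring) B * E_comm j k - E_comm j k * B

theorem omega_transpose_of_rotation {u : Pt n} {B : Mat n}
    (h : ∀ j, (R u)ᵀ * pdM j R u = E j * B - Bᵀ * E j) (j : Fin n) :
    (omega R j u)ᵀ = -omega R j u := by
  rw [omega_eq_of_rotation h, Matrix.transpose_sub, Matrix.transpose_mul, Matrix.transpose_mul,
    Matrix.transpose_transpose, E_transpose, neg_sub]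

theorem IsRiccati.transpose_mul_pdM (hR : IsRiccati p U R₀ R₁) (hO : ∀ u ∈ U, IsOrth (R₁ u))
    {u : Pt n} (hu : u ∈ U) (j : Fin n) :
    (R₁ u)ᵀ * pdM j R₁ u = -omega R₀ j u + E j * ((R₀ u)ᵀ * p.D * R₁ u)
      - ((R₀ u)ᵀ * p.D * R₁ u)ᵀ * E j := by
  have h1 : (R₁ u)ᵀ * R₁ u = 1 := hO u hu
  rw [hR.eqn u hu, Matrix.transpose_mul, Matrix.transpose_mul, Matrix.transpose_transpose,
    p.D_transpose]
  linear_combination (norm := noncomm_ring) -(h1 * omega R₀ j u)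
    + h1 * E j * (R₀ u)ᵀ * p.D * R₁ u

/-- The form of `exists_rotation` is inherited with Bᵀ + R₀ᵀDR₁ in place of B: the form ω₀ in the
Riccati equation exchanges B and Bᵀ, so the new ω contains -R₀ᵀdR₀. -/
theorem IsRiccati.rotation (hU : IsOpen U) (hR₀ : IsCompatible a U R₀)
    (hR : IsRiccati p U R₀ R₁) (hO : ∀ u ∈ U, IsOrth (R₁ u)) {u : Pt n} (hu : u ∈ U) :
    (∃ B : Mat n, ∀ j, (R₁ u)ᵀ * pdM j R₁ u = E j * B - Bᵀ * E j) ∧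
    ∀ j, omega R₁ j u = -((R₀ u)ᵀ * pdM j R₀ u) + (R₀ u)ᵀ * p.D * R₁ u * E j
      - E j * ((R₀ u)ᵀ * p.D * R₁ u)ᵀ := by
  obtain ⟨B, hB⟩ := exists_rotation hU hR₀ hu
  have h : ∀ j, (R₁ u)ᵀ * pdM j R₁ u = E j * (Bᵀ + (R₀ u)ᵀ * p.D * R₁ u)
      - (Bᵀ + (R₀ u)ᵀ * p.D * R₁ u)ᵀ * E j := by
    intro j
    rw [hR.transpose_mul_pdM hO hu, omega_eq_of_rotation hB, Matrix.transpose_add,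
      Matrix.transpose_transpose]
    noncomm_ring
  refine ⟨⟨_, h⟩, fun j => ?_⟩
  rw [omega_eq_of_rotation h, hB, Matrix.transpose_add, Matrix.transpose_transpose]
  noncomm_ring

/-- The derivative of `M = R₀ᵀ D R₁`. -/
theorem IsRiccati.pdM_coupling (hU : IsOpen U) (hR₀ : IsCompatible a U R₀)
    (hR : IsRiccati p U R₀ R₁) {u : Pt n} (hu : u ∈ U) (j : Fin n) :
    pdM j (fun w => (R₀ w)ᵀ * p.D * R₁ w) u
      = -((R₀ u)ᵀ * pdM j R₀ u * ((R₀ u)ᵀ * p.D * R₁ u))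
        - (R₀ u)ᵀ * p.D * R₁ u * omega R₀ j u
        + (R₀ u)ᵀ * p.D * R₁ u * E j * ((R₀ u)ᵀ * p.D * R₁ u)
        - (R₀ u)ᵀ * p.D * p.D * R₀ u * E j := by
  rw [pdM_mul (hR₀.hol.transpose.mul (HolM.const _)) hR.hol hu,
    pdM_mul hR₀.hol.transpose (HolM.const _) hu, pdM_const, pdM_transpose,
    pdM_transpose_eq hU hR₀.hol hR₀.orth hu, hR.eqn u hu]
  noncomm_ring

/-- A solution of the Riccati equation satisfies the compatibility conditions. -/
theorem IsRiccati.isCompatible (hU : IsOpen U) (hR₀ : IsCompatible a U R₀)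
    (hR : IsRiccati p U R₀ R₁) (hO : ∀ u ∈ U, IsOrth (R₁ u)) : IsCompatible a U R₁ := by
  refine ⟨hR.hol, hO, fun u hu j k => ?_, fun u hu j k => ?_⟩
  · have hM : HolM U (fun w => (R₀ w)ᵀ * p.D * R₁ w) :=
      (hR₀.hol.transpose.mul (HolM.const _)).mul hR.hol
    have hG : ∀ k, HolM U (fun w => (R₀ w)ᵀ * pdM k R₀ w) := fun k =>
      hR₀.hol.transpose.mul (hR₀.hol.pdM k)
    have hder : ∀ j k, pdM j (omega R₁ k) u = -((pdM j R₀ u)ᵀ * pdM k R₀ u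
        + (R₀ u)ᵀ * pdM j (pdM k R₀) u)
        + pdM j (fun w => (R₀ w)ᵀ * p.D * R₁ w) u * E k
        - E k * (pdM j (fun w => (R₀ w)ᵀ * p.D * R₁ w) u)ᵀ := by
      intro j k
      rw [pdM_congr hU (fun w hw => (hR.rotation hU hR₀ hO hw).2 k) hu,
        pdM_sub ((hG k).neg.add (hM.mul (HolM.const _))) ((HolM.const _).mul hM.transpose) hu,
        pdM_add (hG k).neg (hM.mul (HolM.const _)) hu, pdM_neg,
        pdM_mul hR₀.hol.transpose (hR₀.hol.pdM k) hu, pdM_mul hM (HolM.const _) hu,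
        pdM_mul (HolM.const _) hM.transpose hu, pdM_transpose, pdM_transpose, pdM_const]
      noncomm_ring
    obtain ⟨B, hB⟩ := exists_rotation hU hR₀ hu
    have hw := omega_transpose_of_rotation hB
    have hGt : ∀ j, ((R₀ u)ᵀ * pdM j R₀ u)ᵀ = -((R₀ u)ᵀ * pdM j R₀ u) := by
      intro j
      rw [Matrix.transpose_mul, Matrix.transpose_transpose,
        transpose_mul_pdM_skew hU hR₀.hol hR₀.orth hu]
    rw [hder, hder, pdM_comm hR₀.hol hu k j, hR.pdM_coupling hU hR₀ hu,
      hR.pdM_coupling hU hR₀ hu, (hR.rotation hU hR₀ hO hu).2, (hR.rotation hU hR₀ hO hu).2]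
    have hc := codazzi_of_rotation hB j k
    have hgg : ∀ j k, (pdM j R₀ u)ᵀ * pdM k R₀ u
        = -((R₀ u)ᵀ * pdM j R₀ u * ((R₀ u)ᵀ * pdM k R₀ u)) := by
      intro j k
      rw [pdM_transpose_eq hU hR₀.hol hR₀.orth hu]
      noncomm_ring
    rw [hgg, hgg]
    -- D² = z⁻¹ - A makes the quadric enter; the scalar z⁻¹ drops out of the antisymmetrized Gauss
    -- equation.
    have hMM : ((R₀ u)ᵀ * p.D * R₁ u)ᵀ * ((R₀ u)ᵀ * p.D * R₁ u)
        = p.z⁻¹ • 1 - (R₁ u)ᵀ * quadA a * R₁ u := by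
      have e0 := (hR₀.orth u hu).mul_transpose
      have e1 : (R₁ u)ᵀ * R₁ u = 1 := hO u hu
      have e2 := p.D_mul_D
      have e3 : p.z⁻¹ • (1 : Mat n) = (R₁ u)ᵀ * (p.z⁻¹ • 1) * R₁ u := by
        simp [e1]
      rw [e3, Matrix.transpose_mul, Matrix.transpose_mul, Matrix.transpose_transpose,
        p.D_transpose]
      linear_combination (norm := noncomm_ring) (R₁ u)ᵀ * p.D * e0 * p.D * R₁ u
        + (R₁ u)ᵀ * e2 * R₁ u
    have hX : ((R₀ u)ᵀ * p.D * p.D * R₀ u)ᵀ = (R₀ u)ᵀ * p.D * p.D * R₀ u := by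
      simp only [Matrix.transpose_mul, Matrix.transpose_transpose, p.D_transpose,
        Matrix.mul_assoc]
    have hRHS : E j * (R₁ u)ᵀ * quadA a * R₁ u * E k - E k * (R₁ u)ᵀ * quadA a * R₁ u * E j
        = E k * (((R₀ u)ᵀ * p.D * R₁ u)ᵀ * ((R₀ u)ᵀ * p.D * R₁ u)) * E j
          - E j * (((R₀ u)ᵀ * p.D * R₁ u)ᵀ * ((R₀ u)ᵀ * p.D * R₁ u)) * E k := by
      have e1 : E j * (p.z⁻¹ • (1 : Mat n)) * E k = E k * (p.z⁻¹ • (1 : Mat n)) * E j := by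
        simp [E_comm j k]
      rw [hMM]
      linear_combination (norm := noncomm_ring) e1
    rw [hRHS]
    simp only [Matrix.transpose_sub, Matrix.transpose_add, Matrix.transpose_neg,
      Matrix.transpose_mul ((R₀ u)ᵀ * pdM _ R₀ u), Matrix.transpose_mul _ (omega R₀ _ u),
      Matrix.transpose_mul _ ((R₀ u)ᵀ * p.D * R₁ u), Matrix.transpose_mul _ (E _), hw, hX,
      E_transpose]
    have hct := congrArg Matrix.transpose hc
    simp only [Matrix.transpose_sub, Matrix.transpose_zero, Matrix.mul_assoc (E _) (R₀ u)ᵀ,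
      Matrix.transpose_mul (E _), Matrix.transpose_mul _ (E _), hw, E_transpose] at hct
    simp only [Matrix.mul_assoc (E _) (R₀ u)ᵀ] at hc
    simp only [hGt] at hct ⊢
    have hE := E_comm j k
    set M := (R₀ u)ᵀ * p.D * R₁ u
    set N := Mᵀ
    set Gj := (R₀ u)ᵀ * pdM j R₀ u
    set Gk := (R₀ u)ᵀ * pdM k R₀ u
    set X := (R₀ u)ᵀ * p.D * p.D * R₀ u
    -- What remains is the Codazzi equation of R₀ and its transpose, multiplied by M and Mᵀ, and the
    -- commutation of E_j with E_k.
    linear_combination (norm := noncomm_ring) -(M * hc) + hct * N - X * hE - hE * X + M * hE * N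
  · exact codazzi_of_rotation (hR.rotation hU hR₀ hO hu).1.choose_spec j k

end Rotation

end Peterson
namespace Peterson

variable {n : ℕ}

/-! ### The leaf of a solution and the Bäcklund transform. -/

section Leaf

variable {a : Fin n → ℂ} {U : Set (Pt n)} {R₀ R₁ : Pt n → Mat n} {p : SpectralParam a}

/-- The vector part `√R_z V + √z R₁ Λ` of the leaf. -/
noncomputable def leafV (p : SpectralParam a) (R₁ : Mat n) (V L : Pt n) : Pt n :=
  p.sqrtR *ᵥ V + p.s • (R₁ *ᵥ L)

/-- The part `√z R₀ᵀ (D R₁ Λ - A V)` of the leaf. -/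
noncomputable def leafL (p : SpectralParam a) (R₀ R₁ : Mat n) (V L : Pt n) : Pt n :=
  p.s • (R₀ᵀ *ᵥ (-(quadA a *ᵥ V) + (p.D * R₁) *ᵥ L))

theorem leafV_eq (R₁ : Mat n) (V L : Pt n) :
    leafV p R₁ V L = p.s • (p.D *ᵥ V + R₁ *ᵥ L) := by
  rw [leafV, SpectralParam.sqrtR, smul_mulVec, smul_add]

theorem SpectralParam.D_mul_D_add_quadA : p.D * p.D + quadA a = p.z⁻¹ • (1 : Mat n) := by
  rw [p.D_mul_D]; abel

theorem SpectralParam.smul_smul_inv (v : Pt n) : p.s • p.s • p.z⁻¹ • v = v := by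
  rw [smul_smul, smul_smul, ← pow_two, p.s_sq, mul_inv_cancel₀ p.z_ne_zero, one_smul]

/-- By D² + A = z⁻¹ one has D(DV + R₁Λ) - z⁻¹V = DR₁Λ - AV; the remaining factor is s² = z. -/
theorem leaf_right {R₀ : Mat n} (h₀ : IsOrth R₀) (R₁ : Mat n) (V L : Pt n) :
    p.s • (R₀ *ᵥ leafL p R₀ R₁ V L) = p.sqrtR *ᵥ leafV p R₁ V L - V := by
  have hz := p.D_mul_D_add_quadA
  have h0 := h₀.mul_transpose
  have key : R₀ *ᵥ (R₀ᵀ *ᵥ (-(quadA a *ᵥ V) + (p.D * R₁) *ᵥ L))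
      = p.D *ᵥ (p.D *ᵥ V + R₁ *ᵥ L) - p.z⁻¹ • V := by
    have e : p.z⁻¹ • V = (p.z⁻¹ • (1 : Mat n)) *ᵥ V := by simp [smul_mulVec]
    rw [e]
    apply colM_injective
    simp only [colM_mulVec, colM_add, colM_sub, colM_neg]
    set v := colM V
    set l := colM L
    linear_combination (norm := noncomm_ring) h0 * (-(quadA a * v) + p.D * R₁ * l) - hz * v
  rw [leafL, leafV_eq, mulVec_smul, key, SpectralParam.sqrtR, smul_mulVec, mulVec_smul, smul_sub,
    smul_sub, p.smul_smul_inv]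

/-- The leaf preserves the bilinear invariant of two solutions. -/
theorem leaf_invariant [Nonempty (Fin n)] {R₀ R₁ : Mat n} (h₀ : IsOrth R₀) (h₁ : IsOrth R₁)
    (V L V' L' : Pt n) :
    leafV p R₁ V L ⬝ᵥ quadA a *ᵥ leafV p R₁ V' L' + leafL p R₀ R₁ V L ⬝ᵥ leafL p R₀ R₁ V' L'
      = V ⬝ᵥ quadA a *ᵥ V' + L ⬝ᵥ L' := by
  set y := p.D *ᵥ V + R₁ *ᵥ L with hy
  set y' := p.D *ᵥ V' + R₁ *ᵥ L' with hy'
  set m := R₀ᵀ *ᵥ (-(quadA a *ᵥ V) + (p.D * R₁) *ᵥ L) with hm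
  set m' := R₀ᵀ *ᵥ (-(quadA a *ᵥ V') + (p.D * R₁) *ᵥ L') with hm'
  have key : y ⬝ᵥ quadA a *ᵥ y' + m ⬝ᵥ m' = p.z⁻¹ * (V ⬝ᵥ quadA a *ᵥ V' + L ⬝ᵥ L') := by
    apply dotProduct_eq_of_colM (n := n)
    have e1 : (Matrix.of fun _ _ => y ⬝ᵥ quadA a *ᵥ y' + m ⬝ᵥ m' : Mat n)
        = (colM y)ᵀ * colM (quadA a *ᵥ y') + (colM m)ᵀ * colM m' := rfl
    have e2 : (Matrix.of fun _ _ => p.z⁻¹ * (V ⬝ᵥ quadA a *ᵥ V' + L ⬝ᵥ L') : Mat n)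
        = p.z⁻¹ • ((colM V)ᵀ * colM (quadA a *ᵥ V') + (colM L)ᵀ * colM L') := rfl
    have e3 : p.z⁻¹ • ((colM V)ᵀ * colM (quadA a *ᵥ V') + (colM L)ᵀ * colM L')
        = (colM V)ᵀ * (p.z⁻¹ • (1 : Mat n)) * colM (quadA a *ᵥ V')
          + (colM L)ᵀ * R₁ᵀ * (p.z⁻¹ • (1 : Mat n)) * R₁ * colM L' := by
      have : R₁ᵀ * R₁ = 1 := h₁
      simp only [mul_smul_comm, smul_mul_assoc, Matrix.mul_one, Matrix.mul_assoc _ R₁ᵀ,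
        this, smul_add]
    rw [e1, e2, e3, ← p.D_mul_D_add_quadA, hy, hy', hm, hm']
    simp only [colM_mulVec, colM_add, colM_neg, Matrix.transpose_add, Matrix.transpose_mul,
      Matrix.transpose_neg, Matrix.transpose_transpose, p.D_transpose, quadA_transpose]
    have h0 := h₀.mul_transpose
    have hDA := p.D_mul_quadA
    set v := colM V
    set l := colM L
    set v' := colM V'
    set l' := colM L'
    linear_combination (norm := noncomm_ring)
      (-(vᵀ * quadA a) + lᵀ * (R₁ᵀ * p.D)) * h0 * (-(quadA a * v') + p.D * R₁ * l')
      + vᵀ * hDA * (R₁ * l') - lᵀ * R₁ᵀ * hDA * v' - vᵀ * p.D * hDA * v'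
  have hs : p.s * p.s * p.z⁻¹ = 1 := by
    rw [← pow_two, p.s_sq, mul_inv_cancel₀ p.z_ne_zero]
  rw [leafV_eq, leafV_eq, leafL, leafL, ← hy, ← hy', ← hm, ← hm', mulVec_smul, smul_dotProduct,
    dotProduct_smul, smul_dotProduct, dotProduct_smul]
  simp only [smul_eq_mul]
  linear_combination p.s * p.s * key + (V ⬝ᵥ quadA a *ᵥ V' + L ⬝ᵥ L') * hs

theorem analyticOnNhd_smul {f : Pt n → Pt n} (hf : AnalyticOnNhd ℂ f U) (c : ℂ) :
    AnalyticOnNhd ℂ (fun w => c • f w) U := fun u hu => (hf u hu).fun_const_smul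

theorem pd_leafV (hR₁ : HolM U R₁) {V L : Pt n → Pt n} (hV : AnalyticOnNhd ℂ V U)
    (hL : AnalyticOnNhd ℂ L U) {u : Pt n} (hu : u ∈ U) (j : Fin n) :
    pd j (fun w => leafV p (R₁ w) (V w) (L w)) u
      = p.s • (p.D *ᵥ pd j V u + (pdM j R₁ u *ᵥ L u + R₁ u *ᵥ pd j L u)) := by
  have h1 := (HolM.const p.D).mulVec hV
  have h2 := hR₁.mulVec hL
  simp only [leafV_eq]
  rw [pd_smul_const ((h1 u hu).differentiableAt.fun_add (h2 u hu).differentiableAt),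
    pd_add (h1 u hu).differentiableAt (h2 u hu).differentiableAt, pd_mulVec (HolM.const _) hV hu,
    pd_mulVec hR₁ hL hu, pdM_const, zero_mulVec, zero_add]

theorem analyticOnNhd_leafV (hR₁ : HolM U R₁) {V L : Pt n → Pt n} (hV : AnalyticOnNhd ℂ V U)
    (hL : AnalyticOnNhd ℂ L U) : AnalyticOnNhd ℂ (fun w => leafV p (R₁ w) (V w) (L w)) U :=
  ((HolM.const p.sqrtR).mulVec hV).add (analyticOnNhd_smul (hR₁.mulVec hL) p.s)

theorem leafL_eq (R₀ R₁ : Mat n) (V L : Pt n) :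
    leafL p R₀ R₁ V L = p.s • ((R₀ᵀ * p.D * R₁) *ᵥ L - (R₀ᵀ * quadA a) *ᵥ V) := by
  rw [leafL]
  congr 1
  apply colM_injective
  simp only [colM_mulVec, colM_add, colM_neg, colM_sub]
  noncomm_ring

theorem analyticOnNhd_leafL (hR₀ : HolM U R₀) (hR₁ : HolM U R₁) {V L : Pt n → Pt n}
    (hV : AnalyticOnNhd ℂ V U) (hL : AnalyticOnNhd ℂ L U) :
    AnalyticOnNhd ℂ (fun w => leafL p (R₀ w) (R₁ w) (V w) (L w)) U := by
  simp only [leafL_eq]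
  exact analyticOnNhd_smul ((((hR₀.transpose.mul (HolM.const _)).mul hR₁).mulVec hL).sub
    ((hR₀.transpose.mul (HolM.const _)).mulVec hV)) _

/-- The leaf of a solution of the linear system is a solution of the transformed linear system. -/
theorem IsLinearSolution.leaf (hU : IsOpen U) (hR₀ : IsCompatible a U R₀)
    (hR : IsRiccati p U R₀ R₁) (hO : ∀ u ∈ U, IsOrth (R₁ u)) {V L : Pt n → Pt n}
    (h : IsLinearSolution a U R₀ V L) :
    IsLinearSolution a U R₁ (fun u => leafV p (R₁ u) (V u) (L u))
      (fun u => leafL p (R₀ u) (R₁ u) (V u) (L u)) := by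
  refine ⟨analyticOnNhd_leafV hR.hol h.hol_V h.hol_L,
    analyticOnNhd_leafL hR₀.hol hR.hol h.hol_V h.hol_L, fun u hu j => ?_, fun u hu j => ?_⟩
  · rw [pd_leafV hR.hol h.hol_V h.hol_L hu, leafL_eq, h.dV u hu, h.dL u hu, hR.eqn u hu,
      mulVec_smul]
    congr 1
    apply colM_injective
    simp only [colM_mulVec, colM_add, colM_sub]
    noncomm_ring
  · have hM : HolM U (fun w => (R₀ w)ᵀ * p.D * R₁ w) :=
      (hR₀.hol.transpose.mul (HolM.const _)).mul hR.hol
    have hN : HolM U (fun w => (R₀ w)ᵀ * quadA a) := hR₀.hol.transpose.mul (HolM.const _)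
    have hder : pd j (fun u => leafL p (R₀ u) (R₁ u) (V u) (L u)) u
        = p.s • ((pdM j (fun w => (R₀ w)ᵀ * p.D * R₁ w) u *ᵥ L u
            + ((R₀ u)ᵀ * p.D * R₁ u) *ᵥ pd j L u)
          - (((pdM j R₀ u)ᵀ * quadA a) *ᵥ V u + ((R₀ u)ᵀ * quadA a) *ᵥ pd j V u)) := by
      have h1 := hM.mulVec h.hol_L
      have h2 := hN.mulVec h.hol_V
      simp only [leafL_eq]
      rw [pd_smul_const ((h1 u hu).differentiableAt.fun_sub (h2 u hu).differentiableAt),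
        pd_sub (h1 u hu).differentiableAt (h2 u hu).differentiableAt, pd_mulVec hM h.hol_L hu,
        pd_mulVec hN h.hol_V hu, pdM_mul hR₀.hol.transpose (HolM.const _) hu, pdM_const,
        pdM_transpose, Matrix.mul_zero, add_zero]
    rw [hder, leafL_eq, leafV_eq, h.dV u hu, h.dL u hu, hR.pdM_coupling hU hR₀ hu,
      pdM_transpose_eq hU hR₀.hol hR₀.orth hu, (hR.rotation hU hR₀ hO hu).2, mulVec_smul,
      mulVec_smul, ← smul_sub]
    congr 1
    apply colM_injective
    simp only [colM_mulVec, colM_add, colM_sub, Matrix.transpose_mul, Matrix.transpose_transpose,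
      p.D_transpose]
    have h0 := (hR₀.orth u hu).mul_transpose
    have h0' : (R₀ u)ᵀ * R₀ u = 1 := hR₀.orth u hu
    have h1 : (R₁ u)ᵀ * R₁ u = 1 := hO u hu
    have hz := p.D_mul_D_add_quadA
    have hDA := p.D_mul_quadA
    -- The scalar z⁻¹ passes through either rotation, which carries D² + A from the side of R₀ to
    -- that of R₁.
    have hzc : (R₀ u)ᵀ * (p.z⁻¹ • (1 : Mat n)) * R₀ u * E j
        = E j * (R₁ u)ᵀ * (p.z⁻¹ • (1 : Mat n)) * R₁ u := by
      rw [mul_smul_comm, mul_smul_comm]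
      simp only [Matrix.mul_one, smul_mul_assoc, Matrix.mul_assoc (E j), h0', h1, Matrix.one_mul]
    set v := colM (V u)
    set l := colM (L u)
    set T := (R₀ u)ᵀ
    set T₁ := (R₁ u)ᵀ
    linear_combination (norm := noncomm_ring) -(T * hz * R₀ u * E j * l) - hzc * l
      + E j * T₁ * hz * R₁ u * l + E j * T₁ * p.D * h0 * p.D * R₁ u * l
      - E j * T₁ * p.D * h0 * quadA a * v - E j * T₁ * hDA * v

/-- The bilinear relations are preserved by `leaf_invariant` and the differential ones by
`IsLinearSolution.leaf`; only the formula for dx¹ needs a separate computation. -/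
theorem backlund_isDeformationDatum (hn : n ≠ 0) (hU : IsOpen U) {S : Datum n}
    (hS : IsDeformationDatum a U S) (hR : IsRiccati p U S.R R₁) (hO : ∀ u ∈ U, IsOrth (R₁ u)) :
    IsDeformationDatum a U (backlund p S R₁) := by
  have : Nonempty (Fin n) := ⟨⟨0, Nat.pos_of_ne_zero hn⟩⟩
  have hinv : ∀ u ∈ U, ∀ V L V' L' : Pt n,
      leafV p (R₁ u) V L ⬝ᵥ quadA a *ᵥ leafV p (R₁ u) V' L'
        + leafL p (S.R u) (R₁ u) V L ⬝ᵥ leafL p (S.R u) (R₁ u) V' L'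
      = V ⬝ᵥ quadA a *ᵥ V' + L ⬝ᵥ L' := fun u hu V L V' L' =>
    leaf_invariant (hS.compatible.orth u hu) (hO u hu) V L V' L'
  have hlin := hS.solution.toIsLinearSolution.leaf hU hS.compatible hR hO
  have hflin := fun l => (hS.frame_solution l).leaf hU hS.compatible hR hO
  have hq : AnalyticOnNhd ℂ (fun u => p.sqrtR *ᵥ leafV p (R₁ u) (S.V u) (S.L u) - S.V u) U :=
    ((HolM.const p.sqrtR).mulVec hlin.hol_V).sub hS.solution.hol_V
  have hxl : ∀ l, AnalyticOnNhd ℂ (fun u => S.frameV l u ⬝ᵥ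
      (p.sqrtR *ᵥ leafV p (R₁ u) (S.V u) (S.L u) - S.V u)) U := fun l =>
    analyticOnNhd_dotProduct (hS.frame_solution l).hol_V hq
  refine ⟨hR.isCompatible hU hS.compatible hO, ⟨hlin, fun u hu => ?_⟩, hflin, fun u hu l m => ?_,
    fun u hu l => ?_, ?_, fun u hu j l => ?_⟩
  · have h1 := hinv u hu (S.V u) (S.L u) (S.V u) (S.L u)
    have h2 := hS.solution.prime_integral u hu
    show leafL p (S.R u) (R₁ u) (S.V u) (S.L u) ⬝ᵥ leafL p (S.R u) (R₁ u) (S.V u) (S.L u)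
      = -(leafV p (R₁ u) (S.V u) (S.L u) ⬝ᵥ quadA a *ᵥ leafV p (R₁ u) (S.V u) (S.L u) + 1)
    linear_combination h1 + h2
  · exact (hinv u hu _ _ _ _).trans (hS.frame_orthonormal u hu l m)
  · exact (hinv u hu _ _ _ _).trans (hS.frame_orthogonal u hu l)
  · exact analyticOnNhd_vec fun l => (analyticOnNhd_apply hS.hol_x l).add (hxl l)
  · have hx : AnalyticOnNhd ℂ (backlund p S R₁).x U :=
      analyticOnNhd_vec fun l => (analyticOnNhd_apply hS.hol_x l).add (hxl l)
    have hV1 := hlin.dV u hu j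
    rw [pd_apply (hx u hu).differentiableAt]
    show pd j (fun w => S.x w l + S.frameV l w ⬝ᵥ
      (p.sqrtR *ᵥ leafV p (R₁ w) (S.V w) (S.L w) - S.V w)) u
      = leafV p (R₁ u) (S.frameV l u) (S.frameL l u)
        ⬝ᵥ pd j (fun w => leafV p (R₁ w) (S.V w) (S.L w)) u
    rw [pd_add (analyticOnNhd_apply hS.hol_x l u hu).differentiableAt (hxl l u hu).differentiableAt,
      ← pd_apply (hS.hol_x u hu).differentiableAt, hS.dx u hu,
      pd_dotProduct ((hS.frame_solution l).hol_V u hu).differentiableAt (hq u hu).differentiableAt,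
      pd_sub (((HolM.const p.sqrtR).mulVec hlin.hol_V) u hu).differentiableAt
        (hS.solution.hol_V u hu).differentiableAt,
      pd_mulVec (HolM.const _) hlin.hol_V hu, pdM_const, zero_mulVec, zero_add,
      ← leaf_right (hS.compatible.orth u hu), (hS.frame_solution l).dV u hu, hV1]
    set L₁ := leafL p (S.R u) (R₁ u) (S.V u) (S.L u)
    -- Through `e1` and `e2` the term coming from ∂_jV_l is rewritten with R₁ in place of R₀; it
    -- supplies the part √z R₁Λ_l of the transformed frame vector.
    have e1 : ((S.R u * E j) *ᵥ S.frameL l u) ⬝ᵥ (S.R u *ᵥ L₁) = S.frameL l u j * L₁ j := by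
      have : S.R u *ᵥ L₁ = ∑ k, (S.R u * E k) *ᵥ L₁ := by
        rw [← sum_mulVec, ← Finset.mul_sum, sum_E, Matrix.mul_one]
      rw [this, dotProduct_sum]
      simp [mul_E_mulVec_dot (hS.compatible.orth u hu)]
    have e2 : (R₁ u *ᵥ S.frameL l u) ⬝ᵥ ((R₁ u * E j) *ᵥ L₁) = S.frameL l u j * L₁ j := by
      have : R₁ u *ᵥ S.frameL l u = ∑ k, (R₁ u * E k) *ᵥ S.frameL l u := by
        rw [← sum_mulVec, ← Finset.mul_sum, sum_E, Matrix.mul_one]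
      rw [this, sum_dotProduct]
      simp [mul_E_mulVec_dot (hO u hu)]
    have e3 : (p.sqrtR *ᵥ S.frameV l u) ⬝ᵥ ((R₁ u * E j) *ᵥ L₁)
        = S.frameV l u ⬝ᵥ (p.sqrtR *ᵥ ((R₁ u * E j) *ᵥ L₁)) := by
      have ht : p.sqrtRᵀ = p.sqrtR := by
        rw [SpectralParam.sqrtR, Matrix.transpose_smul, p.D_transpose]
      rw [dotProduct_mulVec (S.frameV l u), ← mulVec_transpose, ht]
    rw [leafV, add_dotProduct, smul_dotProduct, dotProduct_smul, dotProduct_sub, e1, e2, e3]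
    simp only [smul_eq_mul]
    ring

/-- The vector √R_z V₁ - V₀ equals √z R₀Λ₁, so its square is z|Λ₁|² and the tangency condition is
the prime integral of the leaf. The backward segment formula reduces to V_lᵀAV + Λ_lᵀΛ = 0. -/
theorem backlund_isBacklundTransform (hn : n ≠ 0) {S : Datum n}
    (hS : IsDeformationDatum a U S) (hR : IsRiccati p U S.R R₁) (hO : ∀ u ∈ U, IsOrth (R₁ u)) :
    IsBacklundTransform p U S (backlund p S R₁) := by
  have : Nonempty (Fin n) := ⟨⟨0, Nat.pos_of_ne_zero hn⟩⟩
  have hdot : ∀ R : Mat n, IsOrth R → ∀ v w : Pt n, (R *ᵥ v) ⬝ᵥ (R *ᵥ w) = v ⬝ᵥ w := by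
    intro R h v w
    rw [dotProduct_mulVec, vecMul_mulVec, show Rᵀ * R = 1 from h, Matrix.vecMul_one]
  refine ⟨hR, fun u hu => ?_, fun u hu => leaf_right (hS.compatible.orth u hu) _ _ _,
    fun u hu l => ?_, fun u hu l => leaf_right (hS.compatible.orth u hu) _ _ _, fun u hu => ?_,
    fun u hu l => rfl, fun u hu l => ?_⟩
  · exact (add_sub_cancel_left _ _).symm
  · exact (add_sub_cancel_left _ _).symm
  · show (p.sqrtR *ᵥ leafV p (R₁ u) (S.V u) (S.L u) - S.V u)
      ⬝ᵥ (p.sqrtR *ᵥ leafV p (R₁ u) (S.V u) (S.L u) - S.V u)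
      = -(p.z * (leafV p (R₁ u) (S.V u) (S.L u)
        ⬝ᵥ quadA a *ᵥ leafV p (R₁ u) (S.V u) (S.L u) + 1))
    have h1 := leaf_invariant (p := p) (hS.compatible.orth u hu) (hO u hu)
      (S.V u) (S.L u) (S.V u) (S.L u)
    have h2 := hS.solution.prime_integral u hu
    rw [← leaf_right (hS.compatible.orth u hu), smul_dotProduct, dotProduct_smul,
      hdot _ (hS.compatible.orth u hu)]
    simp only [smul_eq_mul]
    linear_combination p.z * h1 + p.z * h2
      + leafL p (S.R u) (R₁ u) (S.V u) (S.L u) ⬝ᵥ leafL p (S.R u) (R₁ u) (S.V u) (S.L u) * p.s_sq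
  · show S.x u l = S.x u l + S.frameV l u ⬝ᵥ
        (p.sqrtR *ᵥ leafV p (R₁ u) (S.V u) (S.L u) - S.V u)
      + leafV p (R₁ u) (S.frameV l u) (S.frameL l u)
        ⬝ᵥ (p.sqrtR *ᵥ S.V u - leafV p (R₁ u) (S.V u) (S.L u))
    have e1 : p.sqrtR *ᵥ S.V u - leafV p (R₁ u) (S.V u) (S.L u) = -(p.s • (R₁ u *ᵥ S.L u)) := by
      rw [leafV]; abel
    have e2 : S.R u *ᵥ leafL p (S.R u) (R₁ u) (S.V u) (S.L u)
        = p.s • (-(quadA a *ᵥ S.V u) + (p.D * R₁ u) *ᵥ S.L u) := by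
      rw [leafL, mulVec_smul, mulVec_mulVec, (hS.compatible.orth u hu).mul_transpose, one_mulVec]
    have e3 : (p.D *ᵥ S.frameV l u) ⬝ᵥ (R₁ u *ᵥ S.L u)
        = S.frameV l u ⬝ᵥ ((p.D * R₁ u) *ᵥ S.L u) := by
      rw [dotProduct_mulVec (S.frameV l u), ← vecMul_vecMul, ← mulVec_transpose p.D, p.D_transpose,
        ← dotProduct_mulVec]
    have h := hS.frame_orthogonal u hu l
    rw [e1, ← leaf_right (hS.compatible.orth u hu), e2, leafV_eq, dotProduct_neg, smul_dotProduct,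
      dotProduct_smul, dotProduct_smul, dotProduct_smul, dotProduct_add, add_dotProduct, e3,
      dotProduct_neg, hdot _ (hO u hu)]
    simp only [smul_eq_mul]
    linear_combination p.s * p.s * h

end Leaf

end Peterson
namespace Peterson

variable {n : ℕ}

/-! ### The Bianchi Permutability Theorem. -/

section Permutability

variable {a : Fin n → ℂ} {U : Set (Pt n)} {p₁ p₂ : SpectralParam a}

theorem transpose_mul_add_bianchi {R₁ R₂ : Mat n} (h₁ : IsOrth R₁)
    (hG : (p₂.D * R₂ - p₁.D * R₁).det ≠ 0) :
    R₁ᵀ * (p₁.D + p₂.D * bianchi p₁.D p₂.D R₁ R₂)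
      = (p₂.D ^ 2 - p₁.D ^ 2) * (p₂.D * R₂ - p₁.D * R₁)⁻¹ := by
  have h := congrArg (R₁ᵀ * · * (p₂.D * R₂ - p₁.D * R₁)⁻¹) (add_bianchi_mul h₁ hG)
  have hi := Matrix.mul_nonsing_inv _ (isUnit_iff_ne_zero.2 hG)
  simp only [Matrix.mul_assoc, hi, Matrix.mul_one] at h
  rw [h, ← Matrix.mul_assoc (p₂.D ^ 2 - p₁.D ^ 2), p₁.sq_sub_sq_mul p₂ R₁, Matrix.mul_assoc R₁,
    ← Matrix.mul_assoc, show R₁ᵀ * R₁ = 1 from h₁, Matrix.one_mul]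

/-- The rotation given by the Bianchi formula solves the Riccati equation of the first transform. -/
theorem bianchi_isRiccati (hU : IsOpen U) {R₀ R₁ R₂ R₃ : Pt n → Mat n}
    (hR₀ : IsCompatible a U R₀) (hR₁ : IsRiccati p₁ U R₀ R₁) (h₁ : ∀ u ∈ U, IsOrth (R₁ u))
    (hR₂ : IsRiccati p₂ U R₀ R₂)
    (hG : ∀ u ∈ U, (p₂.D * R₂ u - p₁.D * R₁ u).det ≠ 0)
    (hR₃ : ∀ u ∈ U, R₃ u = bianchi p₁.D p₂.D (R₁ u) (R₂ u) * R₀ u) : IsRiccati p₂ U R₁ R₃ := by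
  have holG : HolM U (fun w => p₂.D * R₂ w - p₁.D * R₁ w) :=
    ((HolM.const _).mul hR₂.hol).sub ((HolM.const _).mul hR₁.hol)
  have holH : HolM U (fun w => p₂.D * R₁ w - p₁.D * R₂ w) :=
    ((HolM.const _).mul hR₁.hol).sub ((HolM.const _).mul hR₂.hol)
  have holGi : HolM U (fun w => (p₂.D * R₂ w - p₁.D * R₁ w)⁻¹) := holG.inv hG
  have heq : ∀ u ∈ U, (p₂.D * R₁ u - p₁.D * R₂ u) * ((p₂.D * R₂ u - p₁.D * R₁ u)⁻¹ * R₀ u)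
      = R₃ u := by
    intro u hu
    rw [hR₃ u hu, bianchi_eq (h₁ u hu), Matrix.mul_assoc]
  refine ⟨(holH.mul (holGi.mul hR₀.hol)).congr hU heq, fun u hu j => ?_⟩
  have hder : ∀ (p q : SpectralParam a) (R S : Pt n → Mat n), HolM U R → HolM U S →
      pdM j (fun w => p.D * R w - q.D * S w) u = p.D * pdM j R u - q.D * pdM j S u := by
    intro p q R S hR hS
    rw [pdM_sub ((HolM.const _).mul hR) ((HolM.const _).mul hS) hu,
      pdM_mul (HolM.const _) hR hu, pdM_mul (HolM.const _) hS hu, pdM_const, pdM_const,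
      Matrix.zero_mul, Matrix.zero_mul, zero_add, zero_add]
  rw [← pdM_congr hU heq hu, pdM_mul holH (holGi.mul hR₀.hol) hu, pdM_mul holGi hR₀.hol hu,
    pdM_inv hU holG hG hu, hder _ _ _ _ hR₂.hol hR₁.hol, hder _ _ _ _ hR₁.hol hR₂.hol,
    hR₁.eqn u hu, hR₂.eqn u hu, (hR₁.rotation hU hR₀ h₁ hu).2]
  have hX := transpose_mul_add_bianchi (h₁ u hu) (hG u hu)
  rw [bianchi_eq (h₁ u hu)] at hX
  have hGi := Matrix.mul_nonsing_inv _ (isUnit_iff_ne_zero.2 (hG u hu))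
  have hiG := Matrix.nonsing_inv_mul _ (isUnit_iff_ne_zero.2 (hG u hu))
  have hc := p₁.sq_sub_sq_mul p₂
  have hD := p₁.D_comm p₂
  have h0 := (hR₀.orth u hu).mul_transpose
  have h0' : (R₀ u)ᵀ * R₀ u = 1 := hR₀.orth u hu
  rw [← heq u hu]
  simp only [Matrix.transpose_mul, Matrix.transpose_transpose, p₁.D_transpose]
  set Gi := (p₂.D * R₂ u - p₁.D * R₁ u)⁻¹ with hGidef
  set G := p₂.D * R₂ u - p₁.D * R₁ u with hGdef
  set H := p₂.D * R₁ u - p₁.D * R₂ u with hHdef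
  set w := omega R₀ j u
  set T₀ := (R₀ u)ᵀ
  set T₁ := (R₁ u)ᵀ
  -- In dG and dH the terms with ω₀ and with Q = D₂R₂ occur in the same way and cancel in d(HG⁻¹);
  -- the scalar c in the last term of dG is what `hX` converts into the quadratic part of the new
  -- Riccati equation.
  have hdG : p₂.D * (-(R₂ u * w) + R₂ u * E j * T₀ * p₂.D * R₂ u - p₂.D * R₀ u * E j)
      - p₁.D * (-(R₁ u * w) + R₁ u * E j * T₀ * p₁.D * R₁ u - p₁.D * R₀ u * E j)
      = -(G * w) + G * E j * T₀ * (p₂.D * R₂ u) + p₁.D * R₁ u * E j * T₀ * G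
        - (p₂.D ^ 2 - p₁.D ^ 2) * R₀ u * E j := by
    rw [hGdef]; noncomm_ring
  have hdH : p₂.D * (-(R₁ u * w) + R₁ u * E j * T₀ * p₁.D * R₁ u - p₁.D * R₀ u * E j)
      - p₁.D * (-(R₂ u * w) + R₂ u * E j * T₀ * p₂.D * R₂ u - p₂.D * R₀ u * E j)
      = -(H * w) + H * E j * T₀ * (p₂.D * R₂ u) - p₂.D * R₁ u * E j * T₀ * G := by
    rw [hGdef, hHdef]
    linear_combination (norm := noncomm_ring) hD * R₀ u * E j
  rw [hdG, hdH]
  set P := p₁.D * R₁ u with hP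
  set Q := p₂.D * R₂ u with hQ
  set c := p₂.D ^ 2 - p₁.D ^ 2 with hcdef
  have hcE : c * R₀ u * E j = R₀ u * E j * c := by rw [Matrix.mul_assoc, hc]
  have e1 : R₀ u * E j * c * Gi * R₀ u
      = R₀ u * E j * (T₁ * (p₁.D + p₂.D * (H * Gi))) * R₀ u := by
    rw [hX]; noncomm_ring
  linear_combination (norm := noncomm_ring) H * hiG * w * Gi * R₀ u
    - H * hiG * E j * T₀ * Q * Gi * R₀ u - H * Gi * P * E j * T₀ * hGi * R₀ u
    - H * Gi * P * E j * h0' - p₂.D * R₁ u * E j * T₀ * hGi * R₀ u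
    - p₂.D * R₁ u * E j * h0' + H * Gi * hcE * Gi * R₀ u + H * Gi * e1
    - H * Gi * h0 * pdM j R₀ u + H * Gi * h0 * P * E j
    - H * Gi * R₀ u * T₀ * hP * E j

section SecondLeaf

variable {R₀ R₁ R₂ R₃ : Mat n}

/-- After R₀R₀ᵀ = 1 the difference of the two sides is the relation T(D₂R₂ - D₁R₁) = D₂R₁ - D₁R₂
applied to Λ. -/
theorem second_leafV (h₀ : IsOrth R₀) (h₁ : IsOrth R₁)
    (hG : (p₂.D * R₂ - p₁.D * R₁).det ≠ 0) (h₃ : R₃ = bianchi p₁.D p₂.D R₁ R₂ * R₀) (V L : Pt n) :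
    leafV p₂ R₃ (leafV p₁ R₁ V L) (leafL p₁ R₀ R₁ V L)
      = leafV p₁ R₃ (leafV p₂ R₂ V L) (leafL p₂ R₀ R₂ V L) := by
  simp only [leafV_eq, leafL]
  simp only [mulVec_smul, ← smul_add]
  rw [smul_comm]
  congr 2
  apply colM_injective
  simp only [colM_mulVec, colM_add, colM_neg]
  have hb := bianchi_mul h₁ hG
  have h0 := h₀.mul_transpose
  have hD := p₁.D_comm p₂
  rw [h₃]
  set T := bianchi p₁.D p₂.D R₁ R₂
  set v := colM V
  set l := colM L
  linear_combination (norm := noncomm_ring) T * h0 * (p₁.D * R₁ - p₂.D * R₂) * l - hb * l - hD * v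

/-- Eliminates R₃. The factor (D₂² - D₁²)(D₂R₂ - D₁R₁)⁻¹ is symmetric in the indices, so the two
orders differ only in elementary terms, compared in `second_leafL`. -/
theorem second_leafL_eq (h₀ : IsOrth R₀) (h₁ : IsOrth R₁)
    (hG : (p₂.D * R₂ - p₁.D * R₁).det ≠ 0) (h₃ : R₃ = bianchi p₁.D p₂.D R₁ R₂ * R₀) (V L : Pt n) :
    leafL p₂ R₁ R₃ (leafV p₁ R₁ V L) (leafL p₁ R₀ R₁ V L)
      = p₂.s • p₁.s • (((p₂.D ^ 2 - p₁.D ^ 2) * (p₂.D * R₂ - p₁.D * R₁)⁻¹)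
          *ᵥ (p₁.D *ᵥ (R₁ *ᵥ L) - quadA a *ᵥ V) - p₁.z⁻¹ • L) := by
  have hzL : p₁.z⁻¹ • L = (p₁.z⁻¹ • (1 : Mat n)) *ᵥ L := by simp [smul_mulVec]
  have hX := transpose_mul_add_bianchi h₁ hG
  have h0 := h₀.mul_transpose
  have h1 : R₁ᵀ * R₁ = 1 := h₁
  have hz : R₁ᵀ * (p₁.z⁻¹ • (1 : Mat n)) * R₁ = p₁.z⁻¹ • (1 : Mat n) := by simp [h1]
  rw [← p₁.D_mul_D_add_quadA] at hz
  have hDA := p₁.D_mul_quadA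
  rw [hzL, ← hX, leafL, leafV_eq, leafL, h₃]
  simp only [mulVec_smul, ← smul_neg, ← smul_add]
  congr 2
  apply colM_injective
  simp only [colM_mulVec, colM_add, colM_neg, colM_sub]
  set T := bianchi p₁.D p₂.D R₁ R₂
  set v := colM V
  set l := colM L
  linear_combination (norm := noncomm_ring) R₁ᵀ * p₂.D * T * h0 * (p₁.D * R₁ * l - quadA a * v)
    - hz * l + R₁ᵀ * hDA * v - p₁.D_mul_D_add_quadA * l

theorem second_leafL (h₀ : IsOrth R₀) (h₁ : IsOrth R₁) (h₂ : IsOrth R₂)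
    (hG : (p₂.D * R₂ - p₁.D * R₁).det ≠ 0) (h₃ : R₃ = bianchi p₁.D p₂.D R₁ R₂ * R₀) (V L : Pt n) :
    leafL p₂ R₁ R₃ (leafV p₁ R₁ V L) (leafL p₁ R₀ R₁ V L)
      = leafL p₁ R₂ R₃ (leafV p₂ R₂ V L) (leafL p₂ R₀ R₂ V L) := by
  have k₁ := second_leafL_eq h₀ h₁ hG h₃ V L
  have k₂ := second_leafL_eq h₀ h₂ (det_sub_swap_ne_zero.1 hG)
    (h₃.trans (by rw [bianchi_comm h₁ h₂])) V L
  rw [smul_comm] at k₂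
  refine k₁.trans (Eq.trans (congrArg (fun y => p₂.s • p₁.s • y) ?_) k₂.symm)
  have hi := Matrix.nonsing_inv_mul _ (isUnit_iff_ne_zero.2 hG)
  have e1 : (p₁.D ^ 2 - p₂.D ^ 2) * (p₁.D * R₁ - p₂.D * R₂)⁻¹
      = (p₂.D ^ 2 - p₁.D ^ 2) * (p₂.D * R₂ - p₁.D * R₁)⁻¹ := by
    rw [← neg_sub (p₂.D * R₂), neg_inv_eq, ← neg_sub (p₂.D ^ 2), neg_mul_neg]
  have hz₁ : p₁.z⁻¹ • L = (p₁.z⁻¹ • (1 : Mat n)) *ᵥ L := by simp [smul_mulVec]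
  have hz₂ : p₂.z⁻¹ • L = (p₂.z⁻¹ • (1 : Mat n)) *ᵥ L := by simp [smul_mulVec]
  have hs := p₁.sq_sub_sq p₂
  rw [sub_smul] at hs
  rw [e1, hz₁, hz₂]
  apply colM_injective
  simp only [colM_mulVec, colM_sub]
  set X := (p₂.D * R₂ - p₁.D * R₁)⁻¹
  set v := colM V
  set l := colM L
  linear_combination (norm := noncomm_ring) -((p₂.D ^ 2 - p₁.D ^ 2) * hi * l) - hs * l

/-- The intermediate vertex drops out: the total displacement involves only the seed, the final pair
and products of the two parameters, so it does not see the order. -/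
theorem second_leaf_x (h₁ : IsOrth R₁) (V L f g : Pt n) :
    f ⬝ᵥ (p₁.sqrtR *ᵥ leafV p₁ R₁ V L - V)
      + leafV p₁ R₁ f g ⬝ᵥ (p₂.sqrtR *ᵥ leafV p₂ R₃ (leafV p₁ R₁ V L) (leafL p₁ R₀ R₁ V L)
          - leafV p₁ R₁ V L)
      = f ⬝ᵥ ((p₁.sqrtR * p₂.sqrtR)
            *ᵥ leafV p₂ R₃ (leafV p₁ R₁ V L) (leafL p₁ R₀ R₁ V L) - V)
        + p₁.s * p₂.s * (g ⬝ᵥ leafL p₂ R₁ R₃ (leafV p₁ R₁ V L) (leafL p₁ R₀ R₁ V L)) := by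
  have h := leaf_right (p := p₂) h₁ R₃ (leafV p₁ R₁ V L) (leafL p₁ R₀ R₁ V L)
  set V₁ := leafV p₁ R₁ V L
  set V₃ := leafV p₂ R₃ V₁ (leafL p₁ R₀ R₁ V L)
  set L₃ := leafL p₂ R₁ R₃ V₁ (leafL p₁ R₀ R₁ V L)
  have ht : p₁.sqrtRᵀ = p₁.sqrtR := by
    rw [SpectralParam.sqrtR, Matrix.transpose_smul, p₁.D_transpose]
  have e1 : leafV p₁ R₁ f g ⬝ᵥ (p₂.sqrtR *ᵥ V₃ - V₁)
      = f ⬝ᵥ (p₁.sqrtR *ᵥ (p₂.sqrtR *ᵥ V₃ - V₁)) + p₁.s * p₂.s * (g ⬝ᵥ L₃) := by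
    rw [leafV, add_dotProduct, dotProduct_mulVec f, ← mulVec_transpose, ht]
    congr 1
    rw [← h, smul_dotProduct, dotProduct_smul, dotProduct_mulVec, vecMul_mulVec,
      show R₁ᵀ * R₁ = 1 from h₁, Matrix.vecMul_one, smul_eq_mul, smul_eq_mul, mul_assoc]
  rw [e1, ← add_assoc, ← dotProduct_add]
  congr 2
  rw [mulVec_sub, mulVec_mulVec]
  abel

end SecondLeaf

theorem Datum.AgreeOn.symm {S T : Datum n} (h : S.AgreeOn U T) : T.AgreeOn U S := fun u hu =>
  ⟨(h u hu).1.symm, (h u hu).2.1.symm, (h u hu).2.2.1.symm, fun l => ((h u hu).2.2.2.1 l).symm,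
    fun l => ((h u hu).2.2.2.2.1 l).symm, (h u hu).2.2.2.2.2.symm⟩

theorem Datum.AgreeOn.trans {S T W : Datum n} (h : S.AgreeOn U T) (h' : T.AgreeOn U W) :
    S.AgreeOn U W := fun u hu => by
  obtain ⟨h1, h2, h3, h4, h5, h6⟩ := h u hu
  obtain ⟨k1, k2, k3, k4, k5, k6⟩ := h' u hu
  exact ⟨h1.trans k1, h2.trans k2, h3.trans k3, fun l => (h4 l).trans (k4 l),
    fun l => (h5 l).trans (k5 l), h6.trans k6⟩

theorem Datum.AgreeOn.refl (S : Datum n) : S.AgreeOn U S :=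
  fun _ _ => ⟨rfl, rfl, rfl, fun _ => rfl, fun _ => rfl, rfl⟩

theorem Datum.AgreeOn.backlund {S T : Datum n} (h : S.AgreeOn U T) {R R' : Pt n → Mat n}
    (hR : ∀ u ∈ U, R u = R' u) (p : SpectralParam a) :
    (backlund p S R).AgreeOn U (backlund p T R') := fun u hu => by
  obtain ⟨h1, h2, h3, h4, h5, h6⟩ := h u hu
  refine ⟨hR u hu, ?_, ?_, fun l => ?_, fun l => ?_, ?_⟩
  · simp only [Peterson.backlund, h2, h3, hR u hu]
  · simp only [Peterson.backlund, h1, h2, h3, hR u hu]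
  · simp only [Peterson.backlund, h4, h5, hR u hu]
  · simp only [Peterson.backlund, h1, h4, h5, hR u hu]
  · simp only [Peterson.backlund, h2, h3, h4, h6, hR u hu]

theorem IsRiccati.congr (hU : IsOpen U) {p : SpectralParam a} {R₀ R₁ R₁' : Pt n → Mat n}
    (h : IsRiccati p U R₀ R₁) (heq : ∀ u ∈ U, R₁ u = R₁' u) : IsRiccati p U R₀ R₁' :=
  ⟨h.hol.congr hU heq, fun u hu j => by rw [← pdM_congr hU heq hu, ← heq u hu]; exact h.eqn u hu j⟩

theorem IsBacklundTransform.congr (hU : IsOpen U) {p : SpectralParam a} {S T T' : Datum n}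
    (h : IsBacklundTransform p U S T) (hT : T.AgreeOn U T') : IsBacklundTransform p U S T' where
  riccati := h.riccati.congr hU fun u hu => (hT u hu).1
  left u hu := by rw [← (hT u hu).1, ← (hT u hu).2.1]; exact h.left u hu
  right u hu := by rw [← (hT u hu).2.2.1, ← (hT u hu).2.1]; exact h.right u hu
  frame_left u hu l := by
    rw [← (hT u hu).1, ← (hT u hu).2.2.2.1 l]; exact h.frame_left u hu l
  frame_right u hu l := by
    rw [← (hT u hu).2.2.2.2.1 l, ← (hT u hu).2.2.2.1 l]; exact h.frame_right u hu l
  tangency u hu := by rw [← (hT u hu).2.1]; exact h.tangency u hu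
  segment u hu l := by
    rw [← (hT u hu).2.1, ← (hT u hu).2.2.2.2.2]; exact h.segment u hu l
  segment_back u hu l := by
    rw [← (hT u hu).2.1, ← (hT u hu).2.2.2.2.2, ← (hT u hu).2.2.2.1 l]; exact h.segment_back u hu l

/-- The Bianchi Permutability Theorem. -/
theorem bianchi_permutability (hU : IsOpen U) {S : Datum n}
    (hS : IsDeformationDatum a U S) {R₁ R₂ R₃ : Pt n → Mat n}
    (hR₁ : IsRiccati p₁ U S.R R₁) (h₁ : ∀ u ∈ U, IsOrth (R₁ u))
    (hR₂ : IsRiccati p₂ U S.R R₂) (h₂ : ∀ u ∈ U, IsOrth (R₂ u))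
    (hG : ∀ u ∈ U, (p₂.D * R₂ u - p₁.D * R₁ u).det ≠ 0)
    (hR₃ : ∀ u ∈ U, R₃ u = bianchi p₁.D p₂.D (R₁ u) (R₂ u) * S.R u) :
    (∀ u ∈ U, IsOrth (R₃ u)) ∧ IsRiccati p₂ U R₁ R₃ ∧ IsRiccati p₁ U R₂ R₃ ∧
      (backlund p₂ (backlund p₁ S R₁) R₃).AgreeOn U (backlund p₁ (backlund p₂ S R₂) R₃) := by
  refine ⟨fun u hu => ?_, bianchi_isRiccati hU hS.compatible hR₁ h₁ hR₂ hG hR₃,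
    bianchi_isRiccati hU hS.compatible hR₂ h₂ hR₁ (fun u hu => det_sub_swap_ne_zero.1 (hG u hu))
      (fun u hu => by rw [hR₃ u hu, bianchi_comm (h₁ u hu) (h₂ u hu)]), fun u hu => ?_⟩
  · rw [hR₃ u hu]
    exact (bianchi_isOrth (h₁ u hu) (h₂ u hu) (hG u hu)).mul (hS.compatible.orth u hu)
  · have h₀ := hS.compatible.orth u hu
    have hV := second_leafV h₀ (h₁ u hu) (hG u hu) (hR₃ u hu)
    have hL := second_leafL h₀ (h₁ u hu) (h₂ u hu) (hG u hu) (hR₃ u hu)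
    refine ⟨rfl, hV _ _, hL _ _, fun l => hV _ _, fun l => hL _ _, ?_⟩
    ext l
    have hx₁ := second_leaf_x (p₁ := p₁) (p₂ := p₂) (R₀ := S.R u) (R₃ := R₃ u) (h₁ u hu)
      (S.V u) (S.L u) (S.frameV l u) (S.frameL l u)
    have hx₂ := second_leaf_x (p₁ := p₂) (p₂ := p₁) (R₀ := S.R u) (R₃ := R₃ u) (h₂ u hu)
      (S.V u) (S.L u) (S.frameV l u) (S.frameL l u)
    have hc : p₂.sqrtR * p₁.sqrtR = p₁.sqrtR * p₂.sqrtR := by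
      simp only [SpectralParam.sqrtR, smul_mul_assoc, mul_smul_comm, p₁.D_comm p₂]
      rw [smul_comm]
    rw [hc, mul_comm p₂.s, ← hV, ← hL] at hx₂
    have e : ∀ x : ℂ, ∀ y₁ y₂ z₁ z₂ : ℂ, y₁ + z₁ = y₂ + z₂ → x + y₁ + z₁ = x + y₂ + z₂ := by
      intro x y₁ y₂ z₁ z₂ h
      linear_combination h
    refine e (S.x u l) _ _ _ _ ?_
    have hx := hx₁.trans hx₂.symm
    exact hx.trans (by rw [hV]; rfl)

end Permutability

/-! ### Iterated Bäcklund transforms as data. -/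

section Iteration

variable {a : Fin n → ℂ} {U : Set (Pt n)} {ι : Type} {p : ι → SpectralParam a}
  {R : ι → Pt n → Mat n} {S : Datum n}

theorem iterDatum_R (hS : S.R = fun _ => 1) (l : List ι) :
    (iterDatum p S R l).R = iterR p R l := by
  cases l with
  | nil =>
    rw [iterDatum, hS]
    funext u
    rw [iterR_nil]
  | cons i l => rw [iterDatum]; rfl

/-- The induction carries along the Riccati equations of all further rotations over the current
datum; `bianchi_isRiccati` lifts them by one level. -/
theorem iterDatum_isDeformationDatum (hn : n ≠ 0) (hU : IsOpen U) (hS : IsDeformationDatum a U S)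
    (hS1 : S.R = fun _ => 1) (hR : ∀ i, IsRiccati (p i) U S.R (R i))
    (hO : ∀ i, ∀ u ∈ U, IsOrth (R i u)) (hN : IterNondegenerate p R U) (l : List ι)
    (hl : l.Nodup) : IsDeformationDatum a U (iterDatum p S R l) ∧
      ∀ i, (i :: l).Nodup → IsRiccati (p i) U (iterR p R l) (iterR p R (i :: l)) := by
  induction l with
  | nil =>
    refine ⟨by rw [iterDatum]; exact hS, fun i _ => ?_⟩
    rw [← iterDatum_R hS1, iterDatum, iterR_singleton]
    exact hR i
  | cons j l ih =>
    obtain ⟨ih1, ih2⟩ := ih hl.of_cons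
    have hRj := ih2 j hl
    have hO' : ∀ {l : List ι}, l.Nodup → ∀ u ∈ U, IsOrth (iterR p R l u) :=
      fun hl u hu => iterR_isOrth hO hN hu hl
    refine ⟨?_, fun i hi => ?_⟩
    · rw [iterDatum]
      refine backlund_isDeformationDatum hn hU ih1 ?_ (hO' hl)
      rw [iterDatum_R hS1]
      exact hRj
    · have hil := nodup_cons_of_cons_cons hi
      have hc := ih1.compatible
      rw [iterDatum_R hS1] at hc
      exact bianchi_isRiccati hU hc hRj (hO' hl) (ih2 i hil)
        (fun u hu => hN.det_ne_zero hO hu hi) (fun u hu => iterR_cons_cons i j l u)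

theorem iterDatum_isBacklundTransform (hn : n ≠ 0) (hU : IsOpen U) (hS : IsDeformationDatum a U S)
    (hS1 : S.R = fun _ => 1) (hR : ∀ i, IsRiccati (p i) U S.R (R i))
    (hO : ∀ i, ∀ u ∈ U, IsOrth (R i u)) (hN : IterNondegenerate p R U) {i : ι} {l : List ι}
    (hl : (i :: l).Nodup) :
    IsBacklundTransform (p i) U (iterDatum p S R l) (iterDatum p S R (i :: l)) := by
  obtain ⟨h1, h2⟩ := iterDatum_isDeformationDatum hn hU hS hS1 hR hO hN l hl.of_cons
  rw [iterDatum]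
  refine backlund_isBacklundTransform hn h1 ?_ (fun u hu => iterR_isOrth hO hN hu hl)
  rw [iterDatum_R hS1]
  exact h2 i hl

theorem iterDatum_perm (ha : ∀ j, a j ≠ 0) (hn : n ≠ 0) (hU : IsOpen U)
    (hS : IsDeformationDatum a U S)
    (hS1 : S.R = fun _ => 1) (hR : ∀ i, IsRiccati (p i) U S.R (R i))
    (hO : ∀ i, ∀ u ∈ U, IsOrth (R i u)) (hN : IterNondegenerate p R U) {l l' : List ι}
    (h : l.Perm l') (hl : l.Nodup) :
    (iterDatum p S R l).AgreeOn U (iterDatum p S R l') := by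
  induction h with
  | nil => exact Datum.AgreeOn.refl _
  | cons j hp ih =>
    rw [iterDatum, iterDatum]
    exact (ih hl.of_cons).backlund (fun u hu => iterR_perm ha hO hN hu (hp.cons j) hl) _
  | swap j k l =>
    have hjl := nodup_cons_of_cons_cons hl
    obtain ⟨h1, h2⟩ := iterDatum_isDeformationDatum hn hU hS hS1 hR hO hN l hl.of_cons.of_cons
    have hRj := h2 j hl.of_cons
    have hRk := h2 k hjl
    rw [← iterDatum_R hS1 (S := S)] at hRj hRk
    have := (bianchi_permutability (R₃ := iterR p R (k :: j :: l)) hU h1 hRj (fun u hu => iterR_isOrth hO hN hu hl.of_cons) hRk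
      (fun u hu => iterR_isOrth hO hN hu hjl) (fun u hu => hN.det_ne_zero hO hu hl)
      (fun u hu => by rw [iterDatum_R hS1, iterR_cons_cons])).2.2.2
    rw [iterDatum, iterDatum, iterDatum, iterDatum]
    exact this.trans ((Datum.AgreeOn.refl _).backlund (fun u hu => iterR_swap hO hN hu hl) _)
  | trans hp hq ih₁ ih₂ => exact (ih₁ hl).trans (ih₂ (hp.nodup_iff.1 hl))

end Iteration

end Peterson
namespace Peterson

variable {n : ℕ}

/-! ### Solutions of the system for the frame I. -/

section TrivialFrame

variable {a α : Fin n → ℂ} {U : Set (Pt n)}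

theorem omega_one (j : Fin n) : (omega fun _ => (1 : Mat n)) j = fun _ => 0 := by
  funext u
  simp [omega, pdM_const]

theorem isCompatible_one : IsCompatible a U fun _ => 1 where
  hol := HolM.const 1
  orth _ _ := IsOrth.one
  gauss u _ j k := by
    rw [omega_one, omega_one, pdM_const, pdM_const]
    simp only [transpose_one, Matrix.mul_one, Matrix.mul_assoc, quadA_mul_E]
    rw [← Matrix.mul_assoc, ← Matrix.mul_assoc, E_comm j k]
    simp
  codazzi u _ j k := by
    rw [omega_one, omega_one, pdM_const, pdM_const]
    simp

theorem one_mul_E_mulVec (j : Fin n) (v : Pt n) :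
    ((1 : Mat n) * E j) *ᵥ v = Pi.single j (v j) := by
  ext k
  rw [mul_E_mulVec, Matrix.one_apply, Pi.single_apply]
  split_ifs <;> simp

theorem E_mul_quadA_mulVec (j : Fin n) (v : Pt n) :
    (E j * (1 : Mat n)ᵀ * quadA a) *ᵥ v = Pi.single j ((a j)⁻¹ * v j) := by
  rw [transpose_one, Matrix.mul_one, ← mulVec_mulVec, ← Matrix.one_mul (E j), one_mul_E_mulVec,
    quadA, mulVec_diagonal]

/-- The differential system for the frame `R = Iₙ`. -/
theorem isLinearSolution_one_iff {V L : Pt n → Pt n} : IsLinearSolution a U (fun _ => 1) V L ↔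
    AnalyticOnNhd ℂ V U ∧ AnalyticOnNhd ℂ L U ∧
      (∀ u ∈ U, ∀ j, pd j V u = Pi.single j (L u j)) ∧
      ∀ u ∈ U, ∀ j, pd j L u = -Pi.single j ((a j)⁻¹ * V u j) := by
  have h (u : Pt n) (j : Fin n) : omega (fun _ => (1 : Mat n)) j u = 0 := by rw [omega_one]
  refine ⟨fun hs => ⟨hs.hol_V, hs.hol_L, fun u hu j => ?_, fun u hu j => ?_⟩,
    fun ⟨h1, h2, h3, h4⟩ => ⟨h1, h2, fun u hu j => ?_, fun u hu j => ?_⟩⟩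
  · rw [hs.dV u hu, one_mul_E_mulVec]
  · rw [hs.dL u hu, E_mul_quadA_mulVec, h, zero_mulVec, zero_sub]
  · rw [h3 u hu, one_mul_E_mulVec]
  · rw [h4 u hu, E_mul_quadA_mulVec, h, zero_mulVec, zero_sub]

theorem analyticOnNhd_cexp_coord (c : ℂ) (k : Fin n) :
    AnalyticOnNhd ℂ (fun u : Pt n => Complex.exp (c * u k)) U := fun u hu =>
  (analyticAt_const.mul (analyticOnNhd_coord U k u hu)).cexp

theorem pd_cexp_coord (c : ℂ) (j k : Fin n) (u : Pt n) :
    pd j (fun u : Pt n => Complex.exp (c * u k)) u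
      = if k = j then c * Complex.exp (c * u k) else 0 := by
  have hd : DifferentiableAt ℂ (fun w : Pt n => w k) u := by fun_prop
  have hd' : DifferentiableAt ℂ (fun w : Pt n => c * w k) u := by fun_prop
  have h : pd j (fun w : Pt n => c * w k) u = c * pd j (fun w : Pt n => w k) u :=
    pd_smul_const hd c j
  rw [pd_cexp hd', h, pd_coord]
  split_ifs <;> ring

theorem neg_I_mul (x y : ℂ) : -(Complex.I * x * y) = -(Complex.I * x) * y := by ring

theorem analyticOnNhd_expV (b₁ b₂ : Fin n → ℂ) : AnalyticOnNhd ℂ (expV α b₁ b₂) U := by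
  refine analyticOnNhd_vec fun k u hu => ?_
  simp only [expV, neg_I_mul]
  exact (analyticAt_const.mul (analyticOnNhd_cexp_coord _ k u hu)).add
    (analyticAt_const.mul (analyticOnNhd_cexp_coord _ k u hu))

theorem analyticOnNhd_expL (b₁ b₂ : Fin n → ℂ) : AnalyticOnNhd ℂ (expL α b₁ b₂) U := by
  refine analyticOnNhd_vec fun k u hu => ?_
  simp only [expL, neg_I_mul]
  exact analyticAt_const.mul ((analyticAt_const.mul (analyticOnNhd_cexp_coord _ k u hu)).sub
    (analyticAt_const.mul (analyticOnNhd_cexp_coord _ k u hu)))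

theorem pd_two_exp (x y c : ℂ) (j k : Fin n) (u : Pt n) :
    pd j (fun u : Pt n => x * Complex.exp (c * u k) + y * Complex.exp (-c * u k)) u
      = if k = j then c * (x * Complex.exp (c * u k) - y * Complex.exp (-c * u k)) else 0 := by
  have hd (c : ℂ) : DifferentiableAt ℂ (fun w : Pt n => Complex.exp (c * w k)) u := by fun_prop
  have h (x c : ℂ) : pd j (fun w : Pt n => x * Complex.exp (c * w k)) u
      = x * pd j (fun w : Pt n => Complex.exp (c * w k)) u := pd_smul_const (hd c) x j
  rw [pd_add ((hd c).const_mul x) ((hd (-c)).const_mul y), h, h, pd_cexp_coord, pd_cexp_coord]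
  split_ifs <;> ring

theorem pd_expV (b₁ b₂ : Fin n → ℂ) (j : Fin n) (u : Pt n) :
    pd j (expV α b₁ b₂) u = Pi.single j (expL α b₁ b₂ u j) := by
  ext k
  rw [pd_apply (analyticOnNhd_expV (U := Set.univ) b₁ b₂ u trivial).differentiableAt,
    Pi.single_apply]
  simp only [expV, expL, neg_I_mul, pd_two_exp]
  split_ifs with h
  · rw [h]
  · rfl

theorem I_mul_alpha_sq (hα : ∀ j, α j ^ 2 = (a j)⁻¹) (j : Fin n) :
    (Complex.I * α j) * (Complex.I * α j) = -(a j)⁻¹ := by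
  rw [← hα]
  linear_combination α j ^ 2 * Complex.I_mul_I

theorem pd_expL (hα : ∀ j, α j ^ 2 = (a j)⁻¹) (b₁ b₂ : Fin n → ℂ) (j : Fin n) (u : Pt n) :
    pd j (expL α b₁ b₂) u = -Pi.single j ((a j)⁻¹ * expV α b₁ b₂ u j) := by
  ext k
  have h : (fun w => expL α b₁ b₂ w k) = fun w : Pt n =>
      Complex.I * α k * b₁ k * Complex.exp (Complex.I * α k * w k)
        + -(Complex.I * α k * b₂ k) * Complex.exp (-(Complex.I * α k) * w k) := by
    funext w
    simp only [expL, neg_I_mul]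
    ring
  rw [pd_apply (analyticOnNhd_expL (U := Set.univ) b₁ b₂ u trivial).differentiableAt, h,
    pd_two_exp, Pi.neg_apply, Pi.single_apply]
  split_ifs with h
  · subst h
    simp only [expV, neg_I_mul]
    linear_combination (b₁ k * Complex.exp (Complex.I * α k * u k)
      + b₂ k * Complex.exp (-(Complex.I * α k) * u k)) * I_mul_alpha_sq hα k
  · simp

theorem isLinearSolution_exp (hα : ∀ j, α j ^ 2 = (a j)⁻¹) (b₁ b₂ : Fin n → ℂ) :
    IsLinearSolution a U (fun _ => 1) (expV α b₁ b₂) (expL α b₁ b₂) :=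
  isLinearSolution_one_iff.2 ⟨analyticOnNhd_expV _ _, analyticOnNhd_expL _ _,
    fun u _ j => pd_expV b₁ b₂ j u, fun u _ j => pd_expL hα b₁ b₂ j u⟩

/-- Since (iα_j)² = -a_j⁻¹, the terms with squared exponentials cancel and the mixed ones double.
The orthonormality relations thus become the quadratic system for the constants, independently of u.
-/
theorem exp_invariant (hα : ∀ j, α j ^ 2 = (a j)⁻¹) (b₁ b₂ b₁' b₂' : Fin n → ℂ) (u : Pt n) :
    expV α b₁ b₂ u ⬝ᵥ quadA a *ᵥ expV α b₁' b₂' u + expL α b₁ b₂ u ⬝ᵥ expL α b₁' b₂' u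
      = ∑ j, 2 * (a j)⁻¹ * (b₁ j * b₂' j + b₂ j * b₁' j) := by
  rw [dot_quadA, dotProduct, ← Finset.sum_add_distrib]
  refine Finset.sum_congr rfl fun j _ => ?_
  have he : Complex.exp (Complex.I * α j * u j) * Complex.exp (-(Complex.I * α j * u j)) = 1 := by
    rw [← Complex.exp_add, add_neg_cancel, Complex.exp_zero]
  simp only [expV, expL]
  set x := Complex.exp (Complex.I * α j * u j)
  set y := Complex.exp (-(Complex.I * α j * u j))
  linear_combination (b₁ j * x - b₂ j * y) * (b₁' j * x - b₂' j * y) * I_mul_alpha_sq hα j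
    + 2 * (a j)⁻¹ * (b₁ j * b₂' j + b₂ j * b₁' j) * he

/-- On a connected set the solutions for the frame `R = Iₙ` are exponentials. -/
theorem IsLinearSolution.exists_exp (ha : ∀ j, a j ≠ 0) (hα : ∀ j, α j ^ 2 = (a j)⁻¹)
    (hU : IsOpen U) (hc : IsConnected U) {V L : Pt n → Pt n}
    (h : IsLinearSolution a U (fun _ => 1) V L) :
    ∃ b₁ b₂ : Fin n → ℂ, ∀ u ∈ U, V u = expV α b₁ b₂ u ∧ L u = expL α b₁ b₂ u := by
  obtain ⟨hV, hL, dV, dL⟩ := isLinearSolution_one_iff.1 h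
  obtain ⟨u₀, hu₀⟩ := hc.nonempty
  have hβ (k : Fin n) : Complex.I * α k ≠ 0 := mul_ne_zero Complex.I_ne_zero (alpha_ne_zero ha hα k)
  -- For c = ±iα_k the combination V + c⁻¹Λ is an eigenvector of the oscillator, so its product with
  -- exp(-c uᵏ) is a first integral.
  have key : ∀ (k : Fin n) (c : ℂ), c * c = -(a k)⁻¹ → c ≠ 0 → ∀ u ∈ U,
      Complex.exp (-c * u k) * (V u k + c⁻¹ * L u k)
        = Complex.exp (-c * u₀ k) * (V u₀ k + c⁻¹ * L u₀ k) := by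
    intro k c hcc hc0 u hu
    have dVk : ∀ u ∈ U, DifferentiableAt ℂ (fun w => V w k) u := fun u hu =>
      (analyticOnNhd_apply hV k u hu).differentiableAt
    have dLk : ∀ u ∈ U, DifferentiableAt ℂ (fun w => L w k) u := fun u hu =>
      (analyticOnNhd_apply hL k u hu).differentiableAt
    refine eq_of_pd_eq_zero (f := fun u => Complex.exp (-c * u k) * (V u k + c⁻¹ * L u k)) hU
      hc.isPreconnected (fun u hu => ?_) (fun u hu j => ?_) hu hu₀
    · exact DifferentiableAt.fun_mul (by fun_prop) ((dVk u hu).fun_add ((dLk u hu).const_mul _))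
    · have e1 : pd j (fun w => c⁻¹ * L w k) u = c⁻¹ * pd j (fun w => L w k) u :=
        pd_smul_const (dLk u hu) _ j
      rw [pd_mul (by fun_prop) ((dVk u hu).fun_add ((dLk u hu).const_mul _)),
        pd_add (dVk u hu) ((dLk u hu).const_mul _), e1, pd_cexp_coord,
        ← pd_apply (hV u hu).differentiableAt, ← pd_apply (hL u hu).differentiableAt, dV u hu,
        dL u hu, Pi.neg_apply, Pi.single_apply, Pi.single_apply]
      split_ifs with hkj
      · subst hkj
        have hci := mul_inv_cancel₀ hc0
        set e := Complex.exp (-c * u k)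
        linear_combination -(e * c⁻¹ * V u k) * hcc + (e * V u k * c - e * L u k) * hci
      · simp
  have hα' (k : Fin n) := I_mul_alpha_sq hα k
  -- The constants are half the values of the two first integrals at u₀.
  refine ⟨fun k => Complex.exp (-(Complex.I * α k) * u₀ k)
      * (V u₀ k + (Complex.I * α k)⁻¹ * L u₀ k) / 2,
    fun k => Complex.exp (-(-(Complex.I * α k)) * u₀ k)
      * (V u₀ k + (-(Complex.I * α k))⁻¹ * L u₀ k) / 2, fun u hu => ?_⟩
  have h1 (k : Fin n) := key k _ (hα' k) (hβ k) u hu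
  have h2 (k : Fin n) := key k (-(Complex.I * α k)) (by rw [neg_mul_neg, hα' k])
    (neg_ne_zero.2 (hβ k)) u hu
  have he (k : Fin n) : Complex.exp (-(Complex.I * α k) * u k)
      * Complex.exp (Complex.I * α k * u k) = 1 := by
    rw [← Complex.exp_add, neg_mul, neg_add_cancel, Complex.exp_zero]
  constructor <;> ext k <;> simp only [expV, expL, neg_I_mul] <;>
    rw [← h1 k, ← h2 k, neg_neg, inv_neg]
  · linear_combination -(V u k) * he k
  · linear_combination -(L u k) * he k - L u k * (Complex.exp (-(Complex.I * α k) * u k)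
      * Complex.exp (Complex.I * α k * u k)) * mul_inv_cancel₀ (hβ k)

theorem isVLSolution_one_iff (ha : ∀ j, a j ≠ 0) (hα : ∀ j, α j ^ 2 = (a j)⁻¹)
    (hU : IsOpen U) (hc : IsConnected U) (V L : Pt n → Pt n) :
    IsVLSolution a U (fun _ => 1) V L ↔
      ∃ b₁ b₂ : Fin n → ℂ, ∑ j, 2 * (a j)⁻¹ * (b₁ j * b₂ j + b₂ j * b₁ j) = -1 ∧
        ∀ u ∈ U, V u = expV α b₁ b₂ u ∧ L u = expL α b₁ b₂ u := by
  constructor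
  · intro h
    obtain ⟨b₁, b₂, hb⟩ := h.toIsLinearSolution.exists_exp ha hα hU hc
    obtain ⟨u₀, hu₀⟩ := hc.nonempty
    refine ⟨b₁, b₂, ?_, hb⟩
    have hp := h.prime_integral u₀ hu₀
    rw [(hb u₀ hu₀).1, (hb u₀ hu₀).2] at hp
    rw [← exp_invariant hα b₁ b₂ b₁ b₂ u₀, hp]
    ring
  · rintro ⟨b₁, b₂, hs, hb⟩
    have he := isLinearSolution_one_iff.1 (isLinearSolution_exp (U := U) hα b₁ b₂)
    refine ⟨isLinearSolution_one_iff.2 ⟨analyticOnNhd_congr hU he.1 fun u hu => (hb u hu).1.symm,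
      analyticOnNhd_congr hU he.2.1 fun u hu => (hb u hu).2.symm, fun u hu j => ?_,
      fun u hu j => ?_⟩, fun u hu => ?_⟩
    · rw [pd_congr hU (fun u hu => (hb u hu).1) hu, (hb u hu).2]
      exact he.2.2.1 u hu j
    · rw [pd_congr hU (fun u hu => (hb u hu).2) hu, (hb u hu).1]
      exact he.2.2.2 u hu j
    · have := exp_invariant hα b₁ b₂ b₁ b₂ u
      rw [(hb u hu).1, (hb u hu).2]
      linear_combination this + hs

end TrivialFrame

/-! ### The explicit space realizations. -/

section Explicit

variable {a α : Fin n → ℂ} {U : Set (Pt n)}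

theorem analyticOnNhd_petersonX (c : Constants n) : AnalyticOnNhd ℂ (petersonX α c) U := by
  refine analyticOnNhd_vec fun l u hu => ?_
  have hk (k : Fin n) : AnalyticAt ℂ (fun w : Pt n => w k) u := analyticOnNhd_coord U k u hu
  have he : ∀ (c' : ℂ) (k : Fin n), AnalyticAt ℂ (fun w : Pt n => Complex.exp (c' * w k)) u :=
    fun c' k => analyticOnNhd_cexp_coord c' k u hu
  have hn : ∀ (c' : ℂ) (k : Fin n), AnalyticAt ℂ (fun w : Pt n => Complex.exp (-(c' * w k))) u :=
    fun c' k => (analyticAt_const.mul (hk k)).neg.cexp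
  unfold petersonX
  refine AnalyticAt.add ?_ analyticAt_const
  refine Finset.analyticAt_fun_sum _ fun k _ => ?_
  exact (analyticAt_const.mul ((analyticAt_const.mul (he _ k)).add
    (analyticAt_const.mul (hn _ k)))).add (analyticAt_const.mul (hk k))

theorem pd_petersonX (c : Constants n) (j : Fin n) (u : Pt n) (l : Fin (2 * n - 1)) :
    pd j (petersonX α c) u l = expV α (c.f₁ l) (c.f₂ l) u j * expL α c.c₁ c.c₂ u j := by
  have hd : ∀ k : Fin n, DifferentiableAt ℂ (fun w : Pt n =>
      1 / 2 * c.f₁ l k * c.c₁ k * Complex.exp (2 * Complex.I * α k * w k)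
        + 1 / 2 * c.f₂ l k * c.c₂ k * Complex.exp (-(2 * Complex.I * α k) * w k)) u := by
    intro k; fun_prop
  have hl : ∀ (e : ℂ) (k : Fin n), DifferentiableAt ℂ (fun w : Pt n => e * w k) u := by
    intro e k; fun_prop
  have hp : ∀ (e : ℂ) (k : Fin n), pd j (fun w : Pt n => e * w k) u
      = e * pd j (fun w : Pt n => w k) u := fun e k => pd_smul_const (by fun_prop) e j
  have heq : (fun w => petersonX α c w l) = fun w : Pt n => ∑ k,
      ((1 / 2 * c.f₁ l k * c.c₁ k * Complex.exp (2 * Complex.I * α k * w k)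
        + 1 / 2 * c.f₂ l k * c.c₂ k * Complex.exp (-(2 * Complex.I * α k) * w k))
      + Complex.I * α k * (c.f₂ l k * c.c₁ k - c.f₁ l k * c.c₂ k) * w k) + c.t l := by
    funext w
    rw [petersonX]
    congr 1
    refine Finset.sum_congr rfl fun k _ => ?_
    rw [neg_mul]
    ring
  rw [pd_apply (analyticOnNhd_petersonX (U := Set.univ) c u trivial).differentiableAt, heq,
    pd_add (DifferentiableAt.fun_sum fun k _ => (hd k).fun_add (hl _ k))
      (differentiableAt_const _), pd_const, add_zero,
    pd_sum _ fun k _ => (hd k).fun_add (hl _ k), Finset.sum_eq_single j]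
  · rw [pd_add (hd j) (hl _ j), hp, pd_coord, pd_two_exp]
    have e1 : Complex.exp (2 * Complex.I * α j * u j) = Complex.exp (Complex.I * α j * u j)
        * Complex.exp (Complex.I * α j * u j) := by
      rw [← Complex.exp_add]; ring_nf
    have e2 : Complex.exp (-(2 * Complex.I * α j) * u j) = Complex.exp (-(Complex.I * α j * u j))
        * Complex.exp (-(Complex.I * α j * u j)) := by
      rw [← Complex.exp_add]; ring_nf
    have he : Complex.exp (Complex.I * α j * u j) * Complex.exp (-(Complex.I * α j * u j)) = 1 := by
      rw [← Complex.exp_add, add_neg_cancel, Complex.exp_zero]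
    simp only [if_true, expV, expL, e1, e2]
    linear_combination -(Complex.I * α j * (c.f₂ l j * c.c₁ j - c.f₁ l j * c.c₂ j)) * he
  · intro k _ hk
    rw [pd_add (hd k) (hl _ k), hp, pd_coord, pd_two_exp, if_neg hk, if_neg hk]
    simp
  · simp

theorem petersonDatum_isDeformationDatum (hα : ∀ j, α j ^ 2 = (a j)⁻¹) {c : Constants n}
    (hc : c.Admissible a) : IsDeformationDatum a U (petersonDatum α c) where
  compatible := isCompatible_one
  solution := ⟨isLinearSolution_exp hα _ _, fun u _ => by
    have := exp_invariant hα c.c₁ c.c₂ c.c₁ c.c₂ u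
    rw [hc.seed_seed] at this
    simp only [petersonDatum]
    linear_combination this⟩
  frame_solution l := isLinearSolution_exp hα _ _
  frame_orthonormal u _ l m :=
    (exp_invariant hα _ _ _ _ u).trans (hc.frame_frame l m)
  frame_orthogonal u _ l := (exp_invariant hα _ _ _ _ u).trans (hc.frame_seed l)
  hol_x := analyticOnNhd_petersonX c
  dx u _ j l := by
    simp only [petersonDatum]
    rw [pd_petersonX, pd_expV, dotProduct_single]

theorem petersonDatum_isPeterson (ha : ∀ j, a j ≠ 0) (hα : ∀ j, α j ^ 2 = (a j)⁻¹) (hn : n ≠ 0)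
    {c : Constants n} (hc : c.Admissible a) (hU : IsOpen U)
    (hreg : (petersonDatum α c).RegularOn U) :
    IsPeterson α U (petersonDatum α c).V (petersonDatum α c).x where
  toIsIsometricDeformation :=
    (petersonDatum_isDeformationDatum hα hc).isIsometricDeformation ha hα hn hU hreg
  frame_one u _ j k hkj := by
    simp only [petersonDatum]
    rw [pd_expV, Pi.single_eq_of_ne hkj]

end Explicit

/-! ### The Riccati equation over the frame I. -/

section ExplicitRiccati

variable {a : Fin n → ℂ} {U : Set (Pt n)} {p : SpectralParam a}

theorem isRiccati_one_iff {R₁ : Pt n → Mat n} :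
    IsRiccati p U (fun _ => 1) R₁ ↔ IsPetersonRiccati p U R₁ := by
  have h (u : Pt n) (j : Fin n) : omega (fun _ => (1 : Mat n)) j u = 0 := by rw [omega_one]
  constructor <;> rintro ⟨h1, h2⟩ <;> refine ⟨h1, fun u hu j => ?_⟩
  · simpa [h] using h2 u hu j
  · simpa [h] using h2 u hu j

theorem expZ_apply (ζ : Mat n) (u : Pt n) (j k : Fin n) : expZ p ζ u j k =
    if j = k then -1 / 2 + (ζ j j + 1 / 2) * Complex.exp (-(2 * p.d j * u j))
    else ζ j k * Complex.exp (-(p.d j * u j) - p.d k * u k) := rfl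

theorem holM_expZ (ζ : Mat n) : HolM U (expZ p ζ) := by
  intro k l u hu
  have hk (k : Fin n) : AnalyticAt ℂ (fun w : Pt n => w k) u := analyticOnNhd_coord U k u hu
  simp only [expZ_apply]
  split_ifs
  · exact analyticAt_const.add (analyticAt_const.mul (analyticAt_const.mul (hk k)).neg.cexp)
  · exact analyticAt_const.mul
      ((analyticAt_const.mul (hk k)).neg.sub (analyticAt_const.mul (hk l))).cexp

/-- This is the Riccati equation for R₁ = I + Z⁻¹ rewritten for Z: the substitution makes it affine
linear, with diagonal coefficients. -/
theorem pdM_expZ (ζ : Mat n) (u : Pt n) (j : Fin n) : pdM j (expZ p ζ) u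
    = -(expZ p ζ u * (E j * p.D) + E j * p.D * expZ p ζ u + E j * p.D) := by
  have hED : (E j * p.D : Mat n) = Matrix.diagonal (Pi.single j (p.d j)) := by
    rw [E_eq_diagonal, SpectralParam.D, diagonal_mul_diagonal]
    congr 1
    ext k
    rw [Pi.single_apply, Pi.single_apply]
    split_ifs with h
    · rw [h, one_mul]
    · rw [zero_mul]
  ext k l
  rw [hED, Matrix.neg_apply, Matrix.add_apply, Matrix.add_apply, mul_diagonal, diagonal_mul,
    Matrix.diagonal_apply, Pi.single_apply, Pi.single_apply]
  have hl (e : ℂ) (k : Fin n) : pd j (fun w : Pt n => e * w k) u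
      = e * pd j (fun w : Pt n => w k) u := pd_smul_const (by fun_prop) e j
  have hs (e : ℂ) (f : Pt n → ℂ) (hf : DifferentiableAt ℂ f u) :
      pd j (fun w : Pt n => e * Complex.exp (f w)) u = e * (Complex.exp (f u) * pd j f u) := by
    rw [← pd_cexp hf]
    exact pd_smul_const hf.cexp e j
  simp only [pdM, Matrix.of_apply, expZ_apply]
  by_cases hkl : k = l
  · subst hkl
    simp only [if_true]
    rw [pd_add (differentiableAt_const _) (by fun_prop), pd_const, hs _ _ (by fun_prop), pd_neg, hl,
      pd_coord]
    split_ifs with h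
    · subst h; ring
    · ring
  · simp only [if_neg hkl]
    rw [hs _ _ (by fun_prop), pd_sub (by fun_prop) (by fun_prop), pd_neg, hl, hl, pd_coord, pd_coord]
    split_ifs with h1 h2 h2
    · exact absurd (h1.trans h2.symm) hkl
    · subst h1; ring
    · subst h2; ring
    · ring

theorem expZ_injective (u : Pt n) : Function.Injective fun ζ => expZ p ζ u := by
  intro ζ ζ' h
  ext j k
  have hjk := congrFun (congrFun h j) k
  simp only [expZ_apply] at hjk
  split_ifs at hjk with hj
  · subst hj
    exact add_right_cancel (mul_right_cancel₀ (Complex.exp_ne_zero _) (add_left_cancel hjk))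
  · exact mul_right_cancel₀ (Complex.exp_ne_zero _) hjk

theorem expZ_surjective (u : Pt n) : Function.Surjective fun ζ => expZ p ζ u := by
  intro M
  refine ⟨Matrix.of fun j k => if j = k then (M j j + 1 / 2) * Complex.exp (2 * p.d j * u j) - 1 / 2
    else M j k * Complex.exp (-(-(p.d j * u j) - p.d k * u k)), ?_⟩
  have he (x : ℂ) : Complex.exp x * Complex.exp (-x) = 1 := by
    rw [← Complex.exp_add, add_neg_cancel, Complex.exp_zero]
  ext j k
  simp only [expZ_apply, Matrix.of_apply, if_true]
  split_ifs with hj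
  · subst hj
    linear_combination (M j j + 1 / 2) * he (2 * p.d j * u j)
  · linear_combination M j k * he (-(p.d j * u j) - p.d k * u k)

theorem explicitR_injective {ζ ζ' : Mat n} {u : Pt n} (h : (expZ p ζ u).det ≠ 0)
    (he : explicitR p ζ u = explicitR p ζ' u) : ζ = ζ' := by
  refine expZ_injective (p := p) u ?_
  have h1 : (expZ p ζ u)⁻¹ = (expZ p ζ' u)⁻¹ := add_left_cancel he
  have hu : IsUnit (expZ p ζ u).det := isUnit_iff_ne_zero.2 h
  exact Matrix.inv_inj h1 hu

theorem exists_explicitR_eq {M : Mat n} (hM : (M - 1).det ≠ 0) (u : Pt n) :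
    ∃ ζ : Mat n, (expZ p ζ u).det ≠ 0 ∧ explicitR p ζ u = M := by
  obtain ⟨ζ, hζ⟩ := expZ_surjective (p := p) u (M - 1)⁻¹
  have hζ' : expZ p ζ u = (M - 1)⁻¹ := hζ
  have hu : IsUnit (M - 1).det := isUnit_iff_ne_zero.2 hM
  refine ⟨ζ, ?_, ?_⟩
  · rw [hζ']
    exact (Matrix.isUnit_nonsing_inv_det _ hu).ne_zero
  · rw [explicitR, hζ', Matrix.nonsing_inv_nonsing_inv _ hu, add_sub_cancel]

theorem existsUnique_explicitR_eq (u₀ : Pt n) {M : Mat n} (hM : (M - 1).det ≠ 0) :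
    ∃! ζ : Mat n, (expZ p ζ u₀).det ≠ 0 ∧ explicitR p ζ u₀ = M := by
  obtain ⟨ζ, h1, h2⟩ := exists_explicitR_eq (p := p) hM u₀
  exact ⟨ζ, ⟨h1, h2⟩, fun ζ' h => explicitR_injective h.1 (h.2.trans h2.symm)⟩

theorem explicitR_isPetersonRiccati (hU : IsOpen U) {ζ : Mat n}
    (h : ∀ u ∈ U, (expZ p ζ u).det ≠ 0) : IsPetersonRiccati p U (explicitR p ζ) := by
  have hol : HolM U fun w => (expZ p ζ w)⁻¹ := (holM_expZ ζ).inv h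
  refine ⟨(HolM.const 1).add hol, fun u hu j => ?_⟩
  have hd : pdM j (explicitR p ζ) u = -((expZ p ζ u)⁻¹ * pdM j (expZ p ζ) u * (expZ p ζ u)⁻¹) := by
    rw [← pdM_inv hU (holM_expZ ζ) h hu]
    exact (pdM_add (HolM.const 1) hol hu j).trans (by rw [pdM_const, zero_add])
  have hi := Matrix.nonsing_inv_mul _ (isUnit_iff_ne_zero.2 (h u hu))
  have hi' := Matrix.mul_nonsing_inv _ (isUnit_iff_ne_zero.2 (h u hu))
  rw [hd, pdM_expZ, p.D_mul_E, explicitR]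
  set Z := expZ p ζ u
  set Y := Z⁻¹
  linear_combination (norm := noncomm_ring) hi * E j * p.D * Y + Y * E j * p.D * hi'

theorem IsPetersonRiccati.congr (hU : IsOpen U) {R R' : Pt n → Mat n}
    (h : IsPetersonRiccati p U R) (heq : ∀ u ∈ U, R u = R' u) : IsPetersonRiccati p U R' :=
  isRiccati_one_iff.1 ((isRiccati_one_iff.2 h).congr hU heq)

theorem isPetersonRiccati_iff (hU : IsOpen U) (hc : IsConnected U) {u₀ : Pt n} (hu₀ : u₀ ∈ U)
    {R₁ : Pt n → Mat n} (h₀ : (R₁ u₀ - 1).det ≠ 0) : IsPetersonRiccati p U R₁ ↔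
      ∃! ζ : Mat n, ∀ u ∈ U, (expZ p ζ u).det ≠ 0 ∧ R₁ u = explicitR p ζ u := by
  constructor
  · intro h
    obtain ⟨ζ, h1, h2⟩ := exists_explicitR_eq (p := p) h₀ u₀
    refine ⟨ζ, fun u hu => ?_, fun ζ' h' => explicitR_injective (h' u₀ hu₀).1
      ((h' u₀ hu₀).2.symm.trans h2.symm)⟩
    have hW : HolM U fun w => R₁ w - 1 := h.hol.sub (HolM.const 1)
    have hZ : HolM U (expZ p ζ) := holM_expZ ζ
    -- The function (R₁ - I)Z - I satisfies a homogeneous linear system and vanishes at u₀. Its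
    -- vanishing on U gives invertibility of Z and the formula for R₁ at once, without assuming
    -- either away from u₀.
    have hY := eq_zero_of_pdM_eq hU hc.isPreconnected
      (Y := fun w => (R₁ w - 1) * expZ p ζ w - 1)
      (P := fun j w => (R₁ w - 1) * (E j * p.D) + E j * p.D) (Q := fun j _ => -(E j * p.D))
      ((hW.mul hZ).sub (HolM.const 1))
      (fun j => (hW.mul (HolM.const (E j * p.D))).add (HolM.const (E j * p.D)))
      (fun j => HolM.const _) (fun w hw j => by
        rw [pdM_sub (hW.mul hZ) (HolM.const 1) hw, pdM_mul hW hZ hw,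
          pdM_sub h.hol (HolM.const 1) hw, pdM_const, pdM_expZ, h.eqn w hw, p.D_mul_E]
        noncomm_ring) hu₀ (by
        have hi := Matrix.nonsing_inv_mul _ (isUnit_iff_ne_zero.2 h1)
        have e : R₁ u₀ - 1 = (expZ p ζ u₀)⁻¹ := by rw [← h2, explicitR, add_sub_cancel_left]
        show (R₁ u₀ - 1) * expZ p ζ u₀ - 1 = 0
        rw [e, hi, sub_self]) u hu
    have hWZ : (R₁ u - 1) * expZ p ζ u = 1 := sub_eq_zero.1 hY
    refine ⟨?_, ?_⟩
    · intro hz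
      have := congrArg Matrix.det hWZ
      rw [Matrix.det_mul, hz, mul_zero, Matrix.det_one] at this
      exact zero_ne_one this
    · rw [explicitR, Matrix.inv_eq_left_inv hWZ, add_sub_cancel]
  · rintro ⟨ζ, h, -⟩
    exact (explicitR_isPetersonRiccati hU fun u hu => (h u hu).1).congr hU
      fun u hu => (h u hu).2.symm

/-- Multiplying (I + Z⁻¹)ᵀ(I + Z⁻¹) = I by Zᵀ and Z gives Z + Zᵀ + I = 0. In that sum the
exponentials factor out entry by entry, leaving conditions on ζ alone. -/
theorem isOrth_explicitR_iff {ζ : Mat n} {u : Pt n} (h : (expZ p ζ u).det ≠ 0) :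
    IsOrth (explicitR p ζ u) ↔ (∀ j, ζ j j = -1 / 2) ∧ ∀ j k, j ≠ k → ζ j k = -ζ k j := by
  have hu : IsUnit (expZ p ζ u).det := isUnit_iff_ne_zero.2 h
  have hi := Matrix.nonsing_inv_mul _ hu
  have hi' := Matrix.mul_nonsing_inv _ hu
  have hit : (expZ p ζ u)ᵀ * ((expZ p ζ u)⁻¹)ᵀ = 1 := by rw [← transpose_mul, hi, transpose_one]
  have hit' : ((expZ p ζ u)⁻¹)ᵀ * (expZ p ζ u)ᵀ = 1 := by rw [← transpose_mul, hi', transpose_one]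
  have key : IsOrth (explicitR p ζ u) ↔ expZ p ζ u + (expZ p ζ u)ᵀ + 1 = 0 := by
    rw [IsOrth, explicitR, transpose_add, transpose_one]
    set Z := expZ p ζ u
    set Y := Z⁻¹
    constructor
    · intro ho
      have := congrArg (fun M => Zᵀ * M * Z) ho
      linear_combination (norm := noncomm_ring) this - hit * Z - Zᵀ * hi - hit * (Y * Z) - hi
    · intro hz
      linear_combination (norm := noncomm_ring) Yᵀ * hz * Y - Yᵀ * hi' - hit' * Y
  rw [key]
  constructor
  · intro hz
    refine ⟨fun j => ?_, fun j k hjk => ?_⟩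
    · have := congrFun (congrFun hz j) j
      simp only [Matrix.add_apply, transpose_apply, Matrix.zero_apply, one_apply_eq, expZ_apply,
        if_true] at this
      have h2 : (ζ j j + 1 / 2) * Complex.exp (-(2 * p.d j * u j)) = 0 := by
        linear_combination this / 2
      linear_combination (mul_eq_zero.1 h2).resolve_right (Complex.exp_ne_zero _)
    · have := congrFun (congrFun hz j) k
      simp only [Matrix.add_apply, transpose_apply, Matrix.zero_apply, one_apply_ne hjk, expZ_apply,
        if_neg hjk, if_neg hjk.symm] at this
      rw [show -(p.d k * u k) - p.d j * u j = -(p.d j * u j) - p.d k * u k by ring] at this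
      have h2 : (ζ j k + ζ k j) * Complex.exp (-(p.d j * u j) - p.d k * u k) = 0 := by
        linear_combination this
      linear_combination (mul_eq_zero.1 h2).resolve_right (Complex.exp_ne_zero _)
  · rintro ⟨hd, ho⟩
    ext j k
    simp only [Matrix.add_apply, transpose_apply, Matrix.zero_apply, expZ_apply]
    by_cases hjk : j = k
    · subst hjk
      simp only [if_true, one_apply_eq, hd]
      ring
    · rw [if_neg hjk, if_neg (Ne.symm hjk), one_apply_ne hjk, ho j k hjk,
        show -(p.d k * u k) - p.d j * u j = -(p.d j * u j) - p.d k * u k by ring]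
      ring

/-- The defect R₁ᵀR₁ - I solves a homogeneous linear system, so it vanishes everywhere once it
vanishes at one point. -/
theorem IsPetersonRiccati.isOrth (hU : IsOpen U) (hc : IsPreconnected U) {R₁ : Pt n → Mat n}
    (h : IsPetersonRiccati p U R₁) {u₀ : Pt n} (hu₀ : u₀ ∈ U) (h₀ : IsOrth (R₁ u₀)) :
    ∀ u ∈ U, IsOrth (R₁ u) := by
  have hT := h.hol.transpose
  have hδ (j : Fin n) : HolM U fun _ => E j * p.D := HolM.const _
  have hδ' (j : Fin n) : HolM U fun _ => p.D * E j := HolM.const _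
  intro u hu
  refine sub_eq_zero.1 (eq_zero_of_pdM_eq hU hc (Y := fun w => (R₁ w)ᵀ * R₁ w - 1)
    (P := fun j w => (R₁ w)ᵀ * (p.D * E j)) (Q := fun j w => E j * p.D * R₁ w)
    ((hT.mul h.hol).sub (HolM.const 1)) (fun j => hT.mul (hδ' j)) (fun j => (hδ j).mul h.hol)
    (fun w hw j => ?_) hu₀ (sub_eq_zero.2 h₀) u hu)
  rw [pdM_sub (hT.mul h.hol) (HolM.const 1) hw, pdM_mul hT h.hol hw, pdM_transpose, pdM_const,
    h.eqn w hw]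
  simp only [transpose_sub, transpose_mul, E_transpose, p.D_transpose]
  noncomm_ring

end ExplicitRiccati

end Peterson
namespace Peterson

variable {n : ℕ}

/-! ### Isometry forces orthonormality of the frame. -/

section FrameOfIsometry

variable {a α : Fin n → ℂ} {U : Set (Pt n)}

theorem pd_gram {ι : Type*} [Fintype ι] {f g : ι → Pt n → ℂ} {f₀ g₀ : Pt n → ℂ} {u : Pt n}
    (hf : ∀ l, DifferentiableAt ℂ (f l) u) (hg : ∀ l, DifferentiableAt ℂ (g l) u)
    (hf₀ : DifferentiableAt ℂ f₀ u) (hg₀ : DifferentiableAt ℂ g₀ u) (i : Fin n) :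
    pd i (fun w => ∑ l, f l w * g l w - f₀ w * g₀ w) u
      = ∑ l, (pd i (f l) u * g l u + f l u * pd i (g l) u)
        - (pd i f₀ u * g₀ u + f₀ u * pd i g₀ u) := by
  rw [pd_sub (DifferentiableAt.fun_sum fun l _ => (hf l).fun_mul (hg l)) (hf₀.fun_mul hg₀),
    pd_sum _ fun l _ => (hf l).fun_mul (hg l), pd_mul hf₀ hg₀]
  congr 1
  exact Finset.sum_congr rfl fun l _ => pd_mul (hf l) (hg l) i

theorem quadA_metric_single (hα : ∀ j, α j ^ 2 = (a j)⁻¹) (v : Pt n) (x y : ℂ) (j k : Fin n) :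
    quadricTangent α v (Pi.single j x) ⬝ᵥ quadricTangent α v (Pi.single k y)
      = ((if j = k then a j else 0) + v j * v k) * (x * y) := by
  rw [quadricTangent_dot hα, dotProduct_single, dotProduct_single, Finset.sum_eq_single j]
  · rw [Pi.single_eq_same, Pi.single_apply]
    split_ifs <;> ring
  · intro i _ hij
    rw [Pi.single_eq_of_ne hij]
    ring
  · simp

/-- If the frame `(V_l, Λ_l)` for `R = Iₙ` integrates to an isometric deformation, then it is
orthonormal. -/
theorem frameGram_of_isometric (ha : ∀ j, a j ≠ 0) (hα : ∀ j, α j ^ 2 = (a j)⁻¹) (hU : IsOpen U)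
    {S : Datum n} (hVL : IsLinearSolution a U (fun _ => 1) S.V S.L)
    (hL : ∀ u ∈ U, ∀ j, S.L u j ≠ 0)
    (hF : ∀ l, IsLinearSolution a U (fun _ => 1) (S.frameV l) (S.frameL l))
    (hdx : ∀ u ∈ U, ∀ (j : Fin n) l, pd j S.x u l = S.frameV l u ⬝ᵥ pd j S.V u)
    (hI : ∀ u ∈ U, ∀ j k : Fin n, pd j S.x u ⬝ᵥ pd k S.x u
      = pd j (fun w => quadricPoint α (S.V w)) u ⬝ᵥ pd k (fun w => quadricPoint α (S.V w)) u)
    {u : Pt n} (hu : u ∈ U) :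
    FrameGram a (fun l => S.frameV l u) (fun l => S.frameL l u) (S.V u) (S.L u) := by
  obtain ⟨aV, aL, dV, dL⟩ := isLinearSolution_one_iff.1 hVL
  have hF' := fun l => isLinearSolution_one_iff.1 (hF l)
  -- In the frame I both metrics carry the factor λ_jλ_k, which may be cancelled. Differentiating
  -- this relation in uᵏ gives `vm`, and differentiating that in uʲ gives `mm`.
  have vv : ∀ u ∈ U, ∀ j k, ∑ l, S.frameV l u j * S.frameV l u k - S.V u j * S.V u k
      = if j = k then a j else 0 := by
    intro u hu j k
    have h := hI u hu j k
    rw [pd_quadricPoint aV hu, pd_quadricPoint aV hu, dV u hu, dV u hu, quadA_metric_single hα,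
      dotProduct] at h
    simp only [hdx u hu, dV u hu, dotProduct_single] at h
    have h0 := mul_ne_zero (hL u hu j) (hL u hu k)
    refine mul_right_cancel₀ h0 ?_
    rw [sub_mul, Finset.sum_mul]
    have e : ∑ l, S.frameV l u j * S.frameV l u k * (S.L u j * S.L u k)
        = ∑ l, S.frameV l u j * S.L u j * (S.frameV l u k * S.L u k) :=
      Finset.sum_congr rfl fun l _ => by ring
    rw [e, h]
    ring
  have dVl : ∀ u ∈ U, ∀ l k, DifferentiableAt ℂ (fun w => S.frameV l w k) u := fun u hu l k =>
    (analyticOnNhd_apply (hF' l).1 k u hu).differentiableAt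
  have dLl : ∀ u ∈ U, ∀ l k, DifferentiableAt ℂ (fun w => S.frameL l w k) u := fun u hu l k =>
    (analyticOnNhd_apply (hF' l).2.1 k u hu).differentiableAt
  have dV0 : ∀ u ∈ U, ∀ k, DifferentiableAt ℂ (fun w => S.V w k) u := fun u hu k =>
    (analyticOnNhd_apply aV k u hu).differentiableAt
  have dL0 : ∀ u ∈ U, ∀ k, DifferentiableAt ℂ (fun w => S.L w k) u := fun u hu k =>
    (analyticOnNhd_apply aL k u hu).differentiableAt
  have pV : ∀ u ∈ U, ∀ l j k, pd j (fun w => S.frameV l w k) u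
      = if k = j then S.frameL l u j else 0 := fun u hu l j k => by
    rw [← pd_apply ((hF' l).1 u hu).differentiableAt, (hF' l).2.2.1 u hu, Pi.single_apply]
  have pL : ∀ u ∈ U, ∀ l j k, pd j (fun w => S.frameL l w k) u
      = if k = j then -((a j)⁻¹ * S.frameV l u j) else 0 := fun u hu l j k => by
    rw [← pd_apply ((hF' l).2.1 u hu).differentiableAt, (hF' l).2.2.2 u hu, Pi.neg_apply,
      Pi.single_apply]
    split_ifs <;> simp
  have pV0 : ∀ u ∈ U, ∀ j k, pd j (fun w => S.V w k) u
      = if k = j then S.L u j else 0 := fun u hu j k => by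
    rw [← pd_apply (aV u hu).differentiableAt, dV u hu, Pi.single_apply]
  have pL0 : ∀ u ∈ U, ∀ j k, pd j (fun w => S.L w k) u
      = if k = j then -((a j)⁻¹ * S.V u j) else 0 := fun u hu j k => by
    rw [← pd_apply (aL u hu).differentiableAt, dL u hu, Pi.neg_apply, Pi.single_apply]
    split_ifs <;> simp
  have vm : ∀ u ∈ U, ∀ j k, ∑ l, S.frameV l u j * S.frameL l u k - S.V u j * S.L u k = 0 := by
    intro u hu j k
    have h := pd_congr hU (fun w hw => vv w hw j k) hu k
    rw [pd_const, pd_gram (fun l => dVl u hu l j) (fun l => dVl u hu l k) (dV0 u hu j)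
      (dV0 u hu k)] at h
    simp only [pV u hu, pV0 u hu, if_true] at h
    split_ifs at h with hjk
    · subst hjk
      have e : ∑ l, (S.frameL l u j * S.frameV l u j + S.frameV l u j * S.frameL l u j)
          = 2 * ∑ l, S.frameV l u j * S.frameL l u j := by
        rw [Finset.mul_sum]
        exact Finset.sum_congr rfl fun l _ => by ring
      rw [e] at h
      linear_combination h / 2
    · simpa using h
  have mm : ∀ u ∈ U, ∀ j k, ∑ l, S.frameL l u j * S.frameL l u k - S.L u j * S.L u k
      = if j = k then 1 else 0 := by
    intro u hu j k
    have h := pd_congr hU (fun w hw => vm w hw j k) hu j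
    rw [pd_const, pd_gram (fun l => dVl u hu l j) (fun l => dLl u hu l k) (dV0 u hu j)
      (dL0 u hu k)] at h
    simp only [pV u hu, pV0 u hu, pL u hu, pL0 u hu, if_true] at h
    by_cases hjk : j = k
    · subst hjk
      have e : ∑ l, (S.frameL l u j * S.frameL l u j
            + S.frameV l u j * -((a j)⁻¹ * S.frameV l u j))
          = ∑ l, S.frameL l u j * S.frameL l u j
            - (a j)⁻¹ * ∑ l, S.frameV l u j * S.frameV l u j := by
        rw [Finset.mul_sum, ← Finset.sum_sub_distrib]
        exact Finset.sum_congr rfl fun l _ => by ring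
      have hv := vv u hu j j
      simp only [if_true] at h hv ⊢
      rw [e] at h
      linear_combination h + (a j)⁻¹ * hv + inv_mul_cancel₀ (ha j)
    · simp only [if_neg hjk, if_neg (Ne.symm hjk), mul_zero, add_zero] at h ⊢
      exact h
  exact ⟨vv u hu, vm u hu, mm u hu⟩

theorem card_add_one (hn : n ≠ 0) : Fintype.card (Fin (2 * n - 1)) + 1 = 2 * n := by
  rw [Fintype.card_fin]
  omega

theorem admissible_of_frameOrthonormal (hα : ∀ j, α j ^ 2 = (a j)⁻¹) {c : Constants n} {u : Pt n}
    (h : FrameOrthonormal a (fun l => expV α (c.f₁ l) (c.f₂ l) u)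
      (fun l => expL α (c.f₁ l) (c.f₂ l) u) (expV α c.c₁ c.c₂ u) (expL α c.c₁ c.c₂ u)) :
    c.Admissible a where
  frame_frame l m := (exp_invariant hα _ _ _ _ u).symm.trans (h.frame l m)
  frame_seed l := (exp_invariant hα _ _ _ _ u).symm.trans (h.seed l)
  seed_seed := (exp_invariant hα _ _ _ _ u).symm.trans h.prime

/-- Space realizations by frames of solutions for `R = Iₙ` are explicit. -/
theorem exists_agreeOn_petersonDatum (hn : n ≠ 0) (ha : ∀ j, a j ≠ 0)
    (hα : ∀ j, α j ^ 2 = (a j)⁻¹) (hU : IsOpen U) (hc : IsConnected U) {S : Datum n}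
    (hR : ∀ u ∈ U, S.R u = 1)
    (hVL : IsLinearSolution a U (fun _ => 1) S.V S.L)
    (hL : ∀ u ∈ U, ∀ j, S.L u j ≠ 0)
    (hF : ∀ l, IsLinearSolution a U (fun _ => 1) (S.frameV l) (S.frameL l))
    (hx : AnalyticOnNhd ℂ S.x U)
    (hdx : ∀ u ∈ U, ∀ (j : Fin n) l, pd j S.x u l = S.frameV l u ⬝ᵥ pd j S.V u)
    (hI : ∀ u ∈ U, ∀ j k : Fin n, pd j S.x u ⬝ᵥ pd k S.x u
      = pd j (fun w => quadricPoint α (S.V w)) u ⬝ᵥ pd k (fun w => quadricPoint α (S.V w)) u) :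
    ∃ c : Constants n, c.Admissible a ∧ S.AgreeOn U (petersonDatum α c) := by
  obtain ⟨b₁, b₂, hb⟩ := hVL.exists_exp ha hα hU hc
  choose f₁ f₂ hf using fun l => (hF l).exists_exp ha hα hU hc
  obtain ⟨u₀, hu₀⟩ := hc.nonempty
  let c₀ : Constants n := ⟨b₁, b₂, f₁, f₂, 0⟩
  -- The translation constants make the two realizations agree at u₀; equal derivatives do the rest.
  let c : Constants n := ⟨b₁, b₂, f₁, f₂, S.x u₀ - petersonX α c₀ u₀⟩
  have hxc : ∀ u, petersonX α c u = petersonX α c₀ u + (S.x u₀ - petersonX α c₀ u₀) := by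
    intro u
    ext l
    simp only [petersonX, Pi.add_apply, c, c₀, Pi.zero_apply, add_zero]
  have hg := (frameGram_iff_frameOrthonormal (card_add_one hn) ha).1
    (frameGram_of_isometric ha hα hU hVL hL hF hdx hI hu₀)
  rw [(hb u₀ hu₀).1, (hb u₀ hu₀).2, funext fun l => (hf l u₀ hu₀).1,
    funext fun l => (hf l u₀ hu₀).2] at hg
  refine ⟨c, admissible_of_frameOrthonormal hα hg, fun u hu => ⟨hR u hu, (hb u hu).1, (hb u hu).2,
    fun l => (hf l u hu).1, fun l => (hf l u hu).2, ?_⟩⟩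
  have hp : AnalyticOnNhd ℂ (petersonX α c) U := analyticOnNhd_petersonX c
  have := eq_of_pd_eq_zero (f := fun w => S.x w - petersonX α c w) hU hc.isPreconnected
    (fun w hw => (hx w hw).differentiableAt.fun_sub (hp w hw).differentiableAt)
    (fun w hw j => by
      rw [pd_sub (hx w hw).differentiableAt (hp w hw).differentiableAt]
      ext l
      rw [Pi.sub_apply, hdx w hw, pd_petersonX, (isLinearSolution_one_iff.1 hVL).2.2.1 w hw,
        dotProduct_single, (hf l w hw).1, (hb w hw).2]
      exact sub_self _) hu hu₀
  simp only [hxc] at this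
  show S.x u = petersonX α c u
  rw [hxc]
  rw [add_sub_cancel, sub_self] at this
  exact sub_eq_zero.1 this

end FrameOfIsometry

end Peterson
namespace Peterson

variable {n : ℕ}

/-! ### Functions of one coordinate on a ball. -/

section CoordinateCurves

variable {F : Type*} [NormedAddCommGroup F] [NormedSpace ℂ F] {U : Set (Pt n)}

theorem pd_pd_eq_zero [CompleteSpace F] (hU : IsOpen U) {f : Pt n → F} (hf : AnalyticOnNhd ℂ f U)
    {k : Fin n} (h : ∀ u ∈ U, pd k f u = 0) {u : Pt n} (hu : u ∈ U) (j : Fin n) :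
    pd k (pd j f) u = 0 := by
  rw [pd_comm (hf u hu), pd_congr hU h hu, pd_const]

/-- Balls of the sup norm are products of discs. -/
theorem update_mem_ball {u₀ u v : Pt n} {ε : ℝ} (hu : u ∈ Metric.ball u₀ ε)
    (hv : v ∈ Metric.ball u₀ ε) (j : Fin n) : Function.update u j (v j) ∈ Metric.ball u₀ ε := by
  have hε : 0 < ε := dist_nonneg.trans_lt (Metric.mem_ball.1 hu)
  rw [Metric.mem_ball, dist_pi_lt_iff hε] at hu hv ⊢
  intro k
  by_cases hk : k = j
  · subst hk
    rw [Function.update_self]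
    exact hv k
  · rw [Function.update_of_ne hk]
    exact hu k

/-- On a ball, a function all of whose partial derivatives but one vanish depends on one coordinate
only. -/
theorem eq_of_coord_eq {u₀ : Pt n} {ε : ℝ} {f : Pt n → F}
    (hf : ∀ u ∈ Metric.ball u₀ ε, DifferentiableAt ℂ f u) {j : Fin n}
    (h : ∀ u ∈ Metric.ball u₀ ε, ∀ k, k ≠ j → pd k f u = 0) {u v : Pt n}
    (hu : u ∈ Metric.ball u₀ ε) (hv : v ∈ Metric.ball u₀ ε) (huv : u j = v j) : f u = f v := by
  have hL : ∀ w : Pt n, HasFDerivAt (fun w : Pt n => w + (v j - w j) • Pi.single j (1 : ℂ))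
      (ContinuousLinearMap.id ℂ (Pt n)
        + (-ContinuousLinearMap.proj (R := ℂ) (φ := fun _ : Fin n => ℂ) j).smulRight
          (Pi.single j (1 : ℂ) : Pt n)) w := by
    intro w
    refine (hasFDerivAt_id w).add (HasFDerivAt.smul_const ?_ _)
    exact ((ContinuousLinearMap.proj (R := ℂ) (φ := fun _ : Fin n => ℂ) j).hasFDerivAt).const_sub _
  have hup : ∀ w : Pt n, w + (v j - w j) • Pi.single j (1 : ℂ) = Function.update w j (v j) := by
    intro w
    ext k
    by_cases hk : k = j
    · subst hk; simp
    · simp [hk]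
  have hd : ∀ w ∈ Metric.ball u₀ ε, HasFDerivAt
      (fun w : Pt n => f (w + (v j - w j) • Pi.single j (1 : ℂ))) _ w := fun w hw =>
    ((hf _ (by rw [hup]; exact update_mem_ball hw hv j)).hasFDerivAt).comp w (hL w)
  -- With the j-th coordinate frozen at v_j all partial derivatives vanish, so the composed function
  -- is constant; it equals f at u and at v.
  have := eq_of_pd_eq_zero Metric.isOpen_ball (convex_ball u₀ ε).isPreconnected
    (fun w hw => (hd w hw).differentiableAt) (fun w hw i => by
      rw [pd, (hd w hw).fderiv, ContinuousLinearMap.comp_apply, fderiv_eq_sum_pd]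
      refine Finset.sum_eq_zero fun k _ => ?_
      by_cases hk : k = j
      · subst hk
        rw [_root_.add_apply]
        simp
      · rw [h _ (by rw [hup]; exact update_mem_ball hw hv j) k hk, smul_zero]) hu hv
  simp only [hup] at this
  rwa [← huv, Function.update_eq_self, huv, Function.update_eq_self] at this

theorem pd_comp_coord {f : Pt n → F} {φ : Fin n → ℂ → ℂ} {u : Pt n}
    (hf : DifferentiableAt ℂ f fun k => φ k (u k)) (hφ : ∀ k, DifferentiableAt ℂ (φ k) (u k))
    (j : Fin n) :
    pd j (fun w => f fun k => φ k (w k)) u = deriv (φ j) (u j) • pd j f fun k => φ k (u k) := by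
  have hΦ : HasFDerivAt (fun w : Pt n => fun k => φ k (w k)) (ContinuousLinearMap.pi fun k =>
      deriv (φ k) (u k) • ContinuousLinearMap.proj (R := ℂ) (φ := fun _ : Fin n => ℂ) k) u := by
    rw [hasFDerivAt_pi]
    intro k
    exact (hφ k).hasDerivAt.comp_hasFDerivAt u
      (ContinuousLinearMap.proj (R := ℂ) (φ := fun _ : Fin n => ℂ) k).hasFDerivAt
  have hc : HasFDerivAt (fun w : Pt n => f fun k => φ k (w k)) _ u := hf.hasFDerivAt.comp u hΦ
  rw [pd, hc.fderiv, ContinuousLinearMap.comp_apply, pd, ← map_smul]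
  congr 1
  ext k
  by_cases hk : k = j
  · subst hk; simp
  · simp [hk]

end CoordinateCurves

/-! ### Orthogonal curves on quadrics are conics. -/

section Curves

variable {a α : Fin n → ℂ} {ι : Type*} [Fintype ι]

/-- Mutually orthogonal curves `(X_j, v_j)` on the quadrics `X·X - v² = a_j` lie in planes, so they
are conics and have exponential parametrizations. -/
theorem exists_exponential_coordinates (ha : ∀ j, a j ≠ 0) (hα : ∀ j, α j ^ 2 = (a j)⁻¹)
    {ε : ℝ} (hε : 0 < ε) {u₀ : Pt n} {v : Fin n → Pt n → ℂ} {X : Fin n → Pt n → ι → ℂ}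
    (hv : ∀ j, AnalyticOnNhd ℂ (v j) (Metric.ball u₀ ε))
    (hX : ∀ j, AnalyticOnNhd ℂ (X j) (Metric.ball u₀ ε))
    (hvk : ∀ j k, k ≠ j → ∀ u ∈ Metric.ball u₀ ε, pd k (v j) u = 0)
    (hXk : ∀ j k, k ≠ j → ∀ u ∈ Metric.ball u₀ ε, pd k (X j) u = 0)
    (hG : ∀ u ∈ Metric.ball u₀ ε, ∀ j k,
      X j u ⬝ᵥ X k u - v j u * v k u = if j = k then a j else 0)
    (hm : ∀ j, pd j (v j) u₀ ≠ 0)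
    (hnd : ∀ (N : ι → ℂ) (ν : ℂ), (∀ j, N ⬝ᵥ X j u₀ - ν * v j u₀ = 0) →
      (∀ j, N ⬝ᵥ pd j (X j) u₀ - ν * pd j (v j) u₀ = 0) → N = 0 ∧ ν = 0) :
    ∃ ε' : ℝ, 0 < ε' ∧ ε' ≤ ε ∧ ∃ (φ : Fin n → ℂ → ℂ) (b₁ b₂ : Fin n → ℂ)
      (f₁ f₂ : ι → Fin n → ℂ),
      FrameGram a (fun l => expV α (f₁ l) (f₂ l) 0) (fun l => expL α (f₁ l) (f₂ l) 0)
        (expV α b₁ b₂ 0) (expL α b₁ b₂ 0) ∧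
      ∀ u ∈ Metric.ball u₀ ε', ∀ j, AnalyticAt ℂ (φ j) (u j) ∧
        v j u = expV α b₁ b₂ (fun k => φ k (u k)) j ∧
        ∀ l, X j u l = expV α (f₁ l) (f₂ l) (fun k => φ k (u k)) j := by
  have hB : IsOpen (Metric.ball u₀ ε) := Metric.isOpen_ball
  have h₀ : u₀ ∈ Metric.ball u₀ ε := Metric.mem_ball_self hε
  have dv : ∀ j, ∀ u ∈ Metric.ball u₀ ε, DifferentiableAt ℂ (v j) u := fun j u hu =>
    (hv j u hu).differentiableAt
  have dX : ∀ j, ∀ u ∈ Metric.ball u₀ ε, DifferentiableAt ℂ (X j) u := fun j u hu =>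
    (hX j u hu).differentiableAt
  have av' := fun j => analyticOnNhd_pd (hv j) j
  have aX' := fun j => analyticOnNhd_pd (hX j) j
  have dv' : ∀ j, ∀ u ∈ Metric.ball u₀ ε, DifferentiableAt ℂ (pd j (v j)) u := fun j u hu =>
    (av' j u hu).differentiableAt
  have dX' : ∀ j, ∀ u ∈ Metric.ball u₀ ε, DifferentiableAt ℂ (pd j (X j)) u := fun j u hu =>
    (aX' j u hu).differentiableAt
  have hvk' : ∀ j k, k ≠ j → ∀ u ∈ Metric.ball u₀ ε, pd k (pd j (v j)) u = 0 :=
    fun j k hk u hu => pd_pd_eq_zero hB (hv j) (hvk j k hk) hu j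
  have hXk' : ∀ j k, k ≠ j → ∀ u ∈ Metric.ball u₀ ε, pd k (pd j (X j)) u = 0 :=
    fun j k hk u hu => pd_pd_eq_zero hB (hX j) (hXk j k hk) hu j
  have hG1 : ∀ u ∈ Metric.ball u₀ ε, ∀ j k,
      X j u ⬝ᵥ pd k (X k) u - v j u * pd k (v k) u = 0 := by
    intro u hu j k
    have h := pd_congr hB (fun w hw => hG w hw j k) hu k
    rw [pd_const, pd_sub ((analyticOnNhd_dotProduct (hX j) (hX k)) u hu).differentiableAt
      ((dv j u hu).fun_mul (dv k u hu)), pd_dotProduct (dX j u hu) (dX k u hu),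
      pd_mul (dv j u hu) (dv k u hu)] at h
    by_cases hjk : k = j
    · subst hjk
      rw [dotProduct_comm (pd k (X k) u)] at h
      linear_combination h / 2
    · rw [hXk j k hjk u hu, hvk j k hjk u hu, zero_dotProduct] at h
      linear_combination h
  have hG2 : ∀ u ∈ Metric.ball u₀ ε, ∀ j k, j ≠ k →
      pd j (X j) u ⬝ᵥ pd k (X k) u - pd j (v j) u * pd k (v k) u = 0 := by
    intro u hu j k hjk
    have h := pd_congr hB (fun w hw => hG1 w hw j k) hu j
    rw [pd_const, pd_sub ((analyticOnNhd_dotProduct (hX j) (aX' k)) u hu).differentiableAt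
      ((dv j u hu).fun_mul (dv' k u hu)), pd_dotProduct (dX j u hu) (dX' k u hu),
      pd_mul (dv j u hu) (dv' k u hu), hXk' k j hjk u hu, hvk' k j hjk u hu, dotProduct_zero] at h
    linear_combination h
  -- The square of the velocity at u₀. If it were zero, the velocity would be orthogonal to all
  -- positions and velocities, hence zero by `hnd`, against `hm`.
  let q : Fin n → ℂ := fun j => pd j (X j) u₀ ⬝ᵥ pd j (X j) u₀ - pd j (v j) u₀ * pd j (v j) u₀
  have hq : ∀ j, q j ≠ 0 := by
    intro j hj
    refine hm j (hnd (pd j (X j) u₀) (pd j (v j) u₀) (fun k => ?_) fun k => ?_).2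
    · rw [dotProduct_comm, mul_comm]
      exact hG1 u₀ h₀ k j
    · by_cases hjk : j = k
      · subst hjk
        exact hj
      · exact hG2 u₀ h₀ j k hjk
  choose ρ hρ using fun j => IsAlgClosed.exists_pow_nat_eq (q j / a j) zero_lt_two
  have hρ0 : ∀ j, ρ j ≠ 0 := by
    intro j hj
    have := hρ j
    rw [hj, zero_pow two_ne_zero] at this
    exact div_ne_zero (hq j) (ha j) this.symm
  have hρa : ∀ j, ρ j ^ 2 * a j = q j := fun j => by rw [hρ, div_mul_cancel₀ _ (ha j)]
  -- P and r are the coordinates of the j-th curve along its position and its velocity at u₀.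
  let P : Fin n → Pt n → ℂ := fun j u => (X j u ⬝ᵥ X j u₀ - v j u * v j u₀) / a j
  let r : Fin n → Pt n → ℂ := fun j u =>
    (X j u ⬝ᵥ pd j (X j) u₀ - v j u * pd j (v j) u₀) / q j
  have hPa : ∀ j u, P j u * a j = X j u ⬝ᵥ X j u₀ - v j u * v j u₀ := fun j u =>
    div_mul_cancel₀ _ (ha j)
  have hrq : ∀ j u, r j u * q j = X j u ⬝ᵥ pd j (X j) u₀ - v j u * pd j (v j) u₀ := fun j u =>
    div_mul_cancel₀ _ (hq j)
  -- The j-th curve at u and the k-th curve at u₀ are both evaluated at the point whose j-th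
  -- coordinate is u_j and whose others are those of u₀; there the orthogonality relations apply.
  have cross : ∀ u ∈ Metric.ball u₀ ε, ∀ j k, k ≠ j →
      X j u ⬝ᵥ X k u₀ - v j u * v k u₀ = 0 ∧
      X j u ⬝ᵥ pd k (X k) u₀ - v j u * pd k (v k) u₀ = 0 := by
    intro u hu j k hk
    have hw := update_mem_ball h₀ hu j
    have hj : u j = Function.update u₀ j (u j) j := by rw [Function.update_self]
    have hk' : u₀ k = Function.update u₀ j (u j) k := by rw [Function.update_of_ne hk]
    rw [eq_of_coord_eq (dX j) (fun u hu k hk => hXk j k hk u hu) hu hw hj,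
      eq_of_coord_eq (dv j) (fun u hu k hk => hvk j k hk u hu) hu hw hj,
      eq_of_coord_eq (dX k) (fun u hu i hi => hXk k i hi u hu) h₀ hw hk',
      eq_of_coord_eq (dv k) (fun u hu i hi => hvk k i hi u hu) h₀ hw hk',
      eq_of_coord_eq (dX' k) (fun u hu i hi => hXk' k i hi u hu) h₀ hw hk',
      eq_of_coord_eq (dv' k) (fun u hu i hi => hvk' k i hi u hu) h₀ hw hk']
    exact ⟨(hG _ hw j k).trans (if_neg (Ne.symm hk)), hG1 _ hw j k⟩
  -- The remainder after projection to the plane is orthogonal to the spanning set of `hnd`, so the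
  -- curve is planar.
  have expand : ∀ u ∈ Metric.ball u₀ ε, ∀ j,
      X j u - P j u • X j u₀ - r j u • pd j (X j) u₀ = 0 ∧
      v j u - P j u * v j u₀ - r j u * pd j (v j) u₀ = 0 := by
    intro u hu j
    have g0 := hG u₀ h₀
    have g1 := hG1 u₀ h₀
    have g2 := hG2 u₀ h₀
    refine hnd _ _ (fun k => ?_) fun k => ?_
    · have e := g1 k j
      rw [dotProduct_comm] at e
      rw [sub_dotProduct, sub_dotProduct, smul_dotProduct, smul_dotProduct, smul_eq_mul,
        smul_eq_mul]
      by_cases hk : k = j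
      · subst hk
        have g := g0 k k
        rw [if_pos rfl] at g
        linear_combination -(hPa k u) - P k u * g - r k u * e
      · have g := g0 j k
        rw [if_neg (Ne.symm hk)] at g
        linear_combination (cross u hu j k hk).1 - P j u * g - r j u * e
    · rw [sub_dotProduct, sub_dotProduct, smul_dotProduct, smul_dotProduct, smul_eq_mul,
        smul_eq_mul]
      by_cases hk : k = j
      · subst hk
        linear_combination -(hrq k u) - P k u * g1 k k
      · linear_combination (cross u hu j k hk).2 - P j u * g1 j k - r j u * g2 j k (Ne.symm hk)
  have conic : ∀ u ∈ Metric.ball u₀ ε, ∀ j, P j u ^ 2 + ρ j ^ 2 * r j u ^ 2 = 1 := by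
    intro u hu j
    have g := hG u hu j j
    rw [if_pos rfl] at g
    have e1 : X j u ⬝ᵥ X j u = P j u * (X j u ⬝ᵥ X j u₀) + r j u * (X j u ⬝ᵥ pd j (X j) u₀) := by
      have := congrArg (X j u ⬝ᵥ ·) (expand u hu j).1
      simp only [dotProduct_sub, dotProduct_smul, smul_eq_mul, dotProduct_zero] at this
      linear_combination this
    refine mul_right_cancel₀ (ha j) ?_
    linear_combination r j u ^ 2 * hρa j + P j u * hPa j u + r j u * hrq j u - e1 + g
      + v j u * (expand u hu j).2
  -- The conic P² + ρ²r² = 1 factors as h·(P - iρr) = 1, so h serves as the exponential parameter.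
  let h : Fin n → Pt n → ℂ := fun j u => P j u + Complex.I * ρ j * r j u
  have hh : ∀ u ∈ Metric.ball u₀ ε, ∀ j, h j u * (P j u - Complex.I * ρ j * r j u) = 1 := by
    intro u hu j
    linear_combination conic u hu j - (ρ j * r j u) ^ 2 * Complex.I_mul_I
  have hol : ∀ j, AnalyticOnNhd ℂ (h j) (Metric.ball u₀ ε) := by
    intro j u hu
    have e1 : ∀ y : ι → ℂ, AnalyticAt ℂ (fun w => X j w ⬝ᵥ y) u := fun y =>
      analyticOnNhd_dotProduct (hX j) (fun _ _ => analyticAt_const) u hu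
    exact (((e1 _).sub ((hv j u hu).mul analyticAt_const)).div analyticAt_const (ha j)).add
      (analyticAt_const.mul (((e1 _).sub ((hv j u hu).mul analyticAt_const)).div analyticAt_const
        (hq j)))
  have hone : ∀ j, h j u₀ = 1 := by
    intro j
    have e1 : P j u₀ = 1 := by
      have g := hG u₀ h₀ j j
      rw [if_pos rfl] at g
      show (X j u₀ ⬝ᵥ X j u₀ - v j u₀ * v j u₀) / a j = 1
      rw [g, div_self (ha j)]
    have e2 : r j u₀ = 0 := by
      show (X j u₀ ⬝ᵥ pd j (X j) u₀ - v j u₀ * pd j (v j) u₀) / q j = 0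
      rw [hG1 u₀ h₀ j j, zero_div]
    show P j u₀ + Complex.I * ρ j * r j u₀ = 1
    rw [e1, e2, mul_zero, add_zero]
  -- Since h = 1 at u₀, the principal logarithm is holomorphic along h on a smaller ball.
  have hslit : ∀ᶠ u in nhds u₀, ∀ j, h j u ∈ Complex.slitPlane := by
    rw [Filter.eventually_all]
    intro j
    refine (hol j u₀ h₀).continuousAt.eventually_mem (Complex.isOpen_slitPlane.mem_nhds ?_)
    rw [hone]
    exact Complex.one_mem_slitPlane
  obtain ⟨ε₁, hε₁, hs⟩ := Metric.eventually_nhds_iff_ball.1 hslit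
  have hsub : Metric.ball u₀ (min ε ε₁) ⊆ Metric.ball u₀ ε := Metric.ball_subset_ball (min_le_left _ _)
  have hdep : ∀ u ∈ Metric.ball u₀ ε, ∀ j, h j (Function.update u₀ j (u j)) = h j u := by
    intro u hu j
    have hj : Function.update u₀ j (u j) j = u j := by rw [Function.update_self]
    have hw := update_mem_ball h₀ hu j
    simp only [h, P, r]
    rw [eq_of_coord_eq (dX j) (fun u hu k hk => hXk j k hk u hu) hw hu hj,
      eq_of_coord_eq (dv j) (fun u hu k hk => hvk j k hk u hu) hw hu hj]
  -- The new coordinate is chosen so that exp(iα_jφ_j) = h. The constants come from writing P x + r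
  -- y, for a position x and a velocity y at u₀, as a combination of h and h⁻¹.
  refine ⟨min ε ε₁, lt_min hε hε₁, min_le_left _ _,
    fun j z => Complex.log (h j (Function.update u₀ j z)) / (Complex.I * α j),
    fun j => (v j u₀ + pd j (v j) u₀ / (Complex.I * ρ j)) / 2,
    fun j => (v j u₀ - pd j (v j) u₀ / (Complex.I * ρ j)) / 2,
    fun l j => (X j u₀ l + pd j (X j) u₀ l / (Complex.I * ρ j)) / 2,
    fun l j => (X j u₀ l - pd j (X j) u₀ l / (Complex.I * ρ j)) / 2, ?_, fun u hu j => ?_⟩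
  -- At parameter 0 the exponential data are the position at u₀ and α_j/ρ_j times the velocity; this
  -- factor gives the velocity square 1.
  · have eV : ∀ (x y : Fin n → ℂ), expV α (fun j => (x j + y j / (Complex.I * ρ j)) / 2)
        (fun j => (x j - y j / (Complex.I * ρ j)) / 2) 0 = x := by
      intro x y
      ext j
      simp only [expV, Pi.zero_apply, mul_zero, neg_zero, Complex.exp_zero]
      ring
    have eL : ∀ (x y : Fin n → ℂ), expL α (fun j => (x j + y j / (Complex.I * ρ j)) / 2)
        (fun j => (x j - y j / (Complex.I * ρ j)) / 2) 0 = fun j => α j / ρ j * y j := by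
      intro x y
      ext j
      simp only [expL, Pi.zero_apply, mul_zero, neg_zero, Complex.exp_zero]
      have := hρ0 j
      field_simp
      ring
    simp only [eV, eL]
    refine ⟨fun j k => hG u₀ h₀ j k, fun j k => ?_, fun j k => ?_⟩
    · have e := hG1 u₀ h₀ j k
      rw [dotProduct] at e
      have e2 : ∑ l, X j u₀ l * (α k / ρ k * pd k (X k) u₀ l)
          = α k / ρ k * ∑ l, X j u₀ l * pd k (X k) u₀ l := by
        rw [Finset.mul_sum]
        exact Finset.sum_congr rfl fun l _ => by ring
      rw [e2]
      linear_combination α k / ρ k * e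
    · have e2 : ∑ l, α j / ρ j * pd j (X j) u₀ l * (α k / ρ k * pd k (X k) u₀ l)
          = α j / ρ j * (α k / ρ k) * (pd j (X j) u₀ ⬝ᵥ pd k (X k) u₀) := by
        rw [dotProduct, Finset.mul_sum]
        exact Finset.sum_congr rfl fun l _ => by ring
      rw [e2]
      split_ifs with hjk
      · subst hjk
        have e3 : pd j (X j) u₀ ⬝ᵥ pd j (X j) u₀ - pd j (v j) u₀ * pd j (v j) u₀ = ρ j ^ 2 * a j :=
          (hρa j).symm
        have e4 : (α j / ρ j) ^ 2 * (ρ j ^ 2 * a j) = 1 := by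
          have := hρ0 j
          rw [div_pow, hα]
          have := ha j
          field_simp
        linear_combination (α j / ρ j) ^ 2 * e3 + e4
      · linear_combination α j / ρ j * (α k / ρ k) * hG2 u₀ h₀ j k hjk
  · have huε := hsub hu
    have hα0 : Complex.I * α j ≠ 0 := mul_ne_zero Complex.I_ne_zero (alpha_ne_zero ha hα j)
    have hsl : h j u ∈ Complex.slitPlane := hs u (Metric.ball_subset_ball (min_le_right _ _) hu) j
    have hne : h j u ≠ 0 := Complex.slitPlane_ne_zero hsl
    have hexp : Complex.exp (Complex.I * α j
        * (Complex.log (h j (Function.update u₀ j (u j))) / (Complex.I * α j))) = h j u := by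
      rw [mul_div_cancel₀ _ hα0, hdep u huε, Complex.exp_log hne]
    have hexp' : Complex.exp (-(Complex.I * α j
        * (Complex.log (h j (Function.update u₀ j (u j))) / (Complex.I * α j))))
        = P j u - Complex.I * ρ j * r j u := by
      rw [Complex.exp_neg, hexp]
      exact inv_eq_of_mul_eq_one_right (hh u huε j)
    have hval : ∀ x y : ℂ, (x + y / (Complex.I * ρ j)) / 2 * h j u
        + (x - y / (Complex.I * ρ j)) / 2 * (P j u - Complex.I * ρ j * r j u)
        = P j u * x + r j u * y := by
      intro x y
      have := hρ0 j
      have hI := Complex.I_ne_zero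
      simp only [h]
      field_simp
      ring
    refine ⟨?_, ?_, fun l => ?_⟩
    · have hup : AnalyticAt ℂ (fun z : ℂ => Function.update u₀ j z) (u j) := by
        rw [analyticAt_pi_iff]
        intro k
        by_cases hk : k = j
        · subst hk
          simp only [Function.update_self]
          exact analyticAt_id
        · simp only [Function.update_of_ne hk]
          exact analyticAt_const
      have hc : AnalyticAt ℂ (fun z : ℂ => h j (Function.update u₀ j z)) (u j) :=
        (hol j _ (update_mem_ball h₀ huε j)).fun_comp hup
      refine (hc.clog ?_).div analyticAt_const hα0
      rw [hdep u huε]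
      exact hsl
    · rw [expV, hexp, hexp', hval]
      linear_combination (expand u huε j).2
    · rw [expV, hexp, hexp', hval]
      have := congrFun (expand u huε j).1 l
      simp only [Pi.sub_apply, Pi.smul_apply, smul_eq_mul, Pi.zero_apply] at this
      linear_combination this

end Curves

end Peterson
namespace Peterson

variable {n : ℕ}

/-! ### Christoffel symbols of isometric submanifolds. -/

section Christoffel

variable {U : Set (Pt n)} {ι κ : Type*} [Fintype ι] [Fintype κ]

/-- The Christoffel symbols of the first kind. -/
theorem two_mul_christoffel {f : Pt n → ι → ℂ} (hf : AnalyticOnNhd ℂ f U) {u : Pt n} (hu : u ∈ U)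
    (i j k : Fin n) :
    2 * (pd j (pd k f) u ⬝ᵥ pd i f u) = pd j (fun w => pd k f w ⬝ᵥ pd i f w) u
      + pd k (fun w => pd j f w ⬝ᵥ pd i f w) u - pd i (fun w => pd j f w ⬝ᵥ pd k f w) u := by
  have hd (j : Fin n) := (analyticOnNhd_pd hf j u hu).differentiableAt
  rw [pd_dotProduct (hd k) (hd i), pd_dotProduct (hd j) (hd i), pd_dotProduct (hd j) (hd k),
    pd_comm (hf u hu) k j, pd_comm (hf u hu) i j, pd_comm (hf u hu) i k,
    dotProduct_comm (pd j (pd i f) u)]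
  ring

/-- Christoffel symbols of the first kind are determined by the metric, even when the ambient spaces
differ. -/
theorem christoffel_eq (hU : IsOpen U) {f : Pt n → ι → ℂ} {g : Pt n → κ → ℂ}
    (hf : AnalyticOnNhd ℂ f U) (hg : AnalyticOnNhd ℂ g U)
    (h : ∀ u ∈ U, ∀ j k, pd j f u ⬝ᵥ pd k f u = pd j g u ⬝ᵥ pd k g u) {u : Pt n} (hu : u ∈ U)
    (i j k : Fin n) :
    pd j (pd k f) u ⬝ᵥ pd i f u = pd j (pd k g) u ⬝ᵥ pd i g u := by
  refine mul_left_cancel₀ (two_ne_zero (α := ℂ)) ?_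
  rw [two_mul_christoffel hf hu, two_mul_christoffel hg hu, pd_congr hU (fun w hw => h w hw k i) hu,
    pd_congr hU (fun w hw => h w hw j i) hu, pd_congr hU (fun w hw => h w hw j k) hu]

theorem eq_zero_of_mem_span_of_dotProduct {w : Fin n → ι → ℂ} {y : ι → ℂ}
    (hy : y ∈ Submodule.span ℂ (Set.range w)) (hdet : (Matrix.of fun j k => w j ⬝ᵥ w k).det ≠ 0)
    (h : ∀ i, y ⬝ᵥ w i = 0) : y = 0 := by
  obtain ⟨c, rfl⟩ := (Submodule.mem_span_range_iff_exists_fun ℂ).1 hy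
  have : c ᵥ* (Matrix.of fun j k => w j ⬝ᵥ w k) = 0 := by
    ext i
    have := h i
    rw [sum_dotProduct] at this
    simpa [vecMul, dotProduct, Finset.mul_sum, mul_assoc] using this
  rw [Matrix.eq_zero_of_vecMul_eq_zero hdet this]
  simp

end Christoffel

/-! ### Local classification of Peterson deformations. -/

section PetersonDeformation

variable {a α : Fin n → ℂ} {U : Set (Pt n)} {V : Pt n → Pt n} {x : Pt n → (Fin (2 * n - 1) → ℂ)}

theorem IsPeterson.pd_coord_eq_zero (h : IsPeterson α U V x) {j k : Fin n} (hk : k ≠ j) {u : Pt n}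
    (hu : u ∈ U) : pd k (fun w => V w j) u = 0 := by
  rw [← pd_apply (h.hol_V u hu).differentiableAt]
  exact h.frame_one u hu k j hk.symm

theorem IsPeterson.pd_V (h : IsPeterson α U V x) {u : Pt n} (hu : u ∈ U) (j : Fin n) :
    pd j V u = Pi.single j (pd j (fun w => V w j) u) := by
  ext k
  by_cases hk : k = j
  · subst hk
    rw [Pi.single_eq_same, pd_apply (h.hol_V u hu).differentiableAt]
  · rw [Pi.single_eq_of_ne hk, h.frame_one u hu j k hk]

theorem IsPeterson.metric (hα : ∀ j, α j ^ 2 = (a j)⁻¹) (h : IsPeterson α U V x) {u : Pt n}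
    (hu : u ∈ U) (j k : Fin n) :
    pd j (fun w => quadricPoint α (V w)) u ⬝ᵥ pd k (fun w => quadricPoint α (V w)) u
      = ((if j = k then a j else 0) + V u j * V u k)
        * (pd j (fun w => V w j) u * pd k (fun w => V w k) u) := by
  rw [pd_quadricPoint h.hol_V hu, pd_quadricPoint h.hol_V hu, h.pd_V hu, h.pd_V hu,
    quadA_metric_single hα]

theorem IsPeterson.pd_ne_zero (hα : ∀ j, α j ^ 2 = (a j)⁻¹) (h : IsPeterson α U V x) {u : Pt n}
    (hu : u ∈ U) (j : Fin n) : pd j (fun w => V w j) u ≠ 0 := by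
  intro h0
  refine h.metric_nondegenerate u hu (Matrix.det_eq_zero_of_row_eq_zero j fun k => ?_)
  rw [Matrix.of_apply, h.metric hα hu, h0, zero_mul, mul_zero]

/-- If 1 + VᵀAV were zero, A⁻¹ + VVᵀ would annihilate AV; dividing its entries by the ∂_kvᵏ gives a
kernel vector of the metric, nonzero because V ≠ 0. -/
theorem IsPeterson.sigma_ne_zero (ha : ∀ j, a j ≠ 0) (hα : ∀ j, α j ^ 2 = (a j)⁻¹)
    (h : IsPeterson α U V x) {u : Pt n} (hu : u ∈ U) : 1 + ∑ k, (a k)⁻¹ * (V u k * V u k) ≠ 0 := by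
  intro h0
  have hm := h.pd_ne_zero hα hu
  have hV : V u ≠ 0 := by
    intro hV
    simp [hV] at h0
  refine h.metric_nondegenerate u hu (Matrix.exists_mulVec_eq_zero_iff.1
    ⟨fun k => (a k)⁻¹ * V u k / pd k (fun w => V w k) u, ?_, ?_⟩)
  · intro hz
    refine hV (funext fun k => ?_)
    have := congrFun hz k
    simp only [Pi.zero_apply, div_eq_zero_iff, mul_eq_zero, inv_eq_zero] at this
    exact (this.resolve_right (hm k)).resolve_left (ha k)
  · ext j
    simp only [mulVec, dotProduct, Matrix.of_apply, Pi.zero_apply]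
    have e : ∀ k, (∑ i, pd j (fun w => quadricPoint α (V w)) u i
          * pd k (fun w => quadricPoint α (V w)) u i)
          * ((a k)⁻¹ * V u k / pd k (fun w => V w k) u)
        = pd j (fun w => V w j) u * ((if j = k then V u k else 0)
          + V u j * ((a k)⁻¹ * (V u k * V u k))) := by
      intro k
      have := h.metric hα hu j k
      rw [dotProduct] at this
      rw [this]
      have h1 := hm k
      have h2 := ha k
      split_ifs with hjk
      · subst hjk; field_simp
      · field_simp; ring
    simp only [e]
    rw [← Finset.mul_sum, Finset.sum_add_distrib, ← Finset.mul_sum, Finset.sum_ite_eq,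
      if_pos (Finset.mem_univ _)]
    linear_combination pd j (fun w => V w j) u * V u j * h0

theorem IsPeterson.pd_pd_V (hU : IsOpen U) (h : IsPeterson α U V x) {u : Pt n} (hu : u ∈ U)
    {j k : Fin n} (hjk : j ≠ k) : pd j (pd k V) u = 0 := by
  ext i
  rw [pd_apply (analyticOnNhd_pd h.hol_V k u hu).differentiableAt, Pi.zero_apply]
  have e : ∀ w ∈ U, pd k V w i = pd k (fun w => V w i) w := fun w hw =>
    pd_apply (h.hol_V w hw).differentiableAt k i
  rw [pd_congr hU e hu]
  have hi := analyticOnNhd_apply h.hol_V i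
  by_cases hki : k = i
  · subst hki
    exact pd_pd_eq_zero hU hi (fun w hw => h.pd_coord_eq_zero hjk hw) hu k
  · rw [pd_congr hU (fun w hw => h.pd_coord_eq_zero hki hw) hu, pd_const]

theorem IsPeterson.pd_pd_quadricPoint (hU : IsOpen U) (h : IsPeterson α U V x) {u : Pt n}
    (hu : u ∈ U) {j k : Fin n} (hjk : j ≠ k) :
    pd j (pd k fun w => quadricPoint α (V w)) u = 0 := by
  rw [Peterson.pd_pd_quadricPoint hU h.hol_V hu, h.pd_pd_V hU hu hjk, h.pd_V hu, h.pd_V hu,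
    dotProduct_single, Pi.single_eq_of_ne hjk.symm, zero_mul]
  ext i
  refine Fin.lastCases ?_ (fun i => ?_) i <;> simp [quadricTangent]

/-- Conjugacy makes the mixed derivative tangent, and its tangential components are intrinsic. They
agree with those of x₀∘V, whose mixed derivative is zero. -/
theorem IsPeterson.pd_pd_x (hU : IsOpen U) (h : IsPeterson α U V x) {u : Pt n} (hu : u ∈ U)
    {j k : Fin n} (hjk : j ≠ k) : pd j (pd k x) u = 0 := by
  refine eq_zero_of_mem_span_of_dotProduct (h.conjugate u hu j k hjk) ?_ fun i => ?_
  · have := h.metric_nondegenerate u hu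
    simp only [← h.isometric u hu] at this
    exact this
  · rw [christoffel_eq hU h.hol_x (analyticOnNhd_quadricPoint h.hol_V) h.isometric hu,
      h.pd_pd_quadricPoint hU hu hjk, zero_dotProduct]

/-- The derivative of `x` with respect to `vʲ`. -/
noncomputable def coordTangent (V : Pt n → Pt n) (x : Pt n → (Fin (2 * n - 1) → ℂ)) (j : Fin n)
    (u : Pt n) : Fin (2 * n - 1) → ℂ :=
  (pd j (fun w => V w j) u)⁻¹ • pd j x u

theorem IsPeterson.analyticOnNhd_coordTangent (hα : ∀ j, α j ^ 2 = (a j)⁻¹)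
    (h : IsPeterson α U V x) (j : Fin n) : AnalyticOnNhd ℂ (coordTangent V x j) U := fun u hu =>
  ((analyticOnNhd_pd (analyticOnNhd_apply h.hol_V j) j u hu).inv (h.pd_ne_zero hα hu j)).smul
    (analyticOnNhd_pd h.hol_x j u hu)

theorem IsPeterson.pd_x (hα : ∀ j, α j ^ 2 = (a j)⁻¹) (h : IsPeterson α U V x) {u : Pt n}
    (hu : u ∈ U) (j : Fin n) : pd j x u = pd j (fun w => V w j) u • coordTangent V x j u := by
  rw [coordTangent, smul_smul, mul_inv_cancel₀ (h.pd_ne_zero hα hu j), one_smul]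

theorem pd_smul' {F : Type*} [NormedAddCommGroup F] [NormedSpace ℂ F] {c : Pt n → ℂ} {f : Pt n → F}
    {u : Pt n} (hc : DifferentiableAt ℂ c u) (hf : DifferentiableAt ℂ f u) (j : Fin n) :
    pd j (fun w => c w • f w) u = pd j c u • f u + c u • pd j f u := by
  rw [pd, fderiv_fun_smul hc hf]
  simp [pd, add_comm]

theorem IsPeterson.pd_pd_x_eq (hU : IsOpen U) (hα : ∀ j, α j ^ 2 = (a j)⁻¹)
    (h : IsPeterson α U V x) {u : Pt n} (hu : u ∈ U) (j k : Fin n) :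
    pd k (pd j x) u = pd k (pd j fun w => V w j) u • coordTangent V x j u
      + pd j (fun w => V w j) u • pd k (coordTangent V x j) u := by
  rw [pd_congr hU (fun w hw => h.pd_x hα hw j) hu,
    pd_smul' (analyticOnNhd_pd (analyticOnNhd_apply h.hol_V j) j u hu).differentiableAt
      (h.analyticOnNhd_coordTangent hα j u hu).differentiableAt]

theorem IsPeterson.pd_coordTangent (hU : IsOpen U) (hα : ∀ j, α j ^ 2 = (a j)⁻¹)
    (h : IsPeterson α U V x) {j k : Fin n} (hk : k ≠ j) {u : Pt n} (hu : u ∈ U) :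
    pd k (coordTangent V x j) u = 0 := by
  have e := h.pd_pd_x_eq hU hα hu j k
  rw [h.pd_pd_x hU hu hk, pd_pd_eq_zero hU (analyticOnNhd_apply h.hol_V j)
    (fun w hw => h.pd_coord_eq_zero hk hw) hu, zero_smul, zero_add] at e
  exact (smul_eq_zero.1 e.symm).resolve_left (h.pd_ne_zero hα hu j)

theorem IsPeterson.coordTangent_dot (hα : ∀ j, α j ^ 2 = (a j)⁻¹) (h : IsPeterson α U V x)
    {u : Pt n} (hu : u ∈ U) (j k : Fin n) :
    coordTangent V x j u ⬝ᵥ coordTangent V x k u - V u j * V u k = if j = k then a j else 0 := by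
  rw [coordTangent, coordTangent, smul_dotProduct, dotProduct_smul, h.isometric u hu,
    h.metric hα hu, smul_eq_mul, smul_eq_mul]
  have h1 := mul_inv_cancel₀ (h.pd_ne_zero hα hu j)
  have h2 := mul_inv_cancel₀ (h.pd_ne_zero hα hu k)
  set m := pd j (fun w => V w j) u
  set m' := pd k (fun w => V w k) u
  linear_combination ((if j = k then a j else 0) + V u j * V u k) * (m' * m'⁻¹ * h1 + h2)

theorem sum_mul_ite_add {V : Fin n → ℂ} (j : Fin n) (ha : ∀ j, a j ≠ 0) :
    ∑ k, (a k)⁻¹ * V k * ((if k = j then a k else 0) + V k * V j)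
      = V j * (1 + ∑ k, (a k)⁻¹ * (V k * V k)) := by
  have e : ∀ k, (a k)⁻¹ * V k * ((if k = j then a k else 0) + V k * V j)
      = (if k = j then V k else 0) + V j * ((a k)⁻¹ * (V k * V k)) := by
    intro k
    split_ifs
    · linear_combination V k * inv_mul_cancel₀ (ha k)
    · ring
  simp only [e]
  rw [Finset.sum_add_distrib, ← Finset.mul_sum, Finset.sum_ite_eq', if_pos (Finset.mem_univ _)]
  ring

/-- The vectors `(X_j, V_j)` and their derivatives span the whole space. -/
theorem IsPeterson.eq_zero_of_orthogonal (hU : IsOpen U) (ha : ∀ j, a j ≠ 0)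
    (hα : ∀ j, α j ^ 2 = (a j)⁻¹) (h : IsPeterson α U V x) {u : Pt n} (hu : u ∈ U)
    {N : Fin (2 * n - 1) → ℂ} {ν : ℂ}
    (h₁ : ∀ j, N ⬝ᵥ coordTangent V x j u - ν * V u j = 0)
    (h₂ : ∀ j, N ⬝ᵥ pd j (coordTangent V x j) u - ν * pd j (fun w => V w j) u = 0) :
    N = 0 ∧ ν = 0 := by
  have hσ := h.sigma_ne_zero ha hα hu
  have hG := fun j k => h.coordTangent_dot hα hu j k
  have hdX : ∀ j, DifferentiableAt ℂ (coordTangent V x j) u := fun j =>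
    (h.analyticOnNhd_coordTangent hα j u hu).differentiableAt
  have hdV : ∀ j, DifferentiableAt ℂ (fun w => V w j) u := fun j =>
    (analyticOnNhd_apply h.hol_V j u hu).differentiableAt
  have hG1 : ∀ j k, coordTangent V x j u ⬝ᵥ pd k (coordTangent V x k) u
      - V u j * pd k (fun w => V w k) u = 0 := by
    intro j k
    have e := pd_congr hU (fun w hw => h.coordTangent_dot hα hw j k) hu k
    rw [pd_const, pd_sub (analyticOnNhd_dotProduct (h.analyticOnNhd_coordTangent hα j)
      (h.analyticOnNhd_coordTangent hα k) u hu).differentiableAt ((hdV j).fun_mul (hdV k)),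
      pd_dotProduct (hdX j) (hdX k), pd_mul (hdV j) (hdV k)] at e
    by_cases hjk : k = j
    · subst hjk
      rw [dotProduct_comm (pd k (coordTangent V x k) u)] at e
      linear_combination e / 2
    · rw [h.pd_coordTangent hU hα hjk hu, h.pd_coord_eq_zero hjk hu, zero_dotProduct] at e
      linear_combination e
  set σ := 1 + ∑ k, (a k)⁻¹ * (V u k * V u k) with hσdef
  -- Subtracting (ν/σ)t from N makes it normal to x, while `N₀` is ν/σ times the normal (α_jvʲ, -1)
  -- of the quadric. The hypotheses on velocities then say that the joined second fundamental form
  -- vanishes.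
  let t : Fin (2 * n - 1) → ℂ := ∑ k, ((a k)⁻¹ * V u k) • coordTangent V x k u
  have ht₁ : ∀ j, t ⬝ᵥ coordTangent V x j u = V u j * σ := by
    intro j
    rw [hσdef, ← sum_mul_ite_add j ha, sum_dotProduct]
    refine Finset.sum_congr rfl fun k _ => ?_
    rw [smul_dotProduct, smul_eq_mul, ← hG k j, sub_add_cancel]
  have ht₂ : ∀ j, t ⬝ᵥ pd j (coordTangent V x j) u = (σ - 1) * pd j (fun w => V w j) u := by
    intro j
    rw [hσdef, add_sub_cancel_left, sum_dotProduct, Finset.sum_mul]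
    refine Finset.sum_congr rfl fun k _ => ?_
    rw [smul_dotProduct, smul_eq_mul]
    linear_combination (a k)⁻¹ * V u k * hG1 k j
  let N' : Fin (2 * n - 1) → ℂ := N - (ν / σ) • t
  let N₀ : Fin (n + 1) → ℂ :=
    Fin.snoc (α := fun _ => ℂ) (fun j => α j * (ν / σ * V u j)) (-(ν / σ))
  have hα0 := alpha_ne_zero ha hα
  have hN' : ∀ j, N' ⬝ᵥ coordTangent V x j u = 0 := by
    intro j
    rw [sub_dotProduct, smul_dotProduct, smul_eq_mul, ht₁]
    linear_combination h₁ j - ν * V u j * div_mul_cancel₀ (1 : ℂ) hσ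
  have hN'₂ : ∀ j, N' ⬝ᵥ pd j (coordTangent V x j) u = ν / σ * pd j (fun w => V w j) u := by
    intro j
    rw [sub_dotProduct, smul_dotProduct, smul_eq_mul, ht₂]
    linear_combination h₂ j - ν * pd j (fun w => V w j) u * div_mul_cancel₀ (1 : ℂ) hσ
  have hN₀ : ∀ w : Pt n, N₀ ⬝ᵥ quadricTangent α (V u) w = 0 := by
    intro w
    rw [quadricTangent, snoc_dotProduct_snoc]
    have e : (fun j => α j * (ν / σ * V u j)) ⬝ᵥ (fun j => w j / α j) = ν / σ * (V u ⬝ᵥ w) := by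
      rw [dotProduct, dotProduct, Finset.mul_sum]
      refine Finset.sum_congr rfl fun j _ => ?_
      rw [mul_div_left_comm, ← mul_assoc]
      have := hα0 j
      field_simp
    rw [e]
    ring
  obtain ⟨hz, hz₀⟩ := h.joined_nondegenerate u hu N' N₀ (fun j => by
      rw [h.pd_x hα hu, dotProduct_smul, hN', smul_zero])
    (fun j => by rw [pd_quadricPoint h.hol_V hu, hN₀]) (fun j k => by
      by_cases hjk : j = k
      · subst hjk
        rw [h.pd_pd_x_eq hU hα hu, dotProduct_add, dotProduct_smul, dotProduct_smul, hN', hN'₂,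
          Peterson.pd_pd_quadricPoint hU h.hol_V hu, dotProduct_add, hN₀, h.pd_V hu,
          dotProduct_single, Pi.single_eq_same, snoc_dotProduct_snoc]
        simp only [smul_eq_mul, dotProduct_zero]
        ring
      · rw [h.pd_pd_x hU hu hjk, h.pd_pd_quadricPoint hU hu hjk, dotProduct_zero, dotProduct_zero,
          add_zero])
  have hν : ν = 0 := by
    have := congrFun hz₀ (Fin.last n)
    simp only [N₀, Fin.snoc_last, Pi.zero_apply, neg_eq_zero] at this
    exact (div_eq_zero_iff.1 this).resolve_right hσ
  refine ⟨?_, hν⟩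
  have : N - (ν / σ) • t = 0 := hz
  rwa [hν, zero_div, zero_smul, sub_zero] at this

/-- Every Peterson deformation is locally explicit. -/
theorem IsPeterson.exists_petersonDatum (hn : n ≠ 0) (hU : IsOpen U) (ha : ∀ j, a j ≠ 0)
    (hα : ∀ j, α j ^ 2 = (a j)⁻¹) (h : IsPeterson α U V x) {u₀ : Pt n} (hu₀ : u₀ ∈ U) :
    ∃ W : Set (Pt n), IsOpen W ∧ u₀ ∈ W ∧ W ⊆ U ∧
      ∃ (φ : Fin n → ℂ → ℂ) (c : Constants n), c.Admissible a ∧ ∀ u ∈ W,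
        (∀ j, AnalyticAt ℂ (φ j) (u j) ∧ deriv (φ j) (u j) ≠ 0) ∧
        V u = (petersonDatum α c).V (fun j => φ j (u j)) ∧
        x u = (petersonDatum α c).x (fun j => φ j (u j)) := by
  obtain ⟨ε, hε, hsub⟩ := Metric.isOpen_iff.1 hU u₀ hu₀
  obtain ⟨ε', hε', hle, φ, b₁, b₂, f₁, f₂, hG, hφ⟩ := exists_exponential_coordinates ha hα hε
    (v := fun j w => V w j) (X := coordTangent V x) (u₀ := u₀)
    (fun j => (analyticOnNhd_apply h.hol_V j).mono hsub)
    (fun j => (h.analyticOnNhd_coordTangent hα j).mono hsub)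
    (fun j k hk u hu => h.pd_coord_eq_zero hk (hsub hu))
    (fun j k hk u hu => h.pd_coordTangent hU hα hk (hsub hu))
    (fun u hu j k => h.coordTangent_dot hα (hsub hu) j k) (fun j => h.pd_ne_zero hα hu₀ j)
    (fun N ν h₁ h₂ => h.eq_zero_of_orthogonal hU ha hα hu₀ h₁ h₂)
  have hW : Metric.ball u₀ ε' ⊆ U := (Metric.ball_subset_ball hle).trans hsub
  have hB : IsOpen (Metric.ball u₀ ε') := Metric.isOpen_ball
  have h₀ : u₀ ∈ Metric.ball u₀ ε' := Metric.mem_ball_self hε'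
  let Φ : Pt n → Pt n := fun u k => φ k (u k)
  let c₀ : Constants n := ⟨b₁, b₂, f₁, f₂, 0⟩
  let c : Constants n := ⟨b₁, b₂, f₁, f₂, x u₀ - petersonX α c₀ (Φ u₀)⟩
  have hxc : ∀ u, petersonX α c u = petersonX α c₀ u + (x u₀ - petersonX α c₀ (Φ u₀)) := by
    intro u
    ext l
    simp only [petersonX, Pi.add_apply, c, c₀, Pi.zero_apply, add_zero]
  have hφd : ∀ u ∈ Metric.ball u₀ ε', ∀ k, DifferentiableAt ℂ (φ k) (u k) := fun u hu k =>
    (hφ u hu k).1.differentiableAt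
  have hV : ∀ u ∈ Metric.ball u₀ ε', V u = expV α b₁ b₂ (Φ u) := fun u hu =>
    funext fun j => (hφ u hu j).2.1
  have hpd : ∀ u ∈ Metric.ball u₀ ε', ∀ j, pd j (fun w => V w j) u
      = deriv (φ j) (u j) * expL α b₁ b₂ (Φ u) j := by
    intro u hu j
    rw [← pd_apply (h.hol_V u (hW hu)).differentiableAt, pd_congr hB hV hu,
      pd_comp_coord (analyticOnNhd_expV (U := Set.univ) b₁ b₂ _ trivial).differentiableAt
        (hφd u hu), pd_expV, Pi.smul_apply, Pi.single_eq_same, smul_eq_mul]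
  have hp : ∀ u ∈ Metric.ball u₀ ε', DifferentiableAt ℂ (fun w => petersonX α c (Φ w)) u := by
    intro u hu
    have h1 : DifferentiableAt ℂ (petersonX α c) (Φ u) :=
      (analyticOnNhd_petersonX (U := Set.univ) c _ trivial).differentiableAt
    have h2 : DifferentiableAt ℂ Φ u := by
      rw [differentiableAt_pi]
      intro k
      exact DifferentiableAt.comp u (hφd u hu k) (by fun_prop)
    exact h1.comp u h2
  refine ⟨Metric.ball u₀ ε', hB, h₀, hW, φ, c, admissible_of_frameOrthonormal hα
    ((frameGram_iff_frameOrthonormal (card_add_one hn) ha).1 hG), fun u hu =>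
    ⟨fun j => ⟨(hφ u hu j).1, fun h0 => ?_⟩, hV u hu, ?_⟩⟩
  · refine h.pd_ne_zero hα (hW hu) j ?_
    rw [hpd u hu, h0, zero_mul]
  · have := eq_of_pd_eq_zero (f := fun w => x w - petersonX α c (Φ w)) hB
      (convex_ball u₀ ε').isPreconnected
      (fun w hw => (h.hol_x w (hW hw)).differentiableAt.fun_sub (hp w hw))
      (fun w hw j => by
        rw [pd_sub (h.hol_x w (hW hw)).differentiableAt (hp w hw),
          pd_comp_coord (analyticOnNhd_petersonX (U := Set.univ) c _ trivial).differentiableAt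
          (hφd w hw), h.pd_x hα (hW hw), hpd w hw]
        ext l
        rw [Pi.sub_apply, Pi.smul_apply, Pi.smul_apply, pd_petersonX, (hφ w hw j).2.2 l, smul_eq_mul,
          smul_eq_mul, Pi.zero_apply]
        simp only [c, Φ]
        ring) hu h₀
    simp only [hxc, add_sub_cancel, sub_self] at this
    show x u = petersonX α c (Φ u)
    rw [hxc]
    exact sub_eq_zero.1 this

end PetersonDeformation

end Peterson
namespace Peterson

variable {n : ℕ}

/-! ### The 3-moving Möbius configuration. -/

section Moebius

variable {a : Fin n → ℂ} {U : Set (Pt n)} {p₁ p₂ p₃ : SpectralParam a}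

/-- The algebraic formulas for the rotation of the last vertex of the Möbius configuration. -/
theorem moebius_formulas {R₁ R₂ R₄ R₃ R₅ R₆ R₇ : Mat n} (h₁ : IsOrth R₁)
    (h₂ : IsOrth R₂) (h₁₂ : (p₂.D * R₂ - p₁.D * R₁).det ≠ 0)
    (h₁₃ : (p₃.D * R₄ - p₁.D * R₁).det ≠ 0) (h₂₃ : (p₃.D * R₄ - p₂.D * R₂).det ≠ 0)
    (hb : (box p₁.D p₂.D p₃.D R₁ R₂ R₄).det ≠ 0)
    (h₃ : R₃ = bianchi p₁.D p₂.D R₁ R₂) (h₅ : R₅ = bianchi p₁.D p₃.D R₁ R₄)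
    (h₆ : R₆ = bianchi p₂.D p₃.D R₂ R₄) (h₇ : R₇ = bianchi p₂.D p₃.D R₃ R₅ * R₁) :
    p₁.D * p₂.D * p₃.D * R₇ =
      p₁.D * ((p₂.D ^ 2 - p₃.D ^ 2) * p₂.D * R₃ * (p₂.D * R₃ - p₃.D * R₅)⁻¹ * R₁
        - p₂.D ^ 2 * R₁) ∧
    p₁.D * p₂.D * p₃.D * R₇ =
      (p₁.D ^ 2 * p₂.D * R₂ - p₂.D ^ 2 * p₁.D * R₁) * (box p₁.D p₂.D p₃.D R₁ R₂ R₄)⁻¹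
        * (p₂.D ^ 2 - p₃.D ^ 2) * (p₃.D * R₄ - p₁.D * R₁) - p₂.D ^ 2 * p₁.D * R₁ ∧
    p₁.D * p₂.D * p₃.D * R₇ =
      (p₁.D ^ 2 * p₂.D * R₂ - p₂.D ^ 2 * p₁.D * R₁) * (box p₁.D p₂.D p₃.D R₁ R₂ R₄)⁻¹
        * (p₃.D ^ 2 - p₁.D ^ 2) * (p₂.D * R₂ - p₃.D * R₄) - p₁.D ^ 2 * p₂.D * R₂ ∧
    p₁.D * p₂.D * p₃.D * R₇ =
      p₂.D * ((p₃.D ^ 2 - p₁.D ^ 2) * p₁.D * R₃ * (p₃.D * R₆ - p₁.D * R₃)⁻¹ * R₂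
        - p₁.D ^ 2 * R₂) := by
  have f₂ := third_transform_eq IsOrth.one h₁ h₂ h₁₂ h₁₃ hb (h₃.trans (Matrix.mul_one _).symm)
    (h₅.trans (Matrix.mul_one _).symm)
  rw [← h₇] at f₂
  have f₁ := D_bianchi_sub_inv h₁ h₁₂ h₁₃ hb
  rw [← h₃, ← h₅] at f₁
  have f₃ := box_formula_swap hb
  have hb' : (box p₂.D p₁.D p₃.D R₂ R₁ R₄).det ≠ 0 := by
    rw [box_swap, Matrix.det_neg]
    exact mul_ne_zero (pow_ne_zero _ (neg_ne_zero.2 one_ne_zero)) hb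
  -- The last formula is the first with the indices 1 and 2 exchanged; the two forms of the □
  -- expression connect them.
  have f₄ := D_bianchi_sub_inv h₂ (det_sub_swap_ne_zero.1 h₁₂) h₂₃ hb'
  rw [← bianchi_comm h₁ h₂, ← h₃, ← h₆, box_formula_comm, ← f₃, ← f₂,
    ← neg_sub (p₃.D * R₆), neg_inv_eq, ← neg_sub (p₃.D ^ 2)] at f₄
  refine ⟨f₂.trans f₁.symm, f₂, f₂.trans f₃, f₄.symm.trans ?_⟩
  simp only [Matrix.neg_mul, Matrix.mul_neg, neg_neg]

/-- The 3-moving Möbius configuration over a seed with rotation `Iₙ`. -/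
theorem moebius_configuration (ha : ∀ j, a j ≠ 0) (hn : n ≠ 0) (hU : IsOpen U) {S : Datum n}
    (hS : IsDeformationDatum a U S) (hS1 : S.R = fun _ => 1) {R₁ R₂ R₄ R₃ R₅ R₆ : Pt n → Mat n}
    (hR₁ : IsRiccati p₁ U S.R R₁) (h₁ : ∀ u ∈ U, IsOrth (R₁ u))
    (hR₂ : IsRiccati p₂ U S.R R₂) (h₂ : ∀ u ∈ U, IsOrth (R₂ u))
    (hR₄ : IsRiccati p₃ U S.R R₄) (h₄ : ∀ u ∈ U, IsOrth (R₄ u))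
    (h₁₂ : ∀ u ∈ U, (p₂.D * R₂ u - p₁.D * R₁ u).det ≠ 0)
    (h₁₃ : ∀ u ∈ U, (p₃.D * R₄ u - p₁.D * R₁ u).det ≠ 0)
    (h₂₃ : ∀ u ∈ U, (p₃.D * R₄ u - p₂.D * R₂ u).det ≠ 0)
    (hb : ∀ u ∈ U, (box p₁.D p₂.D p₃.D (R₁ u) (R₂ u) (R₄ u)).det ≠ 0)
    (h₃ : ∀ u ∈ U, R₃ u = bianchi p₁.D p₂.D (R₁ u) (R₂ u))
    (h₅ : ∀ u ∈ U, R₅ u = bianchi p₁.D p₃.D (R₁ u) (R₄ u))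
    (h₆ : ∀ u ∈ U, R₆ u = bianchi p₂.D p₃.D (R₂ u) (R₄ u)) :
    (∀ u ∈ U, (p₂.D * R₃ u - p₃.D * R₅ u).det ≠ 0 ∧ (p₃.D * R₆ u - p₁.D * R₃ u).det ≠ 0) ∧
    ∀ R₇ : Pt n → Mat n, (∀ u ∈ U, R₇ u = bianchi p₂.D p₃.D (R₃ u) (R₅ u) * R₁ u) →
      ∀ S₃ S₅ S₆ : Datum n, S₃ = backlund p₂ (backlund p₁ S R₁) R₃ →
      S₅ = backlund p₃ (backlund p₁ S R₁) R₅ → S₆ = backlund p₃ (backlund p₂ S R₂) R₆ →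
      (∀ u ∈ U, IsOrth (R₇ u)) ∧
      (backlund p₃ S₃ R₇).AgreeOn U (backlund p₂ S₅ R₇) ∧
      (backlund p₃ S₃ R₇).AgreeOn U (backlund p₁ S₆ R₇) ∧
      IsDeformationDatum a U (backlund p₃ S₃ R₇) ∧
      IsBacklundTransform p₃ U S₃ (backlund p₃ S₃ R₇) ∧
      IsBacklundTransform p₂ U S₅ (backlund p₃ S₃ R₇) ∧
      IsBacklundTransform p₁ U S₆ (backlund p₃ S₃ R₇) := by
  have e (M : Mat n) (u : Pt n) : M * S.R u = M := by rw [hS1, Matrix.mul_one]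
  have hd : ∀ u ∈ U, (p₂.D * R₃ u - p₃.D * R₅ u).det ≠ 0 := fun u hu => by
    rw [h₃ u hu, h₅ u hu]
    exact (det_bianchi_sub_ne_zero_iff (h₁ u hu) (h₁₂ u hu) (h₁₃ u hu)).2 (hb u hu)
  have hd' : ∀ u ∈ U, (p₁.D * R₃ u - p₃.D * R₆ u).det ≠ 0 := fun u hu => by
    rw [h₃ u hu, h₆ u hu, bianchi_comm (h₁ u hu) (h₂ u hu)]
    refine (det_bianchi_sub_ne_zero_iff (h₂ u hu) (det_sub_swap_ne_zero.1 (h₁₂ u hu))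
      (h₂₃ u hu)).2 ?_
    rw [box_swap, Matrix.det_neg]
    exact mul_ne_zero (pow_ne_zero _ (neg_ne_zero.2 one_ne_zero)) (hb u hu)
  refine ⟨fun u hu => ⟨hd u hu, det_sub_swap_ne_zero.1 (hd' u hu)⟩, ?_⟩
  rintro R₇ h₇ S₃ S₅ S₆ rfl rfl rfl
  obtain ⟨o₃, r₁₃, r₂₃, g₃⟩ := bianchi_permutability (R₃ := R₃) hU hS hR₁ h₁ hR₂ h₂ h₁₂
    (fun u hu => by rw [e]; exact h₃ u hu)
  obtain ⟨o₅, r₁₅, -, -⟩ := bianchi_permutability (R₃ := R₅) hU hS hR₁ h₁ hR₄ h₄ h₁₃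
    (fun u hu => by rw [e]; exact h₅ u hu)
  obtain ⟨o₆, r₂₆, -, -⟩ := bianchi_permutability (R₃ := R₆) hU hS hR₂ h₂ hR₄ h₄ h₂₃
    (fun u hu => by rw [e]; exact h₆ u hu)
  have hS₁ := backlund_isDeformationDatum hn hU hS hR₁ h₁
  have hS₂ := backlund_isDeformationDatum hn hU hS hR₂ h₂
  obtain ⟨o₇, r₃₇, r₅₇, g₇⟩ := bianchi_permutability (R₃ := R₇) hU hS₁ r₁₃ o₃ r₁₅ o₅
    (fun u hu => det_sub_swap_ne_zero.1 (hd u hu)) h₇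
  -- Permutability over datum 1 relates the data 3 and 5; over datum 2 it relates 3 and 6. Cube
  -- consistency ensures that the same R₇ occurs in both.
  obtain ⟨-, -, r₆₇, g₇'⟩ := bianchi_permutability (R₃ := R₇) hU hS₂ r₂₃ o₃ r₂₆ o₆
    (fun u hu => det_sub_swap_ne_zero.1 (hd' u hu)) (fun u hu => by
      rw [h₇ u hu]
      exact third_transform_comm ha IsOrth.one (h₁ u hu) (h₂ u hu) (h₁₂ u hu) (h₁₃ u hu) (h₂₃ u hu)
        (hb u hu) (by rw [Matrix.mul_one, h₃ u hu]) (by rw [Matrix.mul_one, h₅ u hu])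
        (by rw [Matrix.mul_one, h₆ u hu]))
  have g := (g₃.backlund (fun u _ => rfl) p₃).trans g₇'
  have hS₃ := backlund_isDeformationDatum hn hU hS₁ r₁₃ o₃
  have hS₅ := backlund_isDeformationDatum hn hU hS₁ r₁₅ o₅
  have hS₆ := backlund_isDeformationDatum hn hU hS₂ r₂₆ o₆
  exact ⟨o₇, g₇, g, backlund_isDeformationDatum hn hU hS₃ r₃₇ o₇,
    backlund_isBacklundTransform hn hS₃ r₃₇ o₇,
    (backlund_isBacklundTransform hn hS₅ r₅₇ o₇).congr hU g₇.symm,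
    (backlund_isBacklundTransform hn hS₆ r₆₇ o₇).congr hU g.symm⟩

end Moebius

/-! ### Non-degeneracy for small constants and dependence on them. -/

section SmallConstants

variable {a : Fin n → ℂ}

theorem det_D_sub_D_ne_zero {p q : SpectralParam a} (h : p.z ≠ q.z) : (p.D - q.D).det ≠ 0 := by
  rw [SpectralParam.D, SpectralParam.D, Matrix.diagonal_sub, Matrix.det_diagonal,
    Finset.prod_ne_zero_iff]
  intro j _ h0
  have h1 := p.d_sq_eq j
  have h2 := q.d_sq_eq j
  rw [sub_eq_zero.1 h0, h2] at h1
  exact h (inv_injective (sub_left_injective h1)).symm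

/-- At ζ = -1/2 the coefficients of all exponentials vanish, so Z is constant. This is the centre of
the perturbation argument. -/
theorem expZ_neg_half (p : SpectralParam a) (u : Pt n) :
    expZ p (-((1 / 2 : ℂ) • 1)) u = -((1 / 2 : ℂ) • 1) := by
  ext j k
  rw [expZ_apply]
  split_ifs with hjk
  · subst hjk
    simp only [Matrix.neg_apply, Matrix.smul_apply, one_apply_eq, smul_eq_mul]
    ring
  · simp [Matrix.one_apply_ne hjk]

theorem det_neg_half_ne_zero : (-((1 / 2 : ℂ) • (1 : Mat n))).det ≠ 0 := by
  rw [Matrix.det_neg, Matrix.det_smul, Matrix.det_one, mul_one]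
  exact mul_ne_zero (pow_ne_zero _ (neg_ne_zero.2 one_ne_zero)) (pow_ne_zero _ (by norm_num))

theorem explicitR_neg_half (p : SpectralParam a) (u : Pt n) :
    explicitR p (-((1 / 2 : ℂ) • 1)) u = -1 := by
  have h : (-((1 / 2 : ℂ) • (1 : Mat n)))⁻¹ = -((2 : ℂ) • 1) := by
    refine Matrix.inv_eq_left_inv ?_
    rw [neg_mul_neg, smul_mul_smul_comm, Matrix.one_mul]
    norm_num
  rw [explicitR, expZ_neg_half, h, two_smul]
  abel

theorem continuousAt_inv_of_det_ne_zero {T : Type*} [TopologicalSpace T] {M : T → Mat n} {t : T}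
    (hM : ContinuousAt M t) (h : (M t).det ≠ 0) : ContinuousAt (fun s => (M s)⁻¹) t := by
  have hd : ContinuousAt (fun s => (M s).det) t :=
    (continuous_id.matrix_det (n := Fin n) (R := ℂ)).continuousAt.comp hM
  have hA : ContinuousAt (fun s => (M s).adjugate) t :=
    (continuous_id.matrix_adjugate (n := Fin n) (R := ℂ)).continuousAt.comp hM
  simp only [Matrix.inv_def, Ring.inverse_eq_inv']
  exact (hd.inv₀ h).smul hA

variable {N : ℕ} {p : Fin N → SpectralParam a}

/-- The explicit solutions with `ζ = K - 1/2`. -/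
noncomputable def skewR (p : Fin N → SpectralParam a) (K : Fin N → Mat n) (i : Fin N) :
    Pt n → Mat n :=
  explicitR (p i) (K i - (1 / 2 : ℂ) • 1)

theorem skewR_zero (i : Fin N) (u : Pt n) : skewR p (fun _ => 0) i u = -1 := by
  rw [skewR, zero_sub, explicitR_neg_half]

theorem skewR_isOrth {K : Fin N → Mat n} (hK : ∀ i, (K i)ᵀ = -K i) {i : Fin N} {u : Pt n}
    (h : (expZ (p i) (K i - (1 / 2 : ℂ) • 1) u).det ≠ 0) : IsOrth (skewR p K i u) := by
  have hs : ∀ j k, K i j k = -K i k j := fun j k => by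
    have := congrFun (congrFun (hK i) k) j
    simpa using this
  refine (isOrth_explicitR_iff h).2 ⟨fun j => ?_, fun j k hjk => ?_⟩
  · have := hs j j
    have h0 : K i j j = 0 := by linear_combination this / 2
    simp only [Matrix.sub_apply, Matrix.smul_apply, one_apply_eq, smul_eq_mul, h0]
    ring
  · simp only [Matrix.sub_apply, Matrix.smul_apply, one_apply_ne hjk, one_apply_ne hjk.symm,
      smul_zero, sub_zero]
    exact hs j k

theorem continuous_expZ_skew (i : Fin N) :
    Continuous fun t : (Fin N → Fin n → Fin n → ℂ) × Pt n =>
      expZ (p i) (Matrix.of (t.1 i) - (1 / 2 : ℂ) • 1) t.2 := by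
  refine continuous_matrix fun j k => ?_
  simp only [expZ_apply, Matrix.sub_apply, Matrix.of_apply, Matrix.smul_apply]
  split_ifs <;> fun_prop

theorem det_expZ_skew_ne_zero (i : Fin N) (u : Pt n) :
    (expZ (p i) (Matrix.of ((0 : Fin N → Fin n → Fin n → ℂ) i) - (1 / 2 : ℂ) • 1) u).det ≠ 0 := by
  have : (Matrix.of ((0 : Fin N → Fin n → Fin n → ℂ) i) : Mat n) = 0 := rfl
  rw [this, zero_sub, expZ_neg_half]
  exact det_neg_half_ne_zero

/-- Near `K = 0` the iterated rotations are continuous; at `K = 0` they are `±Iₙ`. -/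
theorem iterR_skewR_near_zero (hz : ∀ i j, i ≠ j → (p i).z ≠ (p j).z) (u₀ : Pt n)
    (l : List (Fin N)) :
    (l.Nodup → iterR p (skewR p fun _ => 0) l u₀ = (-1) ^ l.length ∧
      ContinuousAt (fun t : (Fin N → Fin n → Fin n → ℂ) × Pt n =>
        iterR p (skewR p fun i => Matrix.of (t.1 i)) l t.2) (0, u₀)) ∧
    ∀ i, (i :: l).Nodup → iterR p (skewR p fun _ => 0) (i :: l) u₀ = (-1) ^ (i :: l).length ∧
      ContinuousAt (fun t : (Fin N → Fin n → Fin n → ℂ) × Pt n =>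
        iterR p (skewR p fun i => Matrix.of (t.1 i)) (i :: l) t.2) (0, u₀) := by
  induction l with
  | nil =>
    refine ⟨fun _ => ⟨by rw [iterR_nil]; rfl, ?_⟩, fun i _ => ⟨?_, ?_⟩⟩
    · simp only [iterR_nil]
      exact continuousAt_const
    · rw [iterR_singleton, skewR_zero, List.length_singleton, pow_one]
    · simp only [iterR_singleton]
      exact continuousAt_const.add (continuousAt_inv_of_det_ne_zero
        (continuous_expZ_skew i).continuousAt (det_expZ_skew_ne_zero i u₀))
  | cons j l ih =>
    refine ⟨fun hl => ih.2 j hl, fun i hl => ?_⟩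
    obtain ⟨e₁, c₁⟩ := ih.1 hl.of_cons.of_cons
    obtain ⟨e₂, c₂⟩ := ih.2 j hl.of_cons
    obtain ⟨e₃, c₃⟩ := ih.2 i (nodup_cons_of_cons_cons hl)
    have hij : i ≠ j := fun h => (List.nodup_cons.1 hl).1 (h ▸ List.mem_cons_self)
    have hdet := det_D_sub_D_ne_zero (hz i j hij)
    -- Two lists of equal length give the same sign times I, so the product is I and the matrix to
    -- be inverted is D_i - D_j.
    have hmul : iterR p (skewR p fun _ => 0) (i :: l) u₀
        * (iterR p (skewR p fun _ => 0) (j :: l) u₀)ᵀ = 1 := by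
      rw [e₂, e₃, List.length_cons, List.length_cons, Matrix.transpose_pow, Matrix.transpose_neg,
        Matrix.transpose_one, ← pow_add, Even.neg_one_pow ⟨_, rfl⟩]
    constructor
    · rw [iterR_cons_cons, bianchi, Matrix.mul_assoc (p i).D, Matrix.mul_assoc (p j).D, hmul, e₁,
        Matrix.mul_one, Matrix.mul_one, Matrix.mul_nonsing_inv _ (isUnit_iff_ne_zero.2 hdet),
        Matrix.one_mul, List.length_cons, List.length_cons, pow_add, pow_add, pow_one, mul_assoc,
        neg_mul_neg, one_mul, mul_one]
    · simp only [iterR_cons_cons, bianchi]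
      have k₁ : ContinuousAt (fun t : (Fin N → Fin n → Fin n → ℂ) × Pt n =>
          iterR p (skewR p fun i => Matrix.of (t.1 i)) (i :: l) t.2
            * (iterR p (skewR p fun i => Matrix.of (t.1 i)) (j :: l) t.2)ᵀ) (0, u₀) :=
        c₃.mul (continuous_id.matrix_transpose.continuousAt.comp c₂)
      simp only [Matrix.mul_assoc] at k₁ ⊢
      refine (continuousAt_const.sub (continuousAt_const.mul k₁)).mul
        ((continuousAt_inv_of_det_ne_zero ((continuousAt_const.mul k₁).sub continuousAt_const) ?_).mul c₁)
      show ((p i).D * (iterR p (skewR p fun _ => 0) (i :: l) u₀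
        * (iterR p (skewR p fun _ => 0) (j :: l) u₀)ᵀ) - (p j).D).det ≠ 0
      rw [hmul, Matrix.mul_one]
      exact hdet

/-- For small skew-symmetric constants the iteration is non-degenerate near a given point. -/
theorem exists_iterNondegenerate (hz : ∀ i j, i ≠ j → (p i).z ≠ (p j).z) (u₀ : Pt n) :
    ∃ ε : ℝ, 0 < ε ∧ ∀ K : Fin N → Mat n, (∀ i j k, ‖K i j k‖ < ε) →
      (∀ i, ∀ u ∈ Metric.ball u₀ ε, (expZ (p i) (K i - (1 / 2 : ℂ) • 1) u).det ≠ 0) ∧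
      IterNondegenerate p (skewR p K) (Metric.ball u₀ ε) := by
  have h₁ : ∀ᶠ t : (Fin N → Fin n → Fin n → ℂ) × Pt n in nhds (0, u₀), ∀ i,
      (expZ (p i) (Matrix.of (t.1 i) - (1 / 2 : ℂ) • 1) t.2).det ≠ 0 := by
    rw [Filter.eventually_all]
    exact fun i => (continuous_expZ_skew i).matrix_det.continuousAt.eventually_ne
      (det_expZ_skew_ne_zero i u₀)
  -- Lists without repetition over a finite index set form a finite type; quantifying over that
  -- subtype leaves finitely many open conditions to intersect.
  have h₂ : ∀ᶠ t : (Fin N → Fin n → Fin n → ℂ) × Pt n in nhds (0, u₀),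
      ∀ (l : {l : List (Fin N) // l.Nodup}) (i j : Fin N), (i :: j :: l.1).Nodup →
        ((p i).D * iterR p (skewR p fun i => Matrix.of (t.1 i)) (i :: l.1) t.2
          * (iterR p (skewR p fun i => Matrix.of (t.1 i)) (j :: l.1) t.2)ᵀ - (p j).D).det ≠ 0 := by
    rw [Filter.eventually_all]
    rintro ⟨l, -⟩
    rw [Filter.eventually_all]
    intro i
    rw [Filter.eventually_all]
    intro j
    by_cases hl : (i :: j :: l).Nodup
    swap
    · exact Filter.Eventually.of_forall fun t h => absurd h hl
    obtain ⟨e₂, c₂⟩ := (iterR_skewR_near_zero (p := p) hz u₀ l).2 j hl.of_cons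
    obtain ⟨e₃, c₃⟩ := (iterR_skewR_near_zero (p := p) hz u₀ l).2 i (nodup_cons_of_cons_cons hl)
    have hij : i ≠ j := fun h => (List.nodup_cons.1 hl).1 (h ▸ List.mem_cons_self)
    have hc : ContinuousAt (fun t : (Fin N → Fin n → Fin n → ℂ) × Pt n =>
        (p i).D * iterR p (skewR p fun i => Matrix.of (t.1 i)) (i :: l) t.2
          * (iterR p (skewR p fun i => Matrix.of (t.1 i)) (j :: l) t.2)ᵀ - (p j).D) (0, u₀) :=
      ((continuousAt_const.mul c₃).mul
        (continuous_id.matrix_transpose.continuousAt.comp c₂)).sub continuousAt_const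
    have hd := (continuous_id.matrix_det (n := Fin n) (R := ℂ)).continuousAt.comp hc
    refine (hd.eventually_ne (y := 0) ?_).mono fun t ht _ => ht
    show ((p i).D * iterR p (skewR p fun _ => 0) (i :: l) u₀
        * (iterR p (skewR p fun _ => 0) (j :: l) u₀)ᵀ - (p j).D).det ≠ 0
    rw [e₂, e₃, List.length_cons, List.length_cons, Matrix.transpose_pow, Matrix.transpose_neg,
      Matrix.transpose_one, mul_assoc, ← pow_add, Even.neg_one_pow ⟨_, rfl⟩, mul_one]
    exact det_D_sub_D_ne_zero (hz i j hij)
  obtain ⟨ε, hε, hball⟩ := Metric.eventually_nhds_iff_ball.1 (h₁.and h₂)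
  refine ⟨ε, hε, fun K hK => ?_⟩
  have hmem : ∀ u ∈ Metric.ball u₀ ε,
      ((fun i j k => K i j k : Fin N → Fin n → Fin n → ℂ), u) ∈ Metric.ball
        ((0, u₀) : (Fin N → Fin n → Fin n → ℂ) × Pt n) ε := by
    intro u hu
    rw [Metric.mem_ball, Prod.dist_eq, max_lt_iff]
    refine ⟨?_, hu⟩
    rw [dist_pi_lt_iff hε]
    intro i
    rw [dist_pi_lt_iff hε]
    intro j
    rw [dist_pi_lt_iff hε]
    intro k
    simpa using hK i j k
  exact ⟨fun i u hu => (hball _ (hmem u hu)).1 i, fun i j l hl u hu =>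
    (hball _ (hmem u hu)).2 ⟨l, hl.of_cons.of_cons⟩ i j hl⟩

theorem skewR_iterR_injective (ha : ∀ j, a j ≠ 0) (hz : ∀ i j, i ≠ j → (p i).z ≠ (p j).z)
    {U : Set (Pt n)} {K K' : Fin N → Mat n} (hK : ∀ i, (K i)ᵀ = -K i) (hK' : ∀ i, (K' i)ᵀ = -K' i)
    (hd : ∀ i, ∀ u ∈ U, (expZ (p i) (K i - (1 / 2 : ℂ) • 1) u).det ≠ 0)
    (hd' : ∀ i, ∀ u ∈ U, (expZ (p i) (K' i - (1 / 2 : ℂ) • 1) u).det ≠ 0)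
    (hN : IterNondegenerate p (skewR p K) U) (hN' : IterNondegenerate p (skewR p K') U)
    {l : List (Fin N)} {i : Fin N} (hl : l.Nodup) (hi : i ∈ l) (hne : ∀ j, j ≠ i → K j = K' j)
    {u : Pt n} (hu : u ∈ U) (h : iterR p (skewR p K) l u = iterR p (skewR p K') l u) :
    K i = K' i := by
  have := iterR_injective ha hz (fun i u hu => skewR_isOrth hK (hd i u hu)) hN
    (fun i u hu => skewR_isOrth hK' (hd' i u hu)) hN' hu hl hi
    (fun j hj => by rw [skewR, skewR, hne j hj]) h
  exact sub_left_injective (explicitR_injective (hd i u hu) this)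

end SmallConstants

end Peterson
-- Assembly of the theorem.
open Peterson in
theorem mainTheorem1 (n : ℕ) (hn : 2 ≤ n) (a α : Fin n → ℂ) (ha : ∀ j, a j ≠ 0)
    (hα : ∀ j, α j ^ 2 = (a j)⁻¹) :
    -- the solutions of the system in the frame `R = Iₙ`
    (∀ U : Set (Pt n), IsOpen U → IsConnected U → ∀ V L : Pt n → Pt n,
      (IsVLSolution a U (fun _ => 1) V L ↔
        ∃ b₁ b₂ : Fin n → ℂ, ∑ j, 2 * (a j)⁻¹ * (b₁ j * b₂ j + b₂ j * b₁ j) = -1 ∧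
          ∀ u ∈ U, V u = expV α b₁ b₂ u ∧ L u = expL α b₁ b₂ u)) ∧
    -- space realizations given by frames of solutions are explicit
    (∀ U : Set (Pt n), IsOpen U → IsConnected U → ∀ S : Datum n,
      (∀ u ∈ U, S.R u = 1) → IsVLSolution a U (fun _ => 1) S.V S.L → (∀ u ∈ U, ∀ j, S.L u j ≠ 0) →
      (∀ l, IsLinearSolution a U (fun _ => 1) (S.frameV l) (S.frameL l)) →
      AnalyticOnNhd ℂ S.x U →
      (∀ u ∈ U, ∀ (j : Fin n) l, pd j S.x u l = S.frameV l u ⬝ᵥ pd j S.V u) →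
      (∀ u ∈ U, ∀ j k : Fin n, pd j S.x u ⬝ᵥ pd k S.x u
        = pd j (fun w => quadricPoint α (S.V w)) u ⬝ᵥ pd k (fun w => quadricPoint α (S.V w)) u) →
      ∃ c : Constants n, c.Admissible a ∧ S.AgreeOn U (petersonDatum α c)) ∧
    -- conversely, admissible constants give Peterson deformations
    (∀ c : Constants n, c.Admissible a →
      IsRealized a α Set.univ (petersonDatum α c) ∧
      ∀ U : Set (Pt n), IsOpen U → (petersonDatum α c).RegularOn U →
        IsPeterson α U (petersonDatum α c).V (petersonDatum α c).x) ∧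
    -- every Peterson deformation is locally explicit, up to a change of each conjugate coordinate
    (∀ U : Set (Pt n), IsOpen U → ∀ (V : Pt n → Pt n) (x : Pt n → (Fin (2 * n - 1) → ℂ)),
      IsPeterson α U V x → ∀ u₀ ∈ U, ∃ W : Set (Pt n), IsOpen W ∧ u₀ ∈ W ∧ W ⊆ U ∧
        ∃ (φ : Fin n → ℂ → ℂ) (c : Constants n), c.Admissible a ∧ ∀ u ∈ W,
          (∀ j, AnalyticAt ℂ (φ j) (u j) ∧ deriv (φ j) (u j) ≠ 0) ∧
          V u = (petersonDatum α c).V (fun j => φ j (u j)) ∧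
          x u = (petersonDatum α c).x (fun j => φ j (u j))) ∧
    -- the general solution of the Riccati equation
    (∀ (p : SpectralParam a) (U : Set (Pt n)), IsOpen U → IsConnected U → ∀ u₀ ∈ U,
      ∀ R₁ : Pt n → Mat n, (R₁ u₀ - 1).det ≠ 0 →
        (IsPetersonRiccati p U R₁ ↔
          ∃! ζ : Mat n, ∀ u ∈ U, (expZ p ζ u).det ≠ 0 ∧ R₁ u = explicitR p ζ u)) ∧
    (∀ (p : SpectralParam a) (u₀ : Pt n) (M : Mat n), (M - 1).det ≠ 0 →
      ∃! ζ : Mat n, (expZ p ζ u₀).det ≠ 0 ∧ explicitR p ζ u₀ = M) ∧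
    -- orthogonality
    (∀ (p : SpectralParam a) (ζ : Mat n) (u : Pt n), (expZ p ζ u).det ≠ 0 →
      (IsOrth (explicitR p ζ u) ↔
        (∀ j, ζ j j = -1 / 2) ∧ ∀ j k, j ≠ k → ζ j k = -ζ k j)) ∧
    (∀ (p : SpectralParam a) (U : Set (Pt n)), IsOpen U → IsConnected U → ∀ R₁ : Pt n → Mat n,
      IsPetersonRiccati p U R₁ → (∃ u ∈ U, IsOrth (R₁ u)) → ∀ u ∈ U, IsOrth (R₁ u)) ∧
    -- transforms of the Peterson deformation with admissible constants `c`
    (∀ c : Constants n, c.Admissible a → ∀ U : Set (Pt n), IsOpen U →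
      -- the Bäcklund transform
      (∀ (p : SpectralParam a) (R₁ : Pt n → Mat n), IsPetersonRiccati p U R₁ →
        (∀ u ∈ U, IsOrth (R₁ u)) →
        IsRealized a α U (backlund p (petersonDatum α c) R₁) ∧
        IsBacklundTransform p U (petersonDatum α c) (backlund p (petersonDatum α c) R₁)) ∧
      -- the Bianchi Permutability Theorem
      (∀ (p₁ p₂ : SpectralParam a) (R₁ R₂ : Pt n → Mat n),
        IsPetersonRiccati p₁ U R₁ → (∀ u ∈ U, IsOrth (R₁ u)) →
        IsPetersonRiccati p₂ U R₂ → (∀ u ∈ U, IsOrth (R₂ u)) →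
        (∀ u ∈ U, (p₂.D * R₂ u * (R₁ u)ᵀ - p₁.D).det ≠ 0) →
        ∀ R₃ : Pt n → Mat n, (∀ u ∈ U, R₃ u =
          (p₂.D - p₁.D * R₂ u * (R₁ u)ᵀ) * (p₂.D * R₂ u * (R₁ u)ᵀ - p₁.D)⁻¹) →
        ∀ S₁ S₂ S₃ : Datum n, S₁ = backlund p₁ (petersonDatum α c) R₁ →
        S₂ = backlund p₂ (petersonDatum α c) R₂ → S₃ = backlund p₂ S₁ R₃ →
        (∀ u ∈ U, IsOrth (R₃ u)) ∧
        S₃.AgreeOn U (backlund p₁ S₂ R₃) ∧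
        IsRealized a α U S₃ ∧
        IsBacklundTransform p₂ U S₁ S₃ ∧ IsBacklundTransform p₁ U S₂ S₃) ∧
      -- the 3-moving Möbius configuration
      (∀ (p₁ p₂ p₃ : SpectralParam a) (R₁ R₂ R₄ : Pt n → Mat n),
        IsPetersonRiccati p₁ U R₁ → (∀ u ∈ U, IsOrth (R₁ u)) →
        IsPetersonRiccati p₂ U R₂ → (∀ u ∈ U, IsOrth (R₂ u)) →
        IsPetersonRiccati p₃ U R₄ → (∀ u ∈ U, IsOrth (R₄ u)) →
        (∀ u ∈ U, (p₂.D * R₂ u * (R₁ u)ᵀ - p₁.D).det ≠ 0) →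
        (∀ u ∈ U, (p₃.D * R₄ u * (R₁ u)ᵀ - p₁.D).det ≠ 0) →
        (∀ u ∈ U, (p₃.D * R₄ u * (R₂ u)ᵀ - p₂.D).det ≠ 0) →
        (∀ u ∈ U, (box p₁.D p₂.D p₃.D (R₁ u) (R₂ u) (R₄ u)).det ≠ 0) →
        ∀ R₃ R₅ R₆ : Pt n → Mat n,
        (∀ u ∈ U, R₃ u = bianchi p₁.D p₂.D (R₁ u) (R₂ u)) →
        (∀ u ∈ U, R₅ u = bianchi p₁.D p₃.D (R₁ u) (R₄ u)) →
        (∀ u ∈ U, R₆ u = bianchi p₂.D p₃.D (R₂ u) (R₄ u)) →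
        ∀ S₃ S₅ S₆ : Datum n,
        S₃ = backlund p₂ (backlund p₁ (petersonDatum α c) R₁) R₃ →
        S₅ = backlund p₃ (backlund p₁ (petersonDatum α c) R₁) R₅ →
        S₆ = backlund p₃ (backlund p₂ (petersonDatum α c) R₂) R₆ →
        (∀ u ∈ U, (p₂.D * R₃ u - p₃.D * R₅ u).det ≠ 0 ∧ (p₃.D * R₆ u - p₁.D * R₃ u).det ≠ 0) ∧
        ∃ R₇ : Pt n → Mat n,
          (∀ u ∈ U,
            p₁.D * p₂.D * p₃.D * R₇ u =
              p₁.D * ((p₂.D ^ 2 - p₃.D ^ 2) * p₂.D * R₃ u * (p₂.D * R₃ u - p₃.D * R₅ u)⁻¹ * R₁ u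
                - p₂.D ^ 2 * R₁ u) ∧
            p₁.D * p₂.D * p₃.D * R₇ u =
              (p₁.D ^ 2 * p₂.D * R₂ u - p₂.D ^ 2 * p₁.D * R₁ u)
                * (box p₁.D p₂.D p₃.D (R₁ u) (R₂ u) (R₄ u))⁻¹
                * (p₂.D ^ 2 - p₃.D ^ 2) * (p₃.D * R₄ u - p₁.D * R₁ u) - p₂.D ^ 2 * p₁.D * R₁ u ∧
            p₁.D * p₂.D * p₃.D * R₇ u =
              (p₁.D ^ 2 * p₂.D * R₂ u - p₂.D ^ 2 * p₁.D * R₁ u)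
                * (box p₁.D p₂.D p₃.D (R₁ u) (R₂ u) (R₄ u))⁻¹
                * (p₃.D ^ 2 - p₁.D ^ 2) * (p₂.D * R₂ u - p₃.D * R₄ u) - p₁.D ^ 2 * p₂.D * R₂ u ∧
            p₁.D * p₂.D * p₃.D * R₇ u =
              p₂.D * ((p₃.D ^ 2 - p₁.D ^ 2) * p₁.D * R₃ u * (p₃.D * R₆ u - p₁.D * R₃ u)⁻¹ * R₂ u
                - p₁.D ^ 2 * R₂ u)) ∧
          (∀ u ∈ U, IsOrth (R₇ u)) ∧
          (backlund p₃ S₃ R₇).AgreeOn U (backlund p₂ S₅ R₇) ∧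
          (backlund p₃ S₃ R₇).AgreeOn U (backlund p₁ S₆ R₇) ∧
          IsRealized a α U (backlund p₃ S₃ R₇) ∧
          IsBacklundTransform p₃ U S₃ (backlund p₃ S₃ R₇) ∧
          IsBacklundTransform p₂ U S₅ (backlund p₃ S₃ R₇) ∧
          IsBacklundTransform p₁ U S₆ (backlund p₃ S₃ R₇)) ∧
      -- iteration any number of times
      (∀ (N : ℕ) (p : Fin N → SpectralParam a) (R : Fin N → Pt n → Mat n),
        (∀ i, IsPetersonRiccati (p i) U (R i)) → (∀ i, ∀ u ∈ U, IsOrth (R i u)) →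
        IterNondegenerate p R U →
        (∀ l : List (Fin N), l.Nodup → IsRealized a α U (iterDatum p (petersonDatum α c) R l)) ∧
        (∀ (i : Fin N) (l : List (Fin N)), (i :: l).Nodup →
          IsBacklundTransform (p i) U (iterDatum p (petersonDatum α c) R l)
            (iterDatum p (petersonDatum α c) R (i :: l))) ∧
        (∀ l l' : List (Fin N), l.Nodup → l.Perm l' →
          (iterDatum p (petersonDatum α c) R l).AgreeOn U (iterDatum p (petersonDatum α c) R l')))) ∧
    -- the iterated solutions depend on arbitrarily many constants
    (∀ (N : ℕ) (p : Fin N → SpectralParam a), (∀ i j, i ≠ j → (p i).z ≠ (p j).z) → ∀ u₀ : Pt n,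
      ∃ ε : ℝ, 0 < ε ∧ ∀ K : Fin N → Mat n, (∀ i, (K i)ᵀ = -K i) → (∀ i j k, ‖K i j k‖ < ε) →
        (∀ i, ∀ u ∈ Metric.ball u₀ ε, (expZ (p i) (K i - (1 / 2 : ℂ) • 1) u).det ≠ 0) ∧
        IterNondegenerate p (fun i => explicitR (p i) (K i - (1 / 2 : ℂ) • 1))
          (Metric.ball u₀ ε) ∧
        ∀ K' : Fin N → Mat n, (∀ i, (K' i)ᵀ = -K' i) → (∀ i j k, ‖K' i j k‖ < ε) →
          ∀ (l : List (Fin N)) (i : Fin N), l.Nodup → i ∈ l → (∀ j, j ≠ i → K j = K' j) →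
          ∀ u ∈ Metric.ball u₀ ε,
            iterR p (fun i => explicitR (p i) (K i - (1 / 2 : ℂ) • 1)) l u
              = iterR p (fun i => explicitR (p i) (K' i - (1 / 2 : ℂ) • 1)) l u →
            K i = K' i) := by
  have hn0 : n ≠ 0 := by omega
  refine ⟨fun U hU hc V L => isVLSolution_one_iff ha hα hU hc V L,
    fun U hU hc S hR hVL hL hF hx hdx hI =>
      exists_agreeOn_petersonDatum hn0 ha hα hU hc hR hVL.toIsLinearSolution hL hF hx hdx hI,
    fun c hc => ⟨(petersonDatum_isDeformationDatum hα hc).isRealized ha hα hn0,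
      fun U hU hreg => petersonDatum_isPeterson ha hα hn0 hc hU hreg⟩,
    fun U hU V x h u₀ hu₀ => h.exists_petersonDatum hn0 hU ha hα hu₀,
    fun p U hU hc u₀ hu₀ R₁ h₀ => isPetersonRiccati_iff hU hc hu₀ h₀,
    fun p u₀ M hM => existsUnique_explicitR_eq u₀ hM,
    fun p ζ u h => isOrth_explicitR_iff h,
    fun p U hU hc R₁ h ⟨u₀, hu₀, h₀⟩ => h.isOrth hU hc.isPreconnected hu₀ h₀,
    fun c hc U hU => ?_, fun N p hz u₀ => ?_⟩
  · have hS : IsDeformationDatum a U (petersonDatum α c) := petersonDatum_isDeformationDatum hα hc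
    have hS1 : (petersonDatum α c).R = fun _ => 1 := rfl
    refine ⟨fun p R₁ hR₁ h₁ => ?_, ?_, ?_, fun N p R hR hO hN => ?_⟩
    · have hR := isRiccati_one_iff.2 hR₁
      exact ⟨(backlund_isDeformationDatum hn0 hU hS hR h₁).isRealized ha hα hn0,
        backlund_isBacklundTransform hn0 hS hR h₁⟩
    · rintro p₁ p₂ R₁ R₂ hR₁ h₁ hR₂ h₂ hd R₃ hR₃ S₁ S₂ S₃ rfl rfl rfl
      have k₁ := isRiccati_one_iff.2 hR₁
      have k₂ := isRiccati_one_iff.2 hR₂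
      obtain ⟨h₃, r₁₃, r₂₃, g⟩ := bianchi_permutability (R₃ := R₃) hU hS k₁ h₁ k₂ h₂
        (fun u hu => (det_denominator_ne_zero_iff (h₁ u hu)).1 (hd u hu))
        (fun u hu => by rw [hS1, Matrix.mul_one]; exact hR₃ u hu)
      have hS₁ := backlund_isDeformationDatum hn0 hU hS k₁ h₁
      have hS₂ := backlund_isDeformationDatum hn0 hU hS k₂ h₂
      exact ⟨h₃, g, (backlund_isDeformationDatum hn0 hU hS₁ r₁₃ h₃).isRealized ha hα hn0,
        backlund_isBacklundTransform hn0 hS₁ r₁₃ h₃,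
        (backlund_isBacklundTransform hn0 hS₂ r₂₃ h₃).congr hU g.symm⟩
    · intro p₁ p₂ p₃ R₁ R₂ R₄ hR₁ h₁ hR₂ h₂ hR₄ h₄ d₁₂ d₁₃ d₂₃ hb R₃ R₅ R₆ h₃ h₅ h₆ S₃ S₅ S₆ e₃ e₅ e₆
      have k₁₂ := fun u hu => (det_denominator_ne_zero_iff (h₁ u hu)).1 (d₁₂ u hu)
      have k₁₃ := fun u hu => (det_denominator_ne_zero_iff (h₁ u hu)).1 (d₁₃ u hu)
      have k₂₃ := fun u hu => (det_denominator_ne_zero_iff (h₂ u hu)).1 (d₂₃ u hu)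
      obtain ⟨hd, hm⟩ := moebius_configuration ha hn0 hU hS hS1 (isRiccati_one_iff.2 hR₁) h₁
        (isRiccati_one_iff.2 hR₂) h₂ (isRiccati_one_iff.2 hR₄) h₄ k₁₂ k₁₃ k₂₃ hb h₃ h₅ h₆
      obtain ⟨o₇, g, g', hD, b₃, b₂, b₁⟩ := hm (fun u => bianchi p₂.D p₃.D (R₃ u) (R₅ u) * R₁ u)
        (fun u _ => rfl) S₃ S₅ S₆ e₃ e₅ e₆
      exact ⟨hd, _, fun u hu => moebius_formulas (h₁ u hu) (h₂ u hu) (k₁₂ u hu) (k₁₃ u hu)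
        (k₂₃ u hu) (hb u hu) (h₃ u hu) (h₅ u hu) (h₆ u hu) rfl, o₇, g, g',
        hD.isRealized ha hα hn0, b₃, b₂, b₁⟩
    · have hR' := fun i => isRiccati_one_iff.2 (hR i)
      exact ⟨fun l hl => (iterDatum_isDeformationDatum hn0 hU hS hS1 hR' hO hN l hl).1.isRealized
          ha hα hn0,
        fun i l hl => iterDatum_isBacklundTransform hn0 hU hS hS1 hR' hO hN hl,
        fun l l' hl hp => iterDatum_perm ha hn0 hU hS hS1 hR' hO hN hp hl⟩
  · obtain ⟨ε, hε, h⟩ := exists_iterNondegenerate hz u₀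
    refine ⟨ε, hε, fun K hK hKε => ⟨(h K hKε).1, (h K hKε).2, ?_⟩⟩
    intro K' hK' hKε' l i hl hi hne u hu he
    exact skewR_iterR_injective ha hz hK hK' (h K hKε).1 (h K' hKε').1 (h K hKε).2 (h K' hKε').2
      hl hi hne hu he
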